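/- All vector spaces are over $\mathbb{R}$. An $A_\infty$-algebra $(A,m)$ is a $\mathbb{Z}$-graded vector space $A$ with linear maps $m_n:A^{\otimes n}\to A$ ($n\ge 1$) of degree $2-n$ such that, for all $n\ge1$, $$\sum_{i+l+r=n,\ l\ge1}(-1)^{(i+1)(l+1)}\,m_{i+1+r}\circ(\mathrm{id}^{\otimes i}\otimes m_l\otimes \mathrm{id}^{\otimes r})=0 .$$ An $A_\infty$-morphism $f:(A,m)\to(A',m')$ is a family of linear maps $f_n:A^{\otimes n}\to A'$ ($n\ge1$) of degree $1-n$ such that, for all $n\ge1$, $$\sum_{k_1+\cdots+k_l=n}(-1)^{\sum_{j}k_j(l-j)+\sum_{\nu<\mu}k_\nu k_\mu}\,m'_l\circ(f_{k_1}\otimes\cdots\otimes f_{k_l})=\sum_{i+l+r=n,\ l\ge 1}(-1)^{1+n+(i+1)(l+1)}f_{i+1+r}\circ(\mathrm{id}^{\otimes i}\otimes m_l\otimes\mathrm{id}^{\otimes r}),$$ where all $l,k_j\ge 1$ and tensor products of maps are evaluated with the Koszul sign rule. It is an $A_\infty$-quasi-isomorphism if $f_1:(A,m_1)\to(A',m_1')$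 induces an isomorphism on cohomology. Let $A[1]^k=A^{k+1}$, let $s:A\to A[1]$ be the suspension, and let $T^c(A[1])=\bigoplus_{n\ge0}A[1]^{\otimes n}$ with the deconcatenation coproduct $\Delta$. Put $\bar m_n=s\circ m_n\circ(s^{-1})^{\otimes n}$ and $\bar f_n=s\circ f_n\circ(s^{-1})^{\otimes n}$. The bar construction of $m$ is the coderivation $\mathfrak m=\sum \mathrm{id}^{\otimes i}\otimes\bar m_l\otimes\mathrm{id}^{\otimes r}$ of $T^c(A[1])$, and that of $f$ is the coalgebra map $\mathfrak f=\sum\bar f_{k_1}\otimes\cdots\otimes\bar f_{k_l}:T^c(A[1])\to T^c(A'[1])$, with $\mathfrak f(1)=1$. The composition $g\circ f$ of $A_\infty$-morphisms is defined by $\mathfrak g\circ\mathfrak f$. Two $A_\infty$-morphisms $f,g:(A,m)\to(A',m')$ are $A_\infty$-homotopic, $f\sim g$, if there are $A_\infty$-morphisms $f(t):(A,m)\to(A',m')$ and linear maps $\mathfrak h(t):T^c(A[1])\to T^c(A'[1])$ of degree $-1$ with $\mathfrak h(t)(1)=0$ that are coderivations over $\mathfrak f(t)$, i.e. $\Delta\,\mathfrak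 h(t)=(\mathfrak f(t)\otimes\mathfrak h(t)+\mathfrak h(t)\otimes\mathfrak f(t))\Delta$ (with Koszul signs), parametrized piecewise smoothly by $t\in[0,1]$, such that $f(0)=f$, $f(1)=g$ and $$\frac{d\mathfrak f}{dt}(t)=\mathfrak m'\circ\mathfrak h(t)+\mathfrak h(t)\circ\mathfrak m .$$ Here piecewise smoothly means that there is a partition $0=t_0<\cdots<t_N=1$ such that, on each $[t_{i-1},t_i]$ and for every $x\in T^c(A[1])$, the curves $t\mapsto\mathfrak f(t)(x)$ and $t\mapsto\mathfrak h(t)(x)$ are smooth (all their compositions with linear functionals are $C^\infty$ up to the end points; equivalently, they are smooth curves in a finite-dimensional subspace) and satisfy the equation there, with one-sided derivatives at the end points. The curves $\mathfrak f(t)(x)$ are continuous on $[0,1]$, while $\mathfrak h$ may jump at the points $t_i$, where it has one value for each of the two adjacent pieces. **Theorem.** Let $(A,m)$ and $(A',m')$ be $A_\infty$-algebras over $\mathbb{R}$. An $A_\infty$-morphism $f:(A,m)\to(A',m')$ is an $A_\infty$-quasi-isomorphism if and only if it is an $A_\infty$-homotopy equivalence, i.e. there exists an $A_\infty$-morphism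 $g:(A',m')\to(A,m)$ such that $g\circ f\sim\mathrm{id}_A$ and $f\circ g\sim\mathrm{id}_{A'}$. -/

import Mathlib

open scoped TensorProduct DirectSum ContDiff

noncomputable section

namespace AInfty

/-! ### Graded vector spaces and families of multilinear maps

A `ℤ`-graded real vector space is a real vector space `A` with an internal grading
`𝒜 : ℤ → Submodule ℝ A`, `A = ⨁ k, 𝒜 k`. -/

section Graded

variable {A : Type*} [AddCommGroup A] [Module ℝ A]

/-- The Koszul sign operator `x ↦ (-1)^|x| x` of a graded vector space. Moving a homogeneous map of
degree `d` past an argument `x` amounts to applying the `d`-th power of this operator to `x`. -/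
def parity (𝒜 : ℤ → Submodule ℝ A) [DirectSum.Decomposition 𝒜] : A →ₗ[ℝ] A :=
  DirectSum.toModule ℝ ℤ A (fun k => ((Int.negOnePow k : ℤˣ) : ℤ) • (𝒜 k).subtype) ∘ₗ
    (DirectSum.decomposeLinearEquiv 𝒜).toLinearMap

theorem parity_apply_of_mem (𝒜 : ℤ → Submodule ℝ A) [DirectSum.Decomposition 𝒜] {k : ℤ} {x : A}
    (hx : x ∈ 𝒜 k) : parity 𝒜 x = ((Int.negOnePow k : ℤˣ) : ℤ) • x := by
  lift x to 𝒜 k using hx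
  simp [parity]

/-- The grading of `A[1]`, `A[1]^k = A^(k+1)`. The underlying vector spaces of `A` and `A[1]` are
the same, and the suspension `s : A → A[1]` is the identity map (of degree `-1`). -/
def shift (𝒜 : ℤ → Submodule ℝ A) : ℤ → Submodule ℝ A := fun k => 𝒜 (k + 1)

/-- The Koszul sign operator `x ↦ (-1)^|x| x` of `A[1]`. -/
def sparity (𝒜 : ℤ → Submodule ℝ A) [DirectSum.Decomposition 𝒜] : A →ₗ[ℝ] A := -parity 𝒜

theorem sparity_apply_of_mem (𝒜 : ℤ → Submodule ℝ A) [DirectSum.Decomposition 𝒜] {k : ℤ} {x : A}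
    (hx : x ∈ shift 𝒜 k) : sparity 𝒜 x = ((Int.negOnePow k : ℤˣ) : ℤ) • x := by
  have h := parity_apply_of_mem 𝒜 (k := k + 1) hx
  simp only [sparity, LinearMap.neg_apply, h, Int.negOnePow_succ]
  simp

end Graded

section Families

variable {A B C : Type*} [AddCommGroup A] [Module ℝ A] [AddCommGroup B] [Module ℝ B]
  [AddCommGroup C] [Module ℝ C]

/-- A family of linear maps `A^{⊗n} → B`, given as multilinear maps, one for every arity `n`. -/
abbrev Family (A B : Type*) [AddCommGroup A] [Module ℝ A] [AddCommGroup B] [Module ℝ B] :=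
  ∀ n : ℕ, MultilinearMap ℝ (fun _ : Fin n => A) B

/-- The member of arity one, as a linear map. -/
def Family.linear (f : Family A B) : A →ₗ[ℝ] B :=
  (MultilinearMap.ofSubsingleton ℝ A B (0 : Fin 1)).symm (f 1)

/-- The family whose only nonzero member is `φ`, in arity one. -/
def linFamily (φ : A →ₗ[ℝ] B) : Family A B
  | 0 => 0
  | 1 => MultilinearMap.ofSubsingleton ℝ A B (0 : Fin 1) φ
  | _ + 2 => 0

/-- Precompose every argument of every member with `σ`. -/
def Family.precomp (f : Family A B) (σ : A →ₗ[ℝ] A) : Family A B :=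
  fun n => (f n).compLinearMap (fun _ => σ)

/-- `f n` has degree `d n`: it maps homogeneous `v 0, …, v (n-1)` of degrees `e 0, …, e (n-1)` to
degree `∑ i, e i + d n`. -/
def Family.HasDegree (𝒜 : ℤ → Submodule ℝ A) (ℬ : ℤ → Submodule ℝ B) (d : ℕ → ℤ)
    (f : Family A B) : Prop :=
  ∀ (n : ℕ) (e : Fin n → ℤ) (v : Fin n → A), (∀ i, v i ∈ 𝒜 (e i)) →
    f n v ∈ ℬ (∑ i, e i + d n)

/-- For a composition `n = k₀ + ⋯ + k_(l-1)`, cut `v` into consecutive blocks of these lengths and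
apply to the `i`-th block the member of arity `kᵢ` of the family `φ i`: without Koszul signs, this
is `(φ₀_{k₀} ⊗ ⋯ ⊗ φ_(l-1)_{k_(l-1)}) (v)`. -/
def applyBlocks {n : ℕ} (c : Composition n) (φ : Fin c.length → Family A B) (v : Fin n → A) :
    Fin c.length → B :=
  fun i => φ i (c.blocksFun i) (v ∘ c.embedding i)

theorem applyBlocks_update {n : ℕ} (c : Composition n) (φ : Fin c.length → Family A B)
    (j : Fin n) (v : Fin n → A) (z : A) :
    applyBlocks c φ (Function.update v j z) =
      Function.update (applyBlocks c φ v) (c.index j)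
        (φ (c.index j) (c.blocksFun (c.index j))
          (Function.update (v ∘ c.embedding (c.index j)) (c.invEmbedding j) z)) := by
  ext k
  by_cases h : k = c.index j
  · subst h
    simp only [applyBlocks, Function.update_self]
    congr 1
    have C : Function.update v (c.embedding (c.index j) (c.invEmbedding j)) z ∘
        c.embedding (c.index j) =
        Function.update (v ∘ c.embedding (c.index j)) (c.invEmbedding j) z :=
      Function.update_comp_eq_of_injective _ (c.embedding _).injective _ _
    rw [c.embedding_comp_inv] at C
    exact C
  · simp only [h, Function.update_of_ne, Ne, not_false_iff, applyBlocks]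
    congr 1
    apply Function.update_comp_eq_of_notMem_range
    rwa [c.mem_range_embedding_iff']

/-- The multilinear map `v ↦ g (applyBlocks c φ v)`. -/
def compBlocks {n : ℕ} (c : Composition n) (φ : Fin c.length → Family A B)
    (g : MultilinearMap ℝ (fun _ : Fin c.length => B) C) :
    MultilinearMap ℝ (fun _ : Fin n => A) C :=
  MultilinearMap.mk' (fun v => g (applyBlocks c φ v))
    (fun v i x y => by
      simp only [applyBlocks_update, MultilinearMap.map_update_add])
    (fun v i a x => by
      simp only [applyBlocks_update, MultilinearMap.map_update_smul])

/-- The blocks of `id^{⊗i} ⊗ m_l ⊗ id^{⊗r}`, with `σ` applied to the arguments that `m_l` has moved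
past. In `applyBlocks c (insertion σ m i)` all blocks other than the `i`-th one have to be of
length one: otherwise an entry is zero. So a sum over all compositions `c` of `n` and all
`i < c.length` of terms built from it is the sum over all decompositions `n = i + l + r`, `l ≥ 1`,
with `l = c.blocksFun i` and `c.length = i + 1 + r`. -/
def insertion (σ : A →ₗ[ℝ] A) (m : Family A A) {k : ℕ} (i j : Fin k) : Family A A :=
  if j < i then linFamily σ else if j = i then m else linFamily LinearMap.id

end Families

/-! ### `A_∞`-algebras and `A_∞`-morphisms -/

section Structures

variable {A B : Type*} [AddCommGroup A] [Module ℝ A] [AddCommGroup B] [Module ℝ B]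
variable (𝒜 : ℤ → Submodule ℝ A) [DirectSum.Decomposition 𝒜]
variable (ℬ : ℤ → Submodule ℝ B)

/-- `(A, m)` is an `A_∞`-algebra: `m = (m_n)_{n ≥ 1}` with `deg m_n = 2 - n` and
`∑_{i + l + r = n} (-1)^((i+1)(l+1)) m_{i+1+r} ∘ (id^{⊗i} ⊗ m_l ⊗ id^{⊗r}) = 0` for all `n`. A family
indexed by `n ≥ 1` is a family indexed by `ℕ` that vanishes at `0`. -/
structure IsAlgebra (m : Family A A) : Prop where
  zero : m 0 = 0
  degree : m.HasDegree 𝒜 𝒜 (fun n => 2 - n)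
  relation : ∀ (n : ℕ) (v : Fin n → A),
    ∑ c : Composition n, ∑ i : Fin c.length,
      (-1 : ℝ) ^ (((i : ℕ) + 1) * (c.blocksFun i + 1)) •
        m c.length (applyBlocks c (insertion (parity 𝒜 ^ c.blocksFun i) m i) v) = 0

/-- The exponent `∑_j k_j (l - j) + ∑_{ν < μ} k_ν k_μ` (`j = 1, …, l`) of the sign in the relations
of an `A_∞`-morphism, for a composition `k_1 + ⋯ + k_l` of `n`. -/
def signExponent {n : ℕ} (c : Composition n) : ℕ :=
  (∑ j : Fin c.length, c.blocksFun j * (c.length - 1 - (j : ℕ))) +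
    ∑ μ : Fin c.length, ∑ ν : Fin c.length,
      if ν < μ then c.blocksFun ν * c.blocksFun μ else 0

/-- `f = (f_n)_{n ≥ 1}` is an `A_∞`-morphism `(A, m) → (B, m')`: `deg f_n = 1 - n` and, for all `n`,
`∑ (-1)^(signExponent) m'_l ∘ (f_{k_1} ⊗ ⋯ ⊗ f_{k_l}) =
  ∑_{i + l + r = n} (-1)^(1 + n + (i+1)(l+1)) f_{i+1+r} ∘ (id^{⊗i} ⊗ m_l ⊗ id^{⊗r})`.
On the left, the arguments of the `i`-th block are moved past by all `f_{k_μ}`, `μ > i`, whose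
degrees are `1 - k_μ ≡ k_μ + 1` modulo two. -/
structure IsMorphism (m : Family A A) (m' : Family B B) (f : Family A B) : Prop where
  zero : f 0 = 0
  degree : f.HasDegree 𝒜 ℬ (fun n => 1 - n)
  relation : ∀ (n : ℕ) (v : Fin n → A),
    ∑ c : Composition n, (-1 : ℝ) ^ signExponent c •
        m' c.length (applyBlocks c (fun i => f.precomp
          (parity 𝒜 ^ ∑ μ : Fin c.length, if i < μ then c.blocksFun μ + 1 else 0)) v) =
      ∑ c : Composition n, ∑ i : Fin c.length,
        (-1 : ℝ) ^ (1 + n + ((i : ℕ) + 1) * (c.blocksFun i + 1)) •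
          f c.length (applyBlocks c (insertion (parity 𝒜 ^ c.blocksFun i) m i) v)

theorem sum_composition_one {M : Type*} [AddCommMonoid M] (g : Composition 1 → M) :
    ∑ c, g c = g (Composition.single 1 one_pos) := by
  have h : ∀ c : Composition 1, c = Composition.single 1 one_pos := fun c => by
    rw [Composition.eq_single_iff_length]
    have h1 := c.length_le
    have h2 := c.length_pos_of_pos one_pos
    omega
  exact Fintype.sum_eq_single _ (fun c hc => absurd (h c) hc)

/-- The relation for `n = 1`: `f_1` is a chain map. -/
theorem IsMorphism.chain {m : Family A A} {m' : Family B B} {f : Family A B}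
    (hf : IsMorphism 𝒜 ℬ m m' f) (x : A) :
    m'.linear (f.linear x) = f.linear (m.linear x) := by
  have h := hf.relation 1 (fun _ => x)
  rw [sum_composition_one, sum_composition_one] at h
  change _ • m' 1 _ = ∑ i : Fin 1, _ • f 1 _ at h
  rw [Fin.sum_univ_one] at h
  have e1 : signExponent (Composition.single 1 one_pos) = 0 := rfl
  have e2 : ∀ i : Fin (Composition.single 1 one_pos).length,
      (∑ μ : Fin (Composition.single 1 one_pos).length,
        if i < μ then (Composition.single 1 one_pos).blocksFun μ + 1 else 0) = 0 := by decide
  have e4 : (-1 : ℝ) ^ (1 + 1 + (((0 : Fin 1) : ℕ) + 1) *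
      ((Composition.single 1 one_pos).blocksFun (0 : Fin 1) + 1)) = 1 := by
    change (-1 : ℝ) ^ (1 + 1 + (0 + 1) * (1 + 1)) = 1
    norm_num
  rw [e1, e4, pow_zero, one_smul, one_smul] at h
  simp only [e2, pow_zero] at h
  have e5 : (applyBlocks (Composition.single 1 one_pos) (fun _ => f.precomp 1) (fun _ => x) :
      Fin 1 → B) = fun _ => f 1 (fun _ => x) := by
    funext i
    fin_cases i
    rfl
  have e6 : (applyBlocks (Composition.single 1 one_pos) (insertion
      (parity 𝒜 ^ (Composition.single 1 one_pos).blocksFun (0 : Fin 1)) m (0 : Fin 1))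
      (fun _ => x) : Fin 1 → A) = fun _ => m 1 (fun _ => x) := by
    funext i
    fin_cases i
    rfl
  exact ((congrArg (m' 1) e5).symm.trans h).trans (congrArg (f 1) e6)

/-- The cohomology `ker d / im d`. -/
abbrev Cohomology (d : A →ₗ[ℝ] A) : Type _ :=
  LinearMap.ker d ⧸ (LinearMap.range d).submoduleOf (LinearMap.ker d)

/-- The map induced on cohomology by a chain map. -/
def cohomologyMap {d : A →ₗ[ℝ] A} {d' : B →ₗ[ℝ] B} (φ : A →ₗ[ℝ] B) (h : ∀ x, d' (φ x) = φ (d x)) :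
    Cohomology d →ₗ[ℝ] Cohomology d' :=
  Submodule.mapQ _ _
    (φ.restrict (p := LinearMap.ker d) (q := LinearMap.ker d') (fun x hx => by
      rw [LinearMap.mem_ker] at hx ⊢
      rw [h, hx, map_zero]))
    (by
      rintro ⟨x, hx⟩ hxr
      simp only [Submodule.mem_comap, Submodule.submoduleOf, Submodule.subtype_apply] at hxr ⊢
      obtain ⟨y, hy⟩ := hxr
      exact ⟨φ y, by rw [h, hy]; rfl⟩)

/-- `f` is an `A_∞`-quasi-isomorphism: `f_1 : (A, m_1) → (B, m'_1)` induces an isomorphism on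
cohomology. -/
def IsQuasiIso {m : Family A A} {m' : Family B B} {f : Family A B}
    (hf : IsMorphism 𝒜 ℬ m m' f) : Prop :=
  Function.Bijective (cohomologyMap (d := m.linear) (d' := m'.linear) f.linear (hf.chain 𝒜 ℬ))

end Structures

/-! ### The tensor coalgebra and the bar construction -/

section Bar

/-- The vector space underlying `T^c(A[1])`, `⨁ n, A[1]^{⊗n}`. -/
abbrev TensorCoalgebra (A : Type*) [AddCommGroup A] [Module ℝ A] : Type _ :=
  ⨁ n : ℕ, ⨂[ℝ]^n A

variable {A B C : Type*} [AddCommGroup A] [Module ℝ A] [AddCommGroup B] [Module ℝ B]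
  [AddCommGroup C] [Module ℝ C]
variable (𝒜 : ℤ → Submodule ℝ A) [DirectSum.Decomposition 𝒜]
variable (ℬ : ℤ → Submodule ℝ B) [DirectSum.Decomposition ℬ]

/-- The multilinear map `v ↦ v 0 ⊗ ⋯ ⊗ v (n-1)` into the tensor coalgebra. -/
def pureTensor (n : ℕ) : MultilinearMap ℝ (fun _ : Fin n => A) (TensorCoalgebra A) :=
  (DirectSum.lof ℝ ℕ (fun n => ⨂[ℝ]^n A) n).compMultilinearMap (PiTensorProduct.tprod ℝ)

/-- The linear map on the tensor coalgebra with given values on all `v 0 ⊗ ⋯ ⊗ v (n-1)`. -/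
def liftPure {V : Type*} [AddCommGroup V] [Module ℝ V]
    (φ : ∀ n : ℕ, MultilinearMap ℝ (fun _ : Fin n => A) V) : TensorCoalgebra A →ₗ[ℝ] V :=
  DirectSum.toModule ℝ ℕ V (fun n => PiTensorProduct.lift (φ n))

theorem liftPure_pureTensor {V : Type*} [AddCommGroup V] [Module ℝ V]
    (φ : ∀ n : ℕ, MultilinearMap ℝ (fun _ : Fin n => A) V) (n : ℕ) (v : Fin n → A) :
    liftPure φ (pureTensor n v) = φ n v := by
  simp [liftPure, pureTensor]

/-- The projection `T^c(A[1]) → A[1]` onto the tensors of length one. -/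
def cogenerators : TensorCoalgebra A →ₗ[ℝ] A := liftPure (linFamily LinearMap.id)

/-- The deconcatenation coproduct,
`Δ (a_1 ⊗ ⋯ ⊗ a_n) = ∑_{k=0}^n (a_1 ⊗ ⋯ ⊗ a_k) ⊗ (a_(k+1) ⊗ ⋯ ⊗ a_n)`. -/
def coproduct : TensorCoalgebra A →ₗ[ℝ] TensorCoalgebra A ⊗[ℝ] TensorCoalgebra A :=
  DirectSum.toModule ℝ ℕ _ (fun n => ∑ p : Finset.HasAntidiagonal.antidiagonal n,
    TensorProduct.map (DirectSum.lof ℝ ℕ (fun n => ⨂[ℝ]^n A) p.1.1)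
        (DirectSum.lof ℝ ℕ (fun n => ⨂[ℝ]^n A) p.1.2) ∘ₗ
      (TensorPower.mulEquiv (R := ℝ) (M := A) (n := p.1.1) (m := p.1.2)).symm.toLinearMap ∘ₗ
      (TensorPower.cast ℝ A (Finset.HasAntidiagonal.mem_antidiagonal.1 p.2).symm).toLinearMap)

theorem coproduct_pureTensor (n : ℕ) (v : Fin n → A) :
    coproduct (pureTensor n v) = ∑ p : Finset.HasAntidiagonal.antidiagonal n,
      pureTensor p.1.1 (fun i => v ⟨i, by
        have := Finset.HasAntidiagonal.mem_antidiagonal.1 p.2; omega⟩) ⊗ₜ[ℝ]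
      pureTensor p.1.2 (fun i => v ⟨p.1.1 + i, by
        have := Finset.HasAntidiagonal.mem_antidiagonal.1 p.2; omega⟩) := by
  simp only [coproduct, pureTensor, LinearMap.compMultilinearMap_apply, DirectSum.toModule_lof,
    LinearMap.sum_apply]
  refine Finset.sum_congr rfl fun p _ => ?_
  obtain ⟨⟨a, b⟩, hp⟩ := p
  have hp' := Finset.HasAntidiagonal.mem_antidiagonal.1 hp
  simp only at hp'
  subst hp'
  simp only [LinearMap.comp_apply, LinearEquiv.coe_coe, TensorPower.cast_tprod]
  have key : (TensorPower.mulEquiv (R := ℝ) (M := A) (n := a) (m := b)).symm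
      (PiTensorProduct.tprod ℝ v) =
      PiTensorProduct.tprod ℝ (fun i : Fin a => v (Fin.castAdd b i)) ⊗ₜ
        PiTensorProduct.tprod ℝ (fun i : Fin b => v (Fin.natAdd a i)) := by
    rw [LinearEquiv.symm_apply_eq, ← TensorPower.gMul_def, TensorPower.tprod_mul_tprod,
      Fin.append_castAdd_natAdd]
  exact (congrArg _ key).trans (TensorProduct.map_tmul _ _ _ _)

/-- The Koszul sign operator `x ↦ (-1)^|x| x` of `T^c(A[1])`. -/
def tensorParity : TensorCoalgebra A →ₗ[ℝ] TensorCoalgebra A :=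
  liftPure (fun n => (pureTensor n).compLinearMap (fun _ => sparity 𝒜))

/-- The part of degree `k` of `T^c(A[1])`, where `|a_1 ⊗ ⋯ ⊗ a_n| = |a_1| + ⋯ + |a_n|` with the
degrees of `A[1]`. -/
def tensorGrading (k : ℤ) : Submodule ℝ (TensorCoalgebra A) :=
  Submodule.span ℝ {x | ∃ (n : ℕ) (e : Fin n → ℤ) (v : Fin n → A),
    (∀ i, v i ∈ shift 𝒜 (e i)) ∧ ∑ i, e i = k ∧ x = pureTensor n v}

/-- The suspension `s ∘ f_n ∘ (s^{-1})^{⊗n}` of a family `f_n : A^{⊗n} → B`. In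
`(s^{-1})^{⊗n} (x_1 ⊗ ⋯ ⊗ x_n)` the argument `x_j` is moved past by `n - j` maps `s^{-1}`, which have
degree one. -/
def suspend (f : Family A B) : Family A B :=
  fun n => (f n).compLinearMap (fun j => sparity 𝒜 ^ (j.rev : ℕ))

/-- The family with a given suspension. As the sign operators are involutions, this is given by the
same formula. -/
def desuspend (f : Family A B) : Family A B :=
  fun n => (f n).compLinearMap (fun j => sparity 𝒜 ^ (j.rev : ℕ))

theorem suspend_desuspend (f : Family A B) : suspend 𝒜 (desuspend 𝒜 f) = f := by
  have h1 : parity 𝒜 * parity 𝒜 = 1 := by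
    ext x
    induction x using DirectSum.Decomposition.inductionOn 𝒜 with
    | zero => simp
    | add a b ha hb => simp_all
    | @homogeneous i a =>
      rw [Module.End.mul_apply, parity_apply_of_mem 𝒜 a.2, map_zsmul,
        parity_apply_of_mem 𝒜 a.2, smul_smul, ← Units.val_mul]
      simp
  have h : sparity 𝒜 * sparity 𝒜 = 1 := by simp [sparity, h1]
  funext n
  ext v
  simp only [suspend, desuspend, MultilinearMap.compLinearMap_apply]
  congr 1
  ext j
  rw [← Module.End.mul_apply, ← (Commute.refl (sparity 𝒜)).mul_pow, h]
  simp

/-- The coderivation `∑_{i + l + r = n} id^{⊗i} ⊗ m̄_l ⊗ id^{⊗r}` of `T^c(A[1])` that extends the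
suspension `m̄`, which has degree one. -/
def barDifferential (m : Family A A) : TensorCoalgebra A →ₗ[ℝ] TensorCoalgebra A :=
  liftPure (fun n => ∑ c : Composition n, ∑ i : Fin c.length,
    compBlocks c (insertion (sparity 𝒜) (suspend 𝒜 m) i) (pureTensor c.length))

/-- The coalgebra map `∑_{k_1 + ⋯ + k_l = n} f̄_{k_1} ⊗ ⋯ ⊗ f̄_{k_l}` given by the suspension `f̄`,
which has degree zero. The empty composition of `0` gives `1 ↦ 1`. -/
def barMap (f : Family A B) : TensorCoalgebra A →ₗ[ℝ] TensorCoalgebra B :=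
  liftPure (fun n => ∑ c : Composition n, compBlocks c (fun _ => suspend 𝒜 f) (pureTensor c.length))

/-- The composition `g ∘ f`, given by the composition of the bar constructions: the suspension of
`(g ∘ f)_n` is the restriction to `A[1]^{⊗n}` of the projection of `barMap g ∘ barMap f` to
`C[1]`. -/
def comp (g : Family B C) (f : Family A B) : Family A C :=
  desuspend 𝒜 (fun n =>
    (cogenerators ∘ₗ barMap ℬ g ∘ₗ barMap 𝒜 f).compMultilinearMap (pureTensor n))

/-- The identity morphism. -/
def idMorphism (A : Type*) [AddCommGroup A] [Module ℝ A] : Family A A := linFamily LinearMap.id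

/-- `D : T^c(A[1]) → T^c(B[1])` is a coderivation of degree `-1` over `F`:
`Δ D = (F ⊗ D + D ⊗ F) Δ`, where `(F ⊗ D) (x ⊗ y) = (-1)^|x| F x ⊗ D y`. As structures and
morphisms have components of arity `n ≥ 1` only, so has `D`: it vanishes on `A[1]^{⊗0}`. -/
structure IsCoderivationOver (F D : TensorCoalgebra A →ₗ[ℝ] TensorCoalgebra B) : Prop where
  degree : ∀ k : ℤ, ∀ x ∈ tensorGrading 𝒜 k, D x ∈ tensorGrading ℬ (k - 1)
  one : D (pureTensor 0 Fin.elim0) = 0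
  coleibniz : coproduct ∘ₗ D =
    (TensorProduct.map (F ∘ₗ tensorParity 𝒜) D + TensorProduct.map D F) ∘ₗ coproduct

end Bar

/-! ### Homotopies -/

section Homotopy

/-- A curve in a real vector space is smooth on `s` if its image under every linear functional is.
(On a compact interval: it takes values in a finite-dimensional subspace and is smooth there.) -/
def SmoothCurveOn {V : Type*} [AddCommGroup V] [Module ℝ V] (γ : ℝ → V) (s : Set ℝ) : Prop :=
  ∀ φ : Module.Dual ℝ V, ContDiffOn ℝ ∞ (fun t => φ (γ t)) s

/-- `w` is the derivative at `t` within `s` of the curve `γ` in a real vector space. -/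
def HasCurveDerivWithinAt {V : Type*} [AddCommGroup V] [Module ℝ V] (γ : ℝ → V) (w : V)
    (s : Set ℝ) (t : ℝ) : Prop :=
  ∀ φ : Module.Dual ℝ V, HasDerivWithinAt (fun t => φ (γ t)) (φ w) s t

variable {A B : Type*} [AddCommGroup A] [Module ℝ A] [AddCommGroup B] [Module ℝ B]
variable (𝒜 : ℤ → Submodule ℝ A) [DirectSum.Decomposition 𝒜]
variable (ℬ : ℤ → Submodule ℝ B) [DirectSum.Decomposition ℬ]

/-- An `A_∞`-homotopy from `f` to `g`: a family of `A_∞`-morphisms `path t`, `t ∈ [0,1]`, and of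
coderivations over their bar constructions, parametrized piecewise smoothly. There is a partition
`0 = τ 0 < ⋯ < τ N = 1`; on each closed piece both are smooth in `t`, pointwise on `T^c(A[1])`, and
the derivative of the bar construction of `path t` is `m' ∘ h t + h t ∘ m`. The coderivations may
jump at the division points: `h i` is the family on the `i`-th piece. -/
structure Homotopy (m : Family A A) (m' : Family B B) (f g : Family A B) where
  N : ℕ
  τ : Fin (N + 1) → ℝ
  τ_strictMono : StrictMono τ
  τ_zero : τ 0 = 0
  τ_last : τ (Fin.last N) = 1
  path : ℝ → Family A B
  h : Fin N → ℝ → (TensorCoalgebra A →ₗ[ℝ] TensorCoalgebra B)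
  path_zero : path 0 = f
  path_one : path 1 = g
  isMorphism : ∀ t ∈ Set.Icc (0 : ℝ) 1, IsMorphism 𝒜 ℬ m m' (path t)
  isCoderivation : ∀ i : Fin N, ∀ t ∈ Set.Icc (τ i.castSucc) (τ i.succ),
    IsCoderivationOver 𝒜 ℬ (barMap 𝒜 (path t)) (h i t)
  smooth_path : ∀ (i : Fin N) (x : TensorCoalgebra A),
    SmoothCurveOn (fun t => barMap 𝒜 (path t) x) (Set.Icc (τ i.castSucc) (τ i.succ))
  smooth_h : ∀ (i : Fin N) (x : TensorCoalgebra A),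
    SmoothCurveOn (fun t => h i t x) (Set.Icc (τ i.castSucc) (τ i.succ))
  deriv_path : ∀ i : Fin N, ∀ t ∈ Set.Icc (τ i.castSucc) (τ i.succ), ∀ x : TensorCoalgebra A,
    HasCurveDerivWithinAt (fun t => barMap 𝒜 (path t) x)
      (barDifferential ℬ m' (h i t x) + h i t (barDifferential 𝒜 m x))
      (Set.Icc (τ i.castSucc) (τ i.succ)) t

/-- `f ∼ g`. -/
def Homotopic (m : Family A A) (m' : Family B B) (f g : Family A B) : Prop :=
  Nonempty (Homotopy 𝒜 ℬ m m' f g)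

/-- `f : (A, m) → (B, m')` is an `A_∞`-homotopy equivalence: there is an `A_∞`-morphism
`g : (B, m') → (A, m)` with `g ∘ f ∼ id` and `f ∘ g ∼ id`. -/
def IsHomotopyEquivalence (m : Family A A) (m' : Family B B) (f : Family A B) : Prop :=
  ∃ g : Family B A, IsMorphism ℬ 𝒜 m' m g ∧
    Homotopic 𝒜 𝒜 m m (comp 𝒜 ℬ g f) (idMorphism A) ∧
    Homotopic ℬ ℬ m' m' (comp ℬ 𝒜 f g) (idMorphism B)

end Homotopy

end AInfty

end

/-! Everything takes place on the bar construction. A coalgebra map `F` with `F 1 = 1`, and a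
coderivation over such maps, is determined by its projection to the letters. In the convolution ring
of linear maps out of the tensor coalgebra, `F` is a geometric series in its components, and a
coderivation is a product `F * δ * G`. In these terms the A_∞ relations say that the bar
differentials `D`, `D'` square to zero and that `F` commutes with them (`IsAlgebra.comp_self`,
`IsMorphism.comm`, `isMorphism_of_comm`). The filtration by word length (`Vanish n`) is
multiplicative and complete, so nonlinear equations can be solved one word length at a time.

Homotopies that start at the identity come from flows. Given components `δ` of degree `-1`, constant
in time, one solves `dF/dt = D h + h D`, where `h` is the coderivation over `F(t)` with components
`δ`. Picard iteration stabilizes on words of each length (`exists_isFlow`); the solution is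
polynomial in `t` on every element and commutes with `D` (`IsFlow.comm_and_deriv`).

For a quasi-isomorphism `f` one looks for a coalgebra map `G` with components `g` and a generator
`δ` such that `G` commutes with the differentials and `F ∘ G` is the time-one flow of `δ`. The pair
`s = (g, δ)` has values in the cone of `f_1`, and `obstruction` measures the failure of both
equations. To leading order it changes by the linear term `∂ η` when `η` is added to `s`, and it is
itself a cocycle to leading order. The cone is acyclic, hence contractible, and an iteration with
the contraction makes the obstruction vanish (`exists_inverse_of_contraction`). So `f` has a right
inverse `g` up to homotopy. Now `g` is again a quasi-isomorphism and has such a right inverse `k`,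
whence `g f ∼ g f g k ∼ g k ∼ id`.

Conversely, homotopic morphisms agree on cohomology: on a cocycle, a functional that kills
boundaries is constant along a homotopy (`Homotopic.exists_linear_eq`). So the linear parts of `f`
and `g` are mutually inverse on cohomology. -/

noncomputable section

namespace AInfty

/-! ### The concatenation product and the coalgebra structure of the tensor coalgebra -/

section Words

variable {A B : Type*} [AddCommGroup A] [Module ℝ A] [AddCommGroup B] [Module ℝ B]

/-- The concatenation product makes `T^c(A[1])` a ring. -/
instance tensorRing : Ring (TensorCoalgebra A) :=
  { (inferInstance : Semiring (TensorCoalgebra A)),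
    (inferInstance : AddCommGroup (TensorCoalgebra A)) with }

/-- The inclusion of the words of length one. -/
def letter : A →ₗ[ℝ] TensorCoalgebra A :=
  (MultilinearMap.ofSubsingleton ℝ A (TensorCoalgebra A) (0 : Fin 1)).symm (pureTensor 1)

theorem letter_apply (a : A) : letter a = pureTensor 1 (fun _ => a) := rfl

/-- Inherited from the comparison of the tensor algebra with the direct sum of tensor powers. Words
can thus be handled as products in a ring. -/
theorem pureTensor_eq_prod {n : ℕ} (v : Fin n → A) :
    pureTensor n v = (List.ofFn (fun i => letter (v i))).prod := by
  have := TensorAlgebra.toDirectSum_tensorPower_tprod (R := ℝ) v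
  rw [TensorAlgebra.tprod_apply, map_list_prod, List.map_ofFn] at this
  simp_rw [Function.comp_def, TensorAlgebra.toDirectSum_ι] at this
  simp only [letter_apply, pureTensor, LinearMap.compMultilinearMap_apply, DirectSum.lof_eq_of]
  exact this.symm

theorem pureTensor_zero (v : Fin 0 → A) : pureTensor 0 v = 1 := by
  simp [pureTensor_eq_prod]

theorem pureTensor_succ {n : ℕ} (v : Fin (n + 1) → A) :
    pureTensor (n + 1) v = letter (v 0) * pureTensor n (fun i => v i.succ) := by
  simp [pureTensor_eq_prod, List.ofFn_succ]

theorem pureTensor_one (v : Fin 1 → A) : pureTensor 1 v = letter (v 0) := by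
  simp [pureTensor_eq_prod]

theorem pureTensor_mul {m n : ℕ} (u : Fin m → A) (v : Fin n → A) :
    pureTensor m u * pureTensor n v = pureTensor (m + n) (Fin.append u v) := by
  simp only [pureTensor_eq_prod, ← List.prod_append]
  congr 1
  rw [← List.ofFn_fin_append]
  congr 1
  funext i
  refine Fin.addCases (fun i => ?_) (fun i => ?_) i <;> simp

/-- Linear maps on the tensor coalgebra are determined by their values on words. -/
theorem linearMap_ext {V : Type*} [AddCommMonoid V] [Module ℝ V] {f g : TensorCoalgebra A →ₗ[ℝ] V}
    (h : ∀ n (v : Fin n → A), f (pureTensor n v) = g (pureTensor n v)) : f = g := by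
  refine DirectSum.linearMap_ext ℝ fun n => PiTensorProduct.ext ?_
  ext v
  exact h n v

theorem span_pureTensor :
    Submodule.span ℝ {x : TensorCoalgebra A | ∃ n v, x = pureTensor n v} = ⊤ := by
  set S := Submodule.span ℝ {x : TensorCoalgebra A | ∃ n v, x = pureTensor n v}
  have h : S.mkQ = 0 := by
    apply linearMap_ext
    intro n v
    rw [LinearMap.zero_apply, Submodule.mkQ_apply, Submodule.Quotient.mk_eq_zero]
    exact Submodule.subset_span ⟨n, v, rfl⟩
  rw [← Submodule.ker_mkQ S, h, LinearMap.ker_zero]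

/-- Induction on words, adding letters on the left. -/
theorem linearMap_ext_letter {V : Type*} [AddCommMonoid V] [Module ℝ V]
    {f g : TensorCoalgebra A →ₗ[ℝ] V} (h1 : f 1 = g 1)
    (h : ∀ a w, f w = g w → f (letter a * w) = g (letter a * w)) : f = g := by
  apply linearMap_ext
  intro n
  induction n with
  | zero => intro v; rwa [pureTensor_zero]
  | succ n ih => intro v; rw [pureTensor_succ]; exact h _ _ (ih _)

theorem coproduct_one : coproduct (1 : TensorCoalgebra A) = 1 := by
  rw [← pureTensor_zero Fin.elim0, coproduct_pureTensor]
  rw [Finset.sum_eq_single ⟨(0, 0), by simp⟩]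
  · simp only [pureTensor_zero]; rfl
  · rintro ⟨⟨a, b⟩, hp⟩ _ h
    exfalso; apply h
    have := Finset.HasAntidiagonal.mem_antidiagonal.1 hp
    simp only at this
    have h1 : a = 0 := by omega
    have h2 : b = 0 := by omega
    subst h1 h2
    rfl
  · exact fun h => absurd (Finset.mem_univ _) h

/-- The coproduct of a word, as a sum over the cutting points. -/
theorem coproduct_word (n : ℕ) (u : ℕ → A) :
    coproduct (pureTensor n (fun i => u i)) = ∑ p ∈ Finset.HasAntidiagonal.antidiagonal n,
      pureTensor p.1 (fun i => u i) ⊗ₜ[ℝ] pureTensor p.2 (fun i => u (p.1 + i)) := by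
  rw [coproduct_pureTensor]
  exact Finset.sum_attach (Finset.HasAntidiagonal.antidiagonal n) (fun p =>
    pureTensor p.1 (fun i => u i) ⊗ₜ[ℝ] pureTensor p.2 (fun i => u (p.1 + i)))

/-- Every word is an initial segment of an infinite sequence. -/
theorem exists_sequence {X : Type*} [Zero X] {n : ℕ} (v : Fin n → X) : ∃ u : ℕ → X, v = fun i : Fin n => u i :=
  ⟨fun i => if h : i < n then v ⟨i, h⟩ else 0, by funext i; simp⟩

/-- A cut of the word `a w` either precedes `a` or lies behind it. This recursion carries the
inductions that establish the coalgebra structure. -/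
theorem coproduct_letter_mul (a : A) (w : TensorCoalgebra A) :
    coproduct (letter a * w) = 1 ⊗ₜ[ℝ] (letter a * w) + (letter a ⊗ₜ[ℝ] 1) * coproduct w := by
  have : coproduct ∘ₗ LinearMap.mulLeft ℝ (letter a) =
      TensorProduct.mk ℝ _ _ 1 ∘ₗ LinearMap.mulLeft ℝ (letter a) +
        LinearMap.mulLeft ℝ (letter a ⊗ₜ[ℝ] 1) ∘ₗ coproduct := by
    apply linearMap_ext
    intro n v
    obtain ⟨u, rfl⟩ := exists_sequence v
    let u' : ℕ → A := fun i => Nat.casesOn i a u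
    have e : letter a * pureTensor n (fun i => u i) = pureTensor (n + 1) (fun i => u' i) := by
      rw [pureTensor_succ]; rfl
    simp only [LinearMap.comp_apply, LinearMap.add_apply, LinearMap.mulLeft_apply,
      TensorProduct.mk_apply, e, coproduct_word]
    rw [Finset.Nat.sum_antidiagonal_succ, pureTensor_zero, Finset.mul_sum]
    congr 1
    · simp
    · refine Finset.sum_congr rfl fun p _ => ?_
      rw [Algebra.TensorProduct.tmul_mul_tmul, one_mul, pureTensor_succ]
      congr 2
      funext i
      exact congrArg u' (Nat.add_right_comm p.1 1 i)
  exact LinearMap.congr_fun this w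

/-- The counit, the projection to the words of length zero. -/
def counitMap : TensorCoalgebra A →ₗ[ℝ] ℝ :=
  liftPure (fun n => if n = 0 then MultilinearMap.mkPiAlgebra ℝ (Fin n) ℝ |>.compLinearMap 0 else 0)

theorem counitMap_pureTensor (n : ℕ) (v : Fin n → A) :
    counitMap (pureTensor n v) = if n = 0 then 1 else 0 := by
  rw [counitMap, liftPure_pureTensor]
  split_ifs with h
  · subst h; simp
  · rfl

theorem counitMap_one : counitMap (1 : TensorCoalgebra A) = 1 := by
  rw [← pureTensor_zero Fin.elim0, counitMap_pureTensor, if_pos rfl]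

theorem counitMap_letter_mul (a : A) (w : TensorCoalgebra A) : counitMap (letter a * w) = 0 := by
  have : counitMap ∘ₗ LinearMap.mulLeft ℝ (letter a) = 0 := by
    apply linearMap_ext
    intro n v
    have : letter a * pureTensor n v = pureTensor (n + 1) (Fin.cons a v) := by
      simp [pureTensor_succ]
    simp [this, counitMap_pureTensor]
  exact LinearMap.congr_fun this w

theorem rTensor_letter_mul {V : Type*} [AddCommGroup V] [Module ℝ V]
    (φ : TensorCoalgebra A →ₗ[ℝ] V) (ψ : TensorCoalgebra A →ₗ[ℝ] V) (a : A)
    (h : ∀ w, φ (letter a * w) = ψ w)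
    (z : TensorCoalgebra A ⊗[ℝ] TensorCoalgebra A) :
    LinearMap.rTensor (TensorCoalgebra A) φ ((letter a ⊗ₜ[ℝ] 1) * z) =
      LinearMap.rTensor (TensorCoalgebra A) ψ z := by
  induction z using TensorProduct.induction_on with
  | zero => simp
  | tmul x y => simp [h]
  | add x y hx hy => rw [mul_add, map_add, map_add, hx, hy]

theorem lTensor_letter_mul {V : Type*} [AddCommGroup V] [Module ℝ V]
    (φ : TensorCoalgebra A →ₗ[ℝ] V) (a : A)
    (z : TensorCoalgebra A ⊗[ℝ] TensorCoalgebra A) :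
    LinearMap.lTensor (TensorCoalgebra A) φ ((letter a ⊗ₜ[ℝ] 1) * z) =
      LinearMap.rTensor V (LinearMap.mulLeft ℝ (letter a))
        (LinearMap.lTensor (TensorCoalgebra A) φ z) := by
  induction z using TensorProduct.induction_on with
  | zero => simp
  | tmul x y => simp
  | add x y hx hy => rw [mul_add, map_add, map_add, hx, hy, map_add]

theorem assoc_tmul_letter_mul (a : A) (z : TensorCoalgebra A ⊗[ℝ] TensorCoalgebra A)
    (y : TensorCoalgebra A) :
    TensorProduct.assoc ℝ _ _ _ (((letter a ⊗ₜ[ℝ] 1) * z) ⊗ₜ[ℝ] y) =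
      LinearMap.rTensor _ (LinearMap.mulLeft ℝ (letter a))
        (TensorProduct.assoc ℝ _ _ _ (z ⊗ₜ[ℝ] y)) := by
  induction z using TensorProduct.induction_on with
  | zero => simp only [mul_zero, TensorProduct.zero_tmul, LinearEquiv.map_zero, LinearMap.map_zero]
  | tmul x y => simp
  | add x y hx hy =>
    rw [mul_add, TensorProduct.add_tmul, TensorProduct.add_tmul, map_add, map_add, hx, hy, map_add]

theorem assoc_rTensor_coproduct_letter_mul (a : A)
    (z : TensorCoalgebra A ⊗[ℝ] TensorCoalgebra A) :
    TensorProduct.assoc ℝ _ _ _ (LinearMap.rTensor (TensorCoalgebra A) coproduct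
        ((letter a ⊗ₜ[ℝ] 1) * z)) =
      1 ⊗ₜ[ℝ] ((letter a ⊗ₜ[ℝ] 1) * z) +
        LinearMap.rTensor _ (LinearMap.mulLeft ℝ (letter a)) (TensorProduct.assoc ℝ _ _ _
          (LinearMap.rTensor (TensorCoalgebra A) coproduct z)) := by
  induction z using TensorProduct.induction_on with
  | zero =>
    simp only [mul_zero, TensorProduct.tmul_zero, LinearEquiv.map_zero, LinearMap.map_zero,
      add_zero]
  | tmul x y =>
    simp only [Algebra.TensorProduct.tmul_mul_tmul, one_mul, LinearMap.rTensor_tmul,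
      coproduct_letter_mul, TensorProduct.add_tmul, map_add, TensorProduct.assoc_tmul,
      assoc_tmul_letter_mul]
  | add x y hx hy =>
    rw [mul_add, map_add, map_add, hx, hy, TensorProduct.tmul_add, map_add, map_add, map_add]
    abel

/-- This structure supplies the convolution product on linear maps out of the tensor coalgebra. The
axioms follow by adding letters on the left. -/
instance coalgebra : Coalgebra ℝ (TensorCoalgebra A) where
  comul := coproduct
  counit := counitMap
  coassoc := by
    apply linearMap_ext_letter
    · simp [coproduct_one, Algebra.TensorProduct.one_def]
    · intro a w ih
      simp only [LinearMap.comp_apply, LinearEquiv.coe_coe] at ih ⊢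
      rw [coproduct_letter_mul, map_add, map_add, map_add, lTensor_letter_mul, ← ih,
        assoc_rTensor_coproduct_letter_mul, LinearMap.rTensor_tmul, LinearMap.lTensor_tmul,
        coproduct_one, coproduct_letter_mul, Algebra.TensorProduct.one_def,
        TensorProduct.assoc_tmul, TensorProduct.tmul_add]
      abel
  rTensor_counit_comp_comul := by
    apply linearMap_ext_letter
    · simp [coproduct_one, counitMap_one, Algebra.TensorProduct.one_def]
    · intro a w ih
      simp only [LinearMap.comp_apply] at ih ⊢
      rw [coproduct_letter_mul, map_add, rTensor_letter_mul counitMap 0 a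
        (fun w => counitMap_letter_mul a w)]
      simp [counitMap_one]
  lTensor_counit_comp_comul := by
    apply linearMap_ext_letter
    · simp [coproduct_one, counitMap_one, Algebra.TensorProduct.one_def]
    · intro a w ih
      simp only [LinearMap.comp_apply] at ih ⊢
      rw [coproduct_letter_mul, map_add, lTensor_letter_mul, ih]
      simp [counitMap_letter_mul]

theorem comul_eq : (CoalgebraStruct.comul : TensorCoalgebra A →ₗ[ℝ] _) = coproduct := rfl

theorem counit_eq : (CoalgebraStruct.counit : TensorCoalgebra A →ₗ[ℝ] ℝ) = counitMap := rfl

theorem cogenerators_one : cogenerators (1 : TensorCoalgebra A) = 0 := by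
  rw [← pureTensor_zero Fin.elim0, cogenerators, liftPure_pureTensor]; rfl

theorem cogenerators_letter (a : A) : cogenerators (letter a) = a := by
  rw [letter_apply, cogenerators, liftPure_pureTensor]; rfl

theorem cogenerators_letter_mul (a : A) (w : TensorCoalgebra A) :
    cogenerators (letter a * w) = counitMap w • a := by
  have : cogenerators ∘ₗ LinearMap.mulLeft ℝ (letter a) = counitMap.smulRight a := by
    apply linearMap_ext
    intro n v
    have : letter a * pureTensor n v = pureTensor (n + 1) (Fin.cons a v) := by
      simp [pureTensor_succ]
    simp only [LinearMap.comp_apply, LinearMap.mulLeft_apply, this, cogenerators,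
      liftPure_pureTensor, LinearMap.smulRight_apply, counitMap_pureTensor]
    cases n with
    | zero => simp [linFamily]
    | succ n => simp [linFamily]
  exact LinearMap.congr_fun this w

/-- The deconcatenation coproduct of a concatenation product. -/
theorem coproduct_mul (x y : TensorCoalgebra A) :
    coproduct (x * y) =
      coproduct x * (1 ⊗ₜ[ℝ] y) + (x ⊗ₜ[ℝ] 1) * coproduct y - x ⊗ₜ[ℝ] y := by
  have : coproduct ∘ₗ LinearMap.mulRight ℝ y =
      LinearMap.mulRight ℝ (1 ⊗ₜ[ℝ] y) ∘ₗ coproduct +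
        LinearMap.mulRight ℝ (coproduct y) ∘ₗ (TensorProduct.mk ℝ _ _).flip 1
        - (TensorProduct.mk ℝ _ _).flip y := by
    apply linearMap_ext_letter
    · simp [coproduct_one, ← Algebra.TensorProduct.one_def]
    · intro a w ih
      simp only [LinearMap.comp_apply, LinearMap.mulRight_apply, LinearMap.add_apply,
        LinearMap.sub_apply, LinearMap.flip_apply, TensorProduct.mk_apply] at ih ⊢
      rw [mul_assoc, coproduct_letter_mul, coproduct_letter_mul, ih]
      have e1 : (letter a * w) ⊗ₜ[ℝ] (1 : TensorCoalgebra A) =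
        (letter a ⊗ₜ[ℝ] 1) * (w ⊗ₜ[ℝ] 1) := by simp
      have e2 : (letter a * w) ⊗ₜ[ℝ] y = (letter a ⊗ₜ[ℝ] 1) * (w ⊗ₜ[ℝ] y) := by simp
      have e3 : (1 : TensorCoalgebra A) ⊗ₜ[ℝ] (letter a * (w * y)) =
        (1 ⊗ₜ[ℝ] (letter a * w)) * (1 ⊗ₜ[ℝ] y) := by simp [mul_assoc]
      rw [e1, e2, e3]
      simp only [mul_add, add_mul, mul_sub, mul_assoc]
      abel
  exact LinearMap.congr_fun this x

end Words

/-! ### The convolution ring of linear maps from the tensor coalgebra to an algebra -/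

section Convolution

variable {A B : Type*} [AddCommGroup A] [Module ℝ A] [AddCommGroup B] [Module ℝ B]
variable {V W : Type*} [AddCommGroup V] [Module ℝ V] [AddCommGroup W] [Module ℝ W]
variable {R R' : Type*} [Ring R] [Algebra ℝ R] [Ring R'] [Algebra ℝ R']

/-- The convolution ring of linear maps from the tensor coalgebra to an algebra. -/
abbrev Conv (A R : Type*) [AddCommGroup A] [Module ℝ A] [Ring R] [Algebra ℝ R] : Type _ :=
  WithConv (TensorCoalgebra A →ₗ[ℝ] R)

/-- Words are given by infinite sequences, so that both parts of a cut are again of this form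
without any casts between index types. -/
theorem conv_mul_word (f g : Conv A R) (n : ℕ) (u : ℕ → A) :
    (f * g).ofConv (pureTensor n (fun i => u i)) =
      ∑ p ∈ Finset.HasAntidiagonal.antidiagonal n,
        f.ofConv (pureTensor p.1 (fun i => u i)) *
          g.ofConv (pureTensor p.2 (fun i => u (p.1 + i))) := by
  rw [LinearMap.convMul_def, WithConv.ofConv_toConv, LinearMap.comp_apply, LinearMap.comp_apply,
    comul_eq, coproduct_word, map_sum, map_sum]
  simp

/-- `f` vanishes on all words of length less than `n`. -/
def Vanish (n : ℕ) (f : TensorCoalgebra A →ₗ[ℝ] V) : Prop :=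
  ∀ k < n, ∀ v : Fin k → A, f (pureTensor k v) = 0

theorem Vanish.mono {m n : ℕ} (h : m ≤ n) {f : TensorCoalgebra A →ₗ[ℝ] V} (hf : Vanish n f) :
    Vanish m f := fun k hk v => hf k (hk.trans_le h) v

theorem vanish_zero (f : TensorCoalgebra A →ₗ[ℝ] V) : Vanish 0 f := fun _ hk => absurd hk (by simp)

theorem vanish_one_iff {f : TensorCoalgebra A →ₗ[ℝ] V} : Vanish 1 f ↔ f 1 = 0 := by
  constructor
  · intro h
    rw [← pureTensor_zero Fin.elim0]
    exact h 0 one_pos _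
  · intro h k hk v
    obtain rfl : k = 0 := by omega
    rwa [pureTensor_zero]

theorem eq_zero_of_vanish {f : TensorCoalgebra A →ₗ[ℝ] V} (h : ∀ n, Vanish n f) : f = 0 :=
  linearMap_ext fun n v => h (n + 1) n n.lt_succ_self v

theorem Vanish.add {n : ℕ} {f g : TensorCoalgebra A →ₗ[ℝ] V} (hf : Vanish n f) (hg : Vanish n g) :
    Vanish n (f + g) := fun k hk v => by
  rw [LinearMap.add_apply, hf k hk, hg k hk, add_zero]

theorem Vanish.neg {n : ℕ} {f : TensorCoalgebra A →ₗ[ℝ] V} (hf : Vanish n f) :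
    Vanish n (-f) := fun k hk v => by
  rw [LinearMap.neg_apply, hf k hk, neg_zero]

theorem Vanish.sub {n : ℕ} {f g : TensorCoalgebra A →ₗ[ℝ] V} (hf : Vanish n f) (hg : Vanish n g) :
    Vanish n (f - g) := by
  rw [sub_eq_add_neg]; exact hf.add hg.neg

theorem Vanish.comp {n : ℕ} {f : TensorCoalgebra A →ₗ[ℝ] V} (hf : Vanish n f) (u : V →ₗ[ℝ] W) :
    Vanish n (u ∘ₗ f) := fun k hk v => by
  rw [LinearMap.comp_apply, hf k hk, map_zero]

/-- If a word of length less than `m + n` is cut, one of the parts is too short for its factor. All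
later gains of one word length come from here, through a factor that vanishes on the empty word. -/
theorem Vanish.mul {m n : ℕ} {f g : Conv A R} (hf : Vanish m f.ofConv) (hg : Vanish n g.ofConv) :
    Vanish (m + n) (f * g).ofConv := by
  intro k hk v
  obtain ⟨u, rfl⟩ := exists_sequence v
  rw [conv_mul_word]
  refine Finset.sum_eq_zero fun p hp => ?_
  have hp := Finset.HasAntidiagonal.mem_antidiagonal.1 hp
  by_cases h : p.1 < m
  · rw [hf _ h, zero_mul]
  · rw [hg _ (by omega), mul_zero]

theorem Vanish.pow {f : Conv A R} (hf : Vanish 1 f.ofConv) (n : ℕ) :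
    Vanish n (f ^ n).ofConv := by
  induction n with
  | zero => exact vanish_zero _
  | succ n ih => rw [pow_succ]; exact ih.mul hf

theorem Vanish.mul_left {n : ℕ} {g : Conv A R} (f : Conv A R) (hg : Vanish n g.ofConv) :
    Vanish n (f * g).ofConv := by
  simpa using (vanish_zero f.ofConv).mul hg

theorem Vanish.mul_right {n : ℕ} {f : Conv A R} (hf : Vanish n f.ofConv) (g : Conv A R) :
    Vanish n (f * g).ofConv := hf.mul (vanish_zero g.ofConv)

/-- Iteration gives `x = φ ^ n * x`, which vanishes on all words shorter than `n`. -/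
theorem conv_eq_zero_of_eq_mul {φ x : Conv A R} (hφ : Vanish 1 φ.ofConv) (h : x = φ * x) :
    x = 0 := by
  have : ∀ n, x = φ ^ n * x := by
    intro n
    induction n with
    | zero => simp
    | succ n ih => rw [pow_succ, mul_assoc, ← h]; exact ih
  apply WithConv.ofConv_injective
  refine eq_zero_of_vanish fun n => ?_
  rw [this n]
  exact (hφ.pow n).mul_right _

/-- The geometric series `1 + φ + φ² + ⋯` in the convolution ring. -/
def geom (φ : Conv A R) : Conv A R :=
  WithConv.toConv (liftPure fun n =>
    (∑ k ∈ Finset.range (n + 1), φ ^ k).ofConv.compMultilinearMap (pureTensor n))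

/-- On words of length `n` the powers beyond `φ ^ n` vanish, so any longer partial sum may be used
in place of the series; this is `key`. -/
theorem geom_eq {φ : Conv A R} (hφ : Vanish 1 φ.ofConv) : geom φ = 1 + φ * geom φ := by
  have key : ∀ n k, n ≤ k → ∀ v : Fin n → A, (geom φ).ofConv (pureTensor n v) =
      (∑ j ∈ Finset.range (k + 1), φ ^ j).ofConv (pureTensor n v) := by
    intro n k hk v
    rw [geom, WithConv.ofConv_toConv, liftPure_pureTensor, LinearMap.compMultilinearMap_apply,
      ← Finset.sum_range_add_sum_Ico _ (Nat.succ_le_succ hk)]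
    rw [WithConv.ofConv_add, LinearMap.add_apply, left_eq_add, WithConv.ofConv_sum,
      LinearMap.sum_apply]
    refine Finset.sum_eq_zero fun j hj => hφ.pow j n ?_ v
    have := (Finset.mem_Ico.1 hj).1
    omega
  apply WithConv.ofConv_injective
  apply linearMap_ext
  intro n v
  rw [key n (n + 1) (Nat.le_succ n), Finset.sum_range_succ', pow_zero, add_comm,
    WithConv.ofConv_add, WithConv.ofConv_add, LinearMap.add_apply, LinearMap.add_apply]
  congr 1
  simp only [pow_succ']
  rw [← Finset.mul_sum]
  obtain ⟨u, rfl⟩ := exists_sequence v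
  rw [conv_mul_word, conv_mul_word]
  refine Finset.sum_congr rfl fun p hp => ?_
  have hp := Finset.HasAntidiagonal.mem_antidiagonal.1 hp
  rw [key p.2 n (by omega)]

theorem eq_geom {φ x : Conv A R} (hφ : Vanish 1 φ.ofConv) (h : x = 1 + φ * x) : x = geom φ := by
  rw [← sub_eq_zero]
  apply conv_eq_zero_of_eq_mul hφ
  conv_lhs => rw [h, geom_eq hφ]
  noncomm_ring

theorem sub_mul_geom {φ : Conv A R} (hφ : Vanish 1 φ.ofConv) : (1 - φ) * geom φ = 1 := by
  have := geom_eq hφ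
  rw [sub_mul, one_mul]
  nth_rw 1 [this]
  rw [add_sub_cancel_right]

/-- A right inverse of `1 - φ` is also a left inverse, since `1 - φ` can be cancelled on the left.
-/
theorem geom_mul_sub {φ : Conv A R} (hφ : Vanish 1 φ.ofConv) : geom φ * (1 - φ) = 1 := by
  rw [← sub_eq_zero]
  apply conv_eq_zero_of_eq_mul hφ
  have : (1 - φ) * (geom φ * (1 - φ) - 1) = 0 := by
    rw [mul_sub, ← mul_assoc, sub_mul_geom hφ]; simp
  rw [sub_mul, one_mul, sub_eq_zero] at this
  exact this

theorem geom_sub_one {φ : Conv A R} (hφ : Vanish 1 φ.ofConv) : Vanish 1 (geom φ - 1).ofConv := by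
  have : geom φ - 1 = φ * geom φ := by nth_rw 1 [geom_eq hφ]; abel
  rw [this]
  exact hφ.mul_right _

theorem conv_one_apply_one : (1 : Conv A R).ofConv 1 = 1 := by
  rw [LinearMap.convOne_def, WithConv.ofConv_toConv, LinearMap.comp_apply, counit_eq,
    counitMap_one]
  simp

theorem geom_apply_one {φ : Conv A R} (hφ : Vanish 1 φ.ofConv) : (geom φ).ofConv 1 = 1 := by
  have := vanish_one_iff.1 (geom_sub_one hφ)
  rw [WithConv.ofConv_sub, LinearMap.sub_apply, conv_one_apply_one, sub_eq_zero] at this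
  exact this

/-- The difference of two geometric series. -/
theorem geom_sub_geom {φ ψ : Conv A R} (hφ : Vanish 1 φ.ofConv) (hψ : Vanish 1 ψ.ofConv) :
    geom φ - geom ψ = geom φ * (φ - ψ) * geom ψ := by
  have h1 := sub_mul_geom hψ
  have h2 := geom_mul_sub hφ
  calc geom φ - geom ψ = geom φ * ((1 - ψ) * geom ψ) - (geom φ * (1 - φ)) * geom ψ := by
        rw [h1, h2, mul_one, one_mul]
    _ = _ := by noncomm_ring

/-- Modulo words of length greater than `n`, a product of `e` vanishing below `n` with factors
`1 + ⋯` is `e`. -/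
theorem vanish_mul_mul_sub {n : ℕ} {f e g : Conv A R} (hf : Vanish 1 (f - 1).ofConv)
    (hg : Vanish 1 (g - 1).ofConv) (he : Vanish n e.ofConv) :
    Vanish (n + 1) (f * e * g - e).ofConv := by
  have : f * e * g - e = (f - 1) * (e * g) + e * (g - 1) := by noncomm_ring
  rw [this]
  refine Vanish.add ?_ (he.mul hg)
  rw [add_comm n 1]
  exact hf.mul (he.mul_right g)

/-- An algebra homomorphism induces a homomorphism of convolution rings. -/
def convMap (u : R →ₐ[ℝ] R') : Conv A R →+* Conv A R' where
  toFun f := WithConv.toConv (u.toLinearMap ∘ₗ f.ofConv)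
  map_one' := by
    apply WithConv.ofConv_injective
    ext x
    simp [LinearMap.convOne_def]
  map_mul' f g := by
    apply WithConv.ofConv_injective
    exact LinearMap.algHom_comp_convMul_distrib u f g
  map_zero' := by simp
  map_add' f g := by simp [LinearMap.comp_add]

theorem convMap_ofConv (u : R →ₐ[ℝ] R') (f : Conv A R) :
    (convMap u f).ofConv = u.toLinearMap ∘ₗ f.ofConv := rfl

end Convolution

/-! ### Coalgebra maps and coderivations of tensor coalgebras -/

section Coalgebra

variable {A B C : Type*} [AddCommGroup A] [Module ℝ A] [AddCommGroup B] [Module ℝ B]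
  [AddCommGroup C] [Module ℝ C]

theorem counitMap_mul (x y : TensorCoalgebra A) :
    counitMap (x * y) = counitMap x * counitMap y := by
  have : counitMap ∘ₗ LinearMap.mulRight ℝ y = LinearMap.mulRight ℝ (counitMap y) ∘ₗ counitMap := by
    apply linearMap_ext_letter
    · simp [counitMap_one]
    · intro a w _
      simp [mul_assoc, counitMap_letter_mul]
  exact LinearMap.congr_fun this x

/-- The counit as a homomorphism of algebras. -/
def counitHom : TensorCoalgebra A →ₐ[ℝ] ℝ :=
  AlgHom.ofLinearMap counitMap counitMap_one counitMap_mul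

/-- A product has length one only if one factor has length zero and the other has length one. -/
theorem cogenerators_mul (x y : TensorCoalgebra A) :
    cogenerators (x * y) = counitMap x • cogenerators y + counitMap y • cogenerators x := by
  have : cogenerators ∘ₗ LinearMap.mulRight ℝ y =
      counitMap.smulRight (cogenerators y) + counitMap y • cogenerators := by
    apply linearMap_ext_letter
    · simp [counitMap_one, cogenerators_one]
    · intro a w _
      simp only [LinearMap.comp_apply, LinearMap.mulRight_apply, LinearMap.add_apply,
        LinearMap.smulRight_apply, LinearMap.smul_apply, mul_assoc, cogenerators_letter_mul,
        counitMap_letter_mul, zero_smul, zero_add, smul_smul]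
      rw [counitMap_mul, mul_comm]
  exact LinearMap.congr_fun this x

theorem counitMap_letter (a : A) : counitMap (letter a) = 0 := by
  have := counitMap_letter_mul a 1
  rwa [mul_one] at this

theorem coproduct_letter (a : A) :
    coproduct (letter a) = 1 ⊗ₜ[ℝ] letter a + letter a ⊗ₜ[ℝ] 1 := by
  have := coproduct_letter_mul a 1
  rwa [mul_one, coproduct_one, mul_one] at this

/-- A linear map with values in `B`, regarded as a map to words of length one. -/
def letters (φ : TensorCoalgebra A →ₗ[ℝ] B) : Conv A (TensorCoalgebra B) :=
  WithConv.toConv (letter ∘ₗ φ)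

theorem letters_apply (φ : TensorCoalgebra A →ₗ[ℝ] B) (x : TensorCoalgebra A) :
    (letters φ).ofConv x = letter (φ x) := rfl

theorem letters_add (φ ψ : TensorCoalgebra A →ₗ[ℝ] B) :
    letters (φ + ψ) = letters φ + letters ψ := by
  apply WithConv.ofConv_injective
  simp [letters, LinearMap.comp_add]

theorem letters_sub (φ ψ : TensorCoalgebra A →ₗ[ℝ] B) :
    letters (φ - ψ) = letters φ - letters ψ := by
  apply WithConv.ofConv_injective
  simp [letters, LinearMap.comp_sub]

theorem letters_zero : letters (0 : TensorCoalgebra A →ₗ[ℝ] B) = 0 := by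
  apply WithConv.ofConv_injective
  simp [letters]

theorem Vanish.letters {n : ℕ} {φ : TensorCoalgebra A →ₗ[ℝ] B} (h : Vanish n φ) :
    Vanish n (letters φ).ofConv := h.comp letter

theorem cogenerators_comp_letters (φ : TensorCoalgebra A →ₗ[ℝ] B) :
    cogenerators ∘ₗ (letters φ).ofConv = φ := by
  refine LinearMap.ext fun x => ?_
  simp [letters_apply, cogenerators_letter]

theorem counitMap_comp_letters (φ : TensorCoalgebra A →ₗ[ℝ] B) :
    counitMap ∘ₗ (letters φ).ofConv = 0 := by
  refine LinearMap.ext fun x => ?_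
  simp [letters_apply, counitMap_letter]

theorem counitMap_comp_one :
    counitMap ∘ₗ (1 : Conv A (TensorCoalgebra B)).ofConv = counitMap := by
  refine LinearMap.ext fun x => ?_
  simp [LinearMap.convOne_def, counit_eq, Algebra.algebraMap_eq_smul_one, counitMap_one]

theorem counitMap_comp_mul (f g : Conv A (TensorCoalgebra B)) :
    counitMap ∘ₗ (f * g).ofConv =
      (WithConv.toConv (counitMap ∘ₗ f.ofConv) * WithConv.toConv (counitMap ∘ₗ g.ofConv) :
        Conv A ℝ).ofConv :=
  congrArg WithConv.ofConv ((convMap (A := A) (counitHom (A := B))).map_mul f g)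

theorem counitMap_comp_mul_eq_zero_left {f : Conv A (TensorCoalgebra B)}
    (hf : counitMap ∘ₗ f.ofConv = 0) (g : Conv A (TensorCoalgebra B)) :
    counitMap ∘ₗ (f * g).ofConv = 0 := by
  rw [counitMap_comp_mul, hf]; simp

theorem counitMap_comp_mul_eq_zero_right (f : Conv A (TensorCoalgebra B))
    {g : Conv A (TensorCoalgebra B)} (hg : counitMap ∘ₗ g.ofConv = 0) :
    counitMap ∘ₗ (f * g).ofConv = 0 := by
  rw [counitMap_comp_mul, hg]; simp

/-- The counit of `g` is zero, so only the counit of `f` can contribute, and it is nonzero on the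
empty word alone. A single cut survives, the one in front of the word. -/
theorem cogenerators_comp_mul_left {f g : Conv A (TensorCoalgebra B)}
    (hf : counitMap ∘ₗ f.ofConv = counitMap) (hg : counitMap ∘ₗ g.ofConv = 0) :
    cogenerators ∘ₗ (f * g).ofConv = cogenerators ∘ₗ g.ofConv := by
  apply linearMap_ext
  intro n v
  obtain ⟨u, rfl⟩ := exists_sequence v
  have hf' := fun x => LinearMap.congr_fun hf x
  have hg' := fun x => LinearMap.congr_fun hg x
  simp only [LinearMap.comp_apply, LinearMap.zero_apply] at hf' hg'
  simp only [LinearMap.comp_apply, conv_mul_word, map_sum, cogenerators_mul, hf', hg', zero_smul,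
    add_zero]
  rw [Finset.sum_eq_single (0, n)]
  · simp [counitMap_pureTensor]
  · rintro ⟨a, b⟩ hp h
    have hp := Finset.HasAntidiagonal.mem_antidiagonal.1 hp
    have : a ≠ 0 := by rintro rfl; apply h; simp at hp; simp [hp]
    simp [counitMap_pureTensor, this]
  · intro h; simp at h

theorem cogenerators_comp_mul_right {f g : Conv A (TensorCoalgebra B)}
    (hf : counitMap ∘ₗ f.ofConv = 0) (hg : counitMap ∘ₗ g.ofConv = counitMap) :
    cogenerators ∘ₗ (f * g).ofConv = cogenerators ∘ₗ f.ofConv := by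
  apply linearMap_ext
  intro n v
  obtain ⟨u, rfl⟩ := exists_sequence v
  have hf' := fun x => LinearMap.congr_fun hf x
  have hg' := fun x => LinearMap.congr_fun hg x
  simp only [LinearMap.comp_apply, LinearMap.zero_apply] at hf' hg'
  simp only [LinearMap.comp_apply, conv_mul_word, map_sum, cogenerators_mul, hf', hg', zero_smul,
    zero_add]
  rw [Finset.sum_eq_single (n, 0)]
  · simp [counitMap_pureTensor]
  · rintro ⟨a, b⟩ hp h
    have hp := Finset.HasAntidiagonal.mem_antidiagonal.1 hp
    have : b ≠ 0 := by rintro rfl; apply h; simp at hp; simp [hp]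
    simp [counitMap_pureTensor, this]
  · intro h; simp at h

/-! #### Coproducts in the convolution ring -/

/-- The embedding as left factor. -/
abbrev convLeft : Conv A (TensorCoalgebra B) →+* Conv A (TensorCoalgebra B ⊗[ℝ] TensorCoalgebra B) :=
  convMap Algebra.TensorProduct.includeLeft

/-- The embedding as right factor. -/
abbrev convRight : Conv A (TensorCoalgebra B) →+* Conv A (TensorCoalgebra B ⊗[ℝ] TensorCoalgebra B) :=
  convMap Algebra.TensorProduct.includeRight

theorem convLeft_apply (f : Conv A (TensorCoalgebra B)) (x : TensorCoalgebra A) :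
    (convLeft f).ofConv x = f.ofConv x ⊗ₜ[ℝ] 1 := rfl

theorem convRight_apply (f : Conv A (TensorCoalgebra B)) (x : TensorCoalgebra A) :
    (convRight f).ofConv x = 1 ⊗ₜ[ℝ] f.ofConv x := rfl

/-- Composition with the coproduct. -/
def convCoproduct (f : Conv A (TensorCoalgebra B)) :
    Conv A (TensorCoalgebra B ⊗[ℝ] TensorCoalgebra B) :=
  WithConv.toConv (coproduct ∘ₗ f.ofConv)

theorem convLeft_mul_convRight (f g : Conv A (TensorCoalgebra B)) :
    convLeft f * convRight g =
      WithConv.toConv (TensorProduct.map f.ofConv g.ofConv ∘ₗ coproduct) := by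
  apply WithConv.ofConv_injective
  apply linearMap_ext
  intro n v
  obtain ⟨u, rfl⟩ := exists_sequence v
  rw [conv_mul_word]
  simp [coproduct_word, convMap_ofConv]

/-- Deconcatenation is not multiplicative for concatenation. The cuts within the first and within
the second factor are added, and the cut between the factors, which both sums contain, is subtracted
once. -/
theorem convCoproduct_mul (f g : Conv A (TensorCoalgebra B)) :
    convCoproduct (f * g) = convCoproduct f * convRight g + convLeft f * convCoproduct g -
      convLeft f * convRight g := by
  apply WithConv.ofConv_injective
  apply linearMap_ext
  intro n v
  obtain ⟨u, rfl⟩ := exists_sequence v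
  rw [WithConv.ofConv_sub, WithConv.ofConv_add, LinearMap.sub_apply, LinearMap.add_apply,
    conv_mul_word, conv_mul_word, conv_mul_word, ← Finset.sum_add_distrib,
    ← Finset.sum_sub_distrib]
  simp only [convCoproduct, WithConv.ofConv_toConv, LinearMap.comp_apply, conv_mul_word, map_sum,
    coproduct_mul, convLeft_apply, convRight_apply, Algebra.TensorProduct.tmul_mul_tmul, one_mul,
    mul_one]

theorem convCoproduct_one : convCoproduct (1 : Conv A (TensorCoalgebra B)) = 1 := by
  apply WithConv.ofConv_injective
  refine LinearMap.ext fun x => ?_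
  simp [convCoproduct, LinearMap.convOne_def, Algebra.algebraMap_eq_smul_one, coproduct_one]

theorem convCoproduct_add (f g : Conv A (TensorCoalgebra B)) :
    convCoproduct (f + g) = convCoproduct f + convCoproduct g := by
  apply WithConv.ofConv_injective
  simp [convCoproduct, LinearMap.comp_add]

theorem convCoproduct_letters (φ : TensorCoalgebra A →ₗ[ℝ] B) :
    convCoproduct (letters φ) = convLeft (letters φ) + convRight (letters φ) := by
  apply WithConv.ofConv_injective
  refine LinearMap.ext fun x => ?_
  rw [WithConv.ofConv_add, LinearMap.add_apply, convLeft_apply, convRight_apply, letters_apply,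
    add_comm]
  exact coproduct_letter (φ x)

/-- Applying the coproduct to the recursion of the series `F` gives `ΔF = RF + Lφ * ΔF`, where `L`
and `R` are the embeddings as left and right factor. Multiplication by the inverse `LF` of `1 - Lφ`
isolates `ΔF`. -/
theorem convCoproduct_geom {φ : TensorCoalgebra A →ₗ[ℝ] B} (hφ : Vanish 1 φ) :
    convCoproduct (geom (letters φ)) =
      convLeft (geom (letters φ)) * convRight (geom (letters φ)) := by
  set F := geom (letters φ) with hF
  have h1 : (1 - convLeft (letters φ)) * convCoproduct F = convRight F := by
    have h := convCoproduct_mul (letters φ) F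
    have h2 := congrArg convCoproduct (geom_eq hφ.letters)
    rw [convCoproduct_add, convCoproduct_one, ← hF, h, convCoproduct_letters] at h2
    have h3 := congrArg convRight (geom_eq hφ.letters)
    rw [map_add, map_one, map_mul, ← hF] at h3
    rw [sub_mul, one_mul, h3]
    nth_rw 1 [h2]
    noncomm_ring
  have h4 := congrArg convLeft (geom_mul_sub hφ.letters)
  rw [map_mul, map_sub, map_one, ← hF] at h4
  calc convCoproduct F = (convLeft F * (1 - convLeft (letters φ))) * convCoproduct F := by
        rw [h4, one_mul]
    _ = _ := by rw [mul_assoc, h1]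

/-- The letters `x`, `y`, `z` stand for the left embeddings of `F`, `δ`, `G`, the primed letters for
the right ones. No commutation between them is needed. -/
theorem coderivation_aux {S : Type*} [Ring S] (x x' y y' z z' : S) :
    (x * x' * y' + x * (y + y') - x * y') * z' + x * y * (z * z') - x * y * z' =
      x * (x' * y' * z') + x * y * z * z' := by noncomm_ring

theorem convCoproduct_coderivation {F G : Conv A (TensorCoalgebra B)}
    (hF : convCoproduct F = convLeft F * convRight F)
    (hG : convCoproduct G = convLeft G * convRight G) (δ : TensorCoalgebra A →ₗ[ℝ] B) :
    convCoproduct (F * letters δ * G) =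
      convLeft F * convRight (F * letters δ * G) + convLeft (F * letters δ * G) * convRight G := by
  rw [convCoproduct_mul, convCoproduct_mul, hF, hG, convCoproduct_letters]
  simp only [map_mul]
  exact coderivation_aux _ _ _ _ _ _

/-! #### Coalgebra maps -/

/-- `F` is a map of coalgebras `T^c(A[1]) → T^c(B[1])` with `F 1 = 1`. -/
structure IsCoalgMap (F : TensorCoalgebra A →ₗ[ℝ] TensorCoalgebra B) : Prop where
  comul : coproduct ∘ₗ F = TensorProduct.map F F ∘ₗ coproduct
  counit : counitMap ∘ₗ F = counitMap
  one : F 1 = 1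

theorem IsCoalgMap.comp {G : TensorCoalgebra B →ₗ[ℝ] TensorCoalgebra C}
    {F : TensorCoalgebra A →ₗ[ℝ] TensorCoalgebra B} (hG : IsCoalgMap G) (hF : IsCoalgMap F) :
    IsCoalgMap (G ∘ₗ F) where
  comul := by
    rw [← LinearMap.comp_assoc, hG.comul, LinearMap.comp_assoc, hF.comul, ← LinearMap.comp_assoc,
      TensorProduct.map_comp]
  counit := by rw [← LinearMap.comp_assoc, hG.counit, hF.counit]
  one := by rw [LinearMap.comp_apply, hF.one, hG.one]

theorem isCoalgMap_id : IsCoalgMap (LinearMap.id : TensorCoalgebra A →ₗ[ℝ] TensorCoalgebra A) where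
  comul := by simp
  counit := rfl
  one := rfl

theorem IsCoalgMap.convCoproduct {F : TensorCoalgebra A →ₗ[ℝ] TensorCoalgebra B}
    (hF : IsCoalgMap F) : convCoproduct (WithConv.toConv F) =
      convLeft (WithConv.toConv F) * convRight (WithConv.toConv F) := by
  rw [convLeft_mul_convRight, AInfty.convCoproduct, hF.comul]

theorem counitMap_comp_geom {φ : TensorCoalgebra A →ₗ[ℝ] B} (hφ : Vanish 1 φ) :
    counitMap ∘ₗ (geom (letters φ)).ofConv = counitMap := by
  rw [geom_eq hφ.letters, WithConv.ofConv_add, LinearMap.comp_add, counitMap_comp_one,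
    counitMap_comp_mul_eq_zero_left (counitMap_comp_letters φ), add_zero]

theorem isCoalgMap_geom {φ : TensorCoalgebra A →ₗ[ℝ] B} (hφ : Vanish 1 φ) :
    IsCoalgMap (geom (letters φ)).ofConv where
  comul := by
    have := convCoproduct_geom hφ
    rw [convLeft_mul_convRight] at this
    exact congrArg WithConv.ofConv this
  counit := counitMap_comp_geom hφ
  one := geom_apply_one hφ.letters

theorem cogenerators_comp_geom {φ : TensorCoalgebra A →ₗ[ℝ] B} (hφ : Vanish 1 φ) :
    cogenerators ∘ₗ (geom (letters φ)).ofConv = φ := by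
  rw [geom_eq hφ.letters, WithConv.ofConv_add, LinearMap.comp_add,
    cogenerators_comp_mul_right (counitMap_comp_letters φ) (counitMap_comp_geom hφ),
    cogenerators_comp_letters]
  have : cogenerators ∘ₗ (1 : Conv A (TensorCoalgebra B)).ofConv = 0 := by
    refine LinearMap.ext fun x => ?_
    simp [LinearMap.convOne_def, Algebra.algebraMap_eq_smul_one, cogenerators_one]
  rw [this, zero_add]

theorem letters_comp_cogenerators_mul (χ : A →ₗ[ℝ] B) (X : Conv A (TensorCoalgebra B)) (a : A)
    (w : TensorCoalgebra A) :
    (letters (χ ∘ₗ cogenerators) * X).ofConv (letter a * w) = letter (χ a) * X.ofConv w := by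
  have : (letters (χ ∘ₗ cogenerators) * X).ofConv ∘ₗ LinearMap.mulLeft ℝ (letter a) =
      LinearMap.mulLeft ℝ (letter (χ a)) ∘ₗ X.ofConv := by
    apply linearMap_ext
    intro n v
    obtain ⟨u, rfl⟩ := exists_sequence v
    let u' : ℕ → A := fun i => Nat.casesOn i a u
    have e : letter a * pureTensor n (fun i => u i) = pureTensor (n + 1) (fun i => u' i) := by
      rw [pureTensor_succ]; rfl
    simp only [LinearMap.comp_apply, LinearMap.mulLeft_apply, e, conv_mul_word]
    rw [Finset.sum_eq_single (1, n)]
    · have e1 : pureTensor 1 (fun i : Fin 1 => u' i) = letter a := pureTensor_one _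
      have e2 : (fun i : Fin n => u' (1 + i)) = fun i : Fin n => u i := by
        funext i
        rw [add_comm]
      simp only [e1, e2, letters_apply, LinearMap.comp_apply, cogenerators_letter]
    · rintro ⟨p, q⟩ hp h
      have hp := Finset.HasAntidiagonal.mem_antidiagonal.1 hp
      have hp1 : p ≠ 1 := by
        rintro rfl
        apply h
        simp only at hp
        rw [Prod.mk.injEq]
        exact ⟨rfl, by omega⟩
      have : cogenerators (pureTensor p (fun i : Fin p => u' i)) = 0 := by
        rw [cogenerators, liftPure_pureTensor]
        match p, hp1 with
        | 0, _ => rfl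
        | _ + 2, _ => rfl
      simp only [letters_apply, LinearMap.comp_apply, this, map_zero, zero_mul]
    · intro h
      exact absurd (Finset.HasAntidiagonal.mem_antidiagonal.2 (add_comm 1 n)) h
  exact LinearMap.congr_fun this w

theorem conv_one_letter_mul (a : A) (w : TensorCoalgebra A) :
    (1 : Conv A (TensorCoalgebra B)).ofConv (letter a * w) = 0 := by
  simp [LinearMap.convOne_def, counit_eq, counitMap_letter_mul]

/-- A map defined letter by letter is a geometric series. -/
theorem eq_geom_of_letter {X : TensorCoalgebra A →ₗ[ℝ] TensorCoalgebra B} (χ : A →ₗ[ℝ] B)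
    (h1 : X 1 = 1) (h : ∀ a w, X (letter a * w) = letter (χ a) * X w) :
    WithConv.toConv X = geom (letters (χ ∘ₗ cogenerators)) := by
  have hv : Vanish 1 (letters (χ ∘ₗ cogenerators)).ofConv := by
    refine Vanish.letters (vanish_one_iff.2 ?_)
    rw [LinearMap.comp_apply, cogenerators_one, map_zero]
  refine eq_geom hv (WithConv.ofConv_injective (linearMap_ext_letter ?_ fun a w _ => ?_))
  · rw [WithConv.ofConv_add, LinearMap.add_apply, conv_one_apply_one,
      vanish_one_iff.1 (hv.mul_right _), WithConv.ofConv_toConv, h1, add_zero]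
  · rw [WithConv.ofConv_add, LinearMap.add_apply, letters_comp_cogenerators_mul,
      conv_one_letter_mul, zero_add, WithConv.ofConv_toConv, h]

theorem id_eq_geom : (WithConv.toConv LinearMap.id : Conv A (TensorCoalgebra A)) =
    geom (letters cogenerators) :=
  eq_geom_of_letter LinearMap.id rfl fun _ _ => rfl

/-- The identity in the convolution ring, `y = ε(y) 1 + π(y₁) y₂`. -/
theorem id_eq : (WithConv.toConv LinearMap.id : Conv A (TensorCoalgebra A)) =
    1 + letters cogenerators * WithConv.toConv LinearMap.id := by
  rw [id_eq_geom]
  exact geom_eq (vanish_one_iff.2 cogenerators_one).letters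

/-- Reconstruction of a map from its projection to cogenerators and its coproduct. -/
theorem eq_of_coproduct {ι : Type*} (s : Finset ι) {X : TensorCoalgebra A →ₗ[ℝ] TensorCoalgebra B}
    (a b : ι → (TensorCoalgebra A →ₗ[ℝ] TensorCoalgebra B))
    (h : coproduct ∘ₗ X = (∑ i ∈ s, TensorProduct.map (a i) (b i)) ∘ₗ coproduct) :
    WithConv.toConv X = WithConv.toConv (Algebra.linearMap ℝ _ ∘ₗ counitMap ∘ₗ X) +
      ∑ i ∈ s, letters (cogenerators ∘ₗ a i) * WithConv.toConv (b i) := by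
  apply WithConv.ofConv_injective
  refine LinearMap.ext fun x => ?_
  -- The formula `y = ε(y) 1 + π(y₁) y₂` is evaluated at `y = X x`, where the coproduct is known by
  -- hypothesis.
  have h1 := LinearMap.congr_fun (congrArg WithConv.ofConv (id_eq (A := B))) (X x)
  rw [WithConv.ofConv_add, LinearMap.add_apply, LinearMap.convMul_def] at h1
  simp only [LinearMap.comp_apply, comul_eq, LinearMap.id_apply] at h1
  have h2 := LinearMap.congr_fun h x
  simp only [LinearMap.comp_apply] at h2
  rw [h2] at h1
  rw [WithConv.ofConv_toConv, h1, WithConv.ofConv_add, LinearMap.add_apply, WithConv.ofConv_sum,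
    LinearMap.sum_apply, LinearMap.sum_apply, map_sum, map_sum]
  congr 1
  refine Finset.sum_congr rfl fun i _ => ?_
  rw [LinearMap.convMul_def]
  simp only [LinearMap.comp_apply, comul_eq]
  rw [← LinearMap.comp_apply (TensorProduct.map _ _) (TensorProduct.map _ _),
    ← TensorProduct.map_comp]
  rfl

/-- Reconstruction from the coproduct reads `F = 1 + (π F) * F`, and the geometric series is the
only solution. This is the cofreeness of the tensor coalgebra. -/
theorem IsCoalgMap.eq_geom {F : TensorCoalgebra A →ₗ[ℝ] TensorCoalgebra B} (hF : IsCoalgMap F) :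
    WithConv.toConv F = geom (letters (cogenerators ∘ₗ F)) := by
  refine AInfty.eq_geom (Vanish.letters (vanish_one_iff.2 ?_)) ?_
  · rw [LinearMap.comp_apply, hF.one, cogenerators_one]
  · have := eq_of_coproduct {()} (X := F) (fun _ => F) (fun _ => F) (by simpa using hF.comul)
    rw [Finset.sum_singleton, hF.counit] at this
    exact this

theorem IsCoalgMap.ext {F G : TensorCoalgebra A →ₗ[ℝ] TensorCoalgebra B} (hF : IsCoalgMap F)
    (hG : IsCoalgMap G) (h : cogenerators ∘ₗ F = cogenerators ∘ₗ G) : F = G := by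
  apply WithConv.toConv_injective
  rw [hF.eq_geom, hG.eq_geom, h]

/-! #### Coderivations -/

/-- `Δ X = (F ⊗ X + X ⊗ G) Δ`. -/
def IsCoder (F G X : TensorCoalgebra A →ₗ[ℝ] TensorCoalgebra B) : Prop :=
  coproduct ∘ₗ X = (TensorProduct.map F X + TensorProduct.map X G) ∘ₗ coproduct

section IsCoder

variable {F G X Y : TensorCoalgebra A →ₗ[ℝ] TensorCoalgebra B}

theorem mul_counit_coproduct (f g : TensorCoalgebra A →ₗ[ℝ] TensorCoalgebra B) :
    LinearMap.mul' ℝ ℝ ∘ₗ TensorProduct.map counitMap counitMap ∘ₗ TensorProduct.map f g ∘ₗ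
        coproduct =
      (WithConv.toConv (counitMap ∘ₗ f) * WithConv.toConv (counitMap ∘ₗ g) : Conv A ℝ).ofConv := by
  rw [LinearMap.convMul_def, ← LinearMap.comp_assoc coproduct, ← TensorProduct.map_comp]
  rfl

theorem toConv_counitMap : (WithConv.toConv counitMap : Conv A ℝ) = 1 := by
  rw [LinearMap.convOne_def]; rfl

theorem mul_counit_coproduct_self :
    LinearMap.mul' ℝ ℝ ∘ₗ TensorProduct.map counitMap counitMap ∘ₗ coproduct =
      (counitMap : TensorCoalgebra A →ₗ[ℝ] ℝ) := by
  have h := congrArg WithConv.ofConv (one_mul (WithConv.toConv counitMap : Conv A ℝ))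
  rw [← toConv_counitMap] at h
  exact h

/-- A coderivation has values in the kernel of the counit. -/
theorem IsCoder.counitMap_comp (hX : IsCoder F G X) (hF : counitMap ∘ₗ F = counitMap)
    (hG : counitMap ∘ₗ G = counitMap) : counitMap ∘ₗ X = 0 := by
  -- Applying `ε ⊗ ε` to the coderivation identity gives `ε X = ε X + ε X`.
  have h1 := congrArg (fun Z => LinearMap.mul' ℝ ℝ ∘ₗ
    TensorProduct.map counitMap counitMap ∘ₗ Z) hX
  simp only [LinearMap.add_comp, LinearMap.comp_add, mul_counit_coproduct, hF, hG,
    toConv_counitMap, one_mul, mul_one, WithConv.ofConv_toConv] at h1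
  have h2 : LinearMap.mul' ℝ ℝ ∘ₗ TensorProduct.map counitMap counitMap ∘ₗ coproduct ∘ₗ X =
      counitMap ∘ₗ X := congrArg (fun Z => Z ∘ₗ X) mul_counit_coproduct_self
  rw [h2] at h1
  exact left_eq_add.1 h1

/-- A coderivation is determined by its projection to cogenerators. -/
theorem IsCoder.eq_add (hX : IsCoder F G X) (hF : counitMap ∘ₗ F = counitMap)
    (hG : counitMap ∘ₗ G = counitMap) :
    WithConv.toConv X = letters (cogenerators ∘ₗ F) * WithConv.toConv X +
      letters (cogenerators ∘ₗ X) * WithConv.toConv G := by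
  have := eq_of_coproduct Finset.univ (X := X) ![F, X] ![X, G] (by
    rw [Fin.sum_univ_two]; exact hX)
  rw [hX.counitMap_comp hF hG, Fin.sum_univ_two, LinearMap.comp_zero] at this
  simpa using this

theorem eq_geom_mul {φ x y : Conv A (TensorCoalgebra B)} (hφ : Vanish 1 φ.ofConv)
    (h : x = φ * x + y) : x = geom φ * y := by
  have : (1 - φ) * x = y := by
    rw [sub_mul, one_mul, sub_eq_iff_eq_add, add_comm]; exact h
  rw [← this, ← mul_assoc, geom_mul_sub hφ, one_mul]

/-- The equation `X = (π F) * X + (π X) * G` is linear in `X` and is solved by the geometric series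
of `π F`, which is `F`. -/
theorem IsCoder.eq_mul (hX : IsCoder F G X) (hF : IsCoalgMap F)
    (hG : counitMap ∘ₗ G = counitMap) :
    WithConv.toConv X =
      WithConv.toConv F * letters (cogenerators ∘ₗ X) * WithConv.toConv G := by
  rw [hF.eq_geom, mul_assoc]
  refine eq_geom_mul (Vanish.letters (vanish_one_iff.2 ?_)) (hX.eq_add hF.counit hG)
  rw [LinearMap.comp_apply, hF.one, cogenerators_one]

theorem IsCoalgMap.isCoder_mul (hF : IsCoalgMap F) (hG : IsCoalgMap G)
    (δ : TensorCoalgebra A →ₗ[ℝ] B) :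
    IsCoder F G (WithConv.toConv F * letters δ * WithConv.toConv G).ofConv := by
  have := convCoproduct_coderivation hF.convCoproduct hG.convCoproduct δ
  rw [convLeft_mul_convRight, convLeft_mul_convRight] at this
  unfold IsCoder
  rw [LinearMap.add_comp]
  exact congrArg WithConv.ofConv this

theorem cogenerators_comp_coderivation {f g : Conv A (TensorCoalgebra B)}
    (hf : counitMap ∘ₗ f.ofConv = counitMap) (hg : counitMap ∘ₗ g.ofConv = counitMap)
    (δ : TensorCoalgebra A →ₗ[ℝ] B) : cogenerators ∘ₗ (f * letters δ * g).ofConv = δ := by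
  rw [cogenerators_comp_mul_right
      (counitMap_comp_mul_eq_zero_right _ (counitMap_comp_letters δ)) hg,
    cogenerators_comp_mul_left hf (counitMap_comp_letters δ), cogenerators_comp_letters]

end IsCoder

end Coalgebra

/-! ### The bar construction in the convolution ring -/

section BarConv

variable {A B C : Type*} [AddCommGroup A] [Module ℝ A] [AddCommGroup B] [Module ℝ B]
  [AddCommGroup C] [Module ℝ C]

/-- The word obtained from `u` by applying the members of `ψ 0, ψ 1, …` to the consecutive blocks
of the given lengths. -/
def blockProd : (ℕ → Family A B) → List ℕ → (ℕ → A) → TensorCoalgebra B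
  | _, [], _ => 1
  | ψ, k :: ks, u => letter (ψ 0 k (fun a => u a)) *
      blockProd (fun i => ψ (i + 1)) ks (fun a => u (k + a))

theorem pureTensor_eq_blockProd (ks : List ℕ) : ∀ (ψ : ℕ → Family A B) (u : ℕ → A),
    pureTensor ks.length (fun i => ψ i (ks.get i) (fun a => u ((ks.take i).sum + a))) =
      blockProd ψ ks u := by
  induction ks with
  | nil => intro ψ u; exact pureTensor_zero _
  | cons k ks ih =>
    intro ψ u
    rw [blockProd, ← ih]
    refine (pureTensor_succ _).trans ?_
    congr 1
    · simp only [Fin.val_zero, List.take_zero, List.sum_nil, zero_add]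
      rfl
    · congr 1
      funext i
      simp [add_assoc]

theorem pureTensor_applyBlocks {n : ℕ} (c : Composition n) (ψ : ℕ → Family A B) (u : ℕ → A) :
    pureTensor c.length (applyBlocks c (fun i => ψ i) (fun i => u i)) =
      blockProd ψ c.blocks u :=
  pureTensor_eq_blockProd c.blocks ψ u

theorem sum_composition_zero {M : Type*} [AddCommMonoid M] (G : List ℕ → M) :
    ∑ c : Composition 0, G c.blocks = G [] := by
  rw [Fintype.sum_eq_single (default : Composition 0)]
  · rfl
  · intro c hc
    refine absurd (Composition.ext ?_) hc
    have h := c.blocks_sum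
    have hpos : ∀ i ∈ c.blocks, 0 < i := fun i hi => c.blocks_pos hi
    cases hb : c.blocks with
    | nil => rfl
    | cons k ks =>
      rw [hb] at h hpos
      have := hpos k (by simp)
      simp at h
      omega

/-- Sums over compositions, split according to the first block. -/
theorem sum_composition_succ {M : Type*} [AddCommMonoid M] (n : ℕ) (G : List ℕ → M) :
    ∑ c : Composition (n + 1), G c.blocks =
      ∑ p ∈ Finset.HasAntidiagonal.antidiagonal n, ∑ c : Composition p.2,
        G ((p.1 + 1) :: c.blocks) := by
  rw [Finset.sum_sigma']
  symm
  refine Finset.sum_bij (fun x hx => ⟨(x.1.1 + 1) :: x.2.blocks, ?_, ?_⟩) ?_ ?_ ?_ ?_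
  · intro i hi
    rcases List.mem_cons.1 hi with rfl | hi
    · exact Nat.succ_pos _
    · exact x.2.blocks_pos hi
  · have := Finset.HasAntidiagonal.mem_antidiagonal.1 (Finset.mem_sigma.1 hx).1
    rw [List.sum_cons, x.2.blocks_sum]
    omega
  · intros; exact Finset.mem_univ _
  · rintro ⟨⟨k, r⟩, c⟩ h ⟨⟨k', r'⟩, c'⟩ h' e
    have h := Finset.HasAntidiagonal.mem_antidiagonal.1 (Finset.mem_sigma.1 h).1
    have h' := Finset.HasAntidiagonal.mem_antidiagonal.1 (Finset.mem_sigma.1 h').1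
    have e := List.cons.inj (congrArg Composition.blocks e)
    simp only at h h' e
    obtain rfl : k = k' := by omega
    obtain rfl : r = r' := by omega
    obtain rfl : c = c' := Composition.ext e.2
    rfl
  · intro c _
    have h := c.blocks_sum
    have hpos : ∀ i ∈ c.blocks, 0 < i := fun i hi => c.blocks_pos hi
    cases hb : c.blocks with
    | nil => rw [hb] at h; simp at h
    | cons k ks =>
      rw [hb] at h hpos
      have hk := hpos k (by simp)
      rw [List.sum_cons] at h
      refine ⟨⟨(k - 1, ks.sum), ⟨ks, fun hi => hpos _ (List.mem_cons_of_mem _ hi), rfl⟩⟩,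
        Finset.mem_sigma.2 ⟨Finset.HasAntidiagonal.mem_antidiagonal.2 ?_, Finset.mem_univ _⟩, ?_⟩
      · simp only; omega
      · apply Composition.ext
        simp only [hb, Nat.sub_add_cancel hk]
  · intros; rfl

theorem liftPure_one_eq_zero {V : Type*} [AddCommGroup V] [Module ℝ V]
    {φ : ∀ n : ℕ, MultilinearMap ℝ (fun _ : Fin n => A) V} (h : φ 0 = 0) : liftPure φ 1 = 0 := by
  rw [← pureTensor_zero Fin.elim0, liftPure_pureTensor, h]; rfl

/-- The convolution product with letters from a family without member of arity zero. -/
theorem letters_mul_word_succ {f : Family A B} (hf : f 0 = 0) (X : Conv A (TensorCoalgebra B))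
    (n : ℕ) (u : ℕ → A) :
    (letters (liftPure f) * X).ofConv (pureTensor (n + 1) (fun i => u i)) =
      ∑ p ∈ Finset.HasAntidiagonal.antidiagonal n,
        letter (f (p.1 + 1) (fun i => u i)) *
          X.ofConv (pureTensor p.2 (fun i => u (p.1 + 1 + i))) := by
  rw [conv_mul_word, Finset.Nat.sum_antidiagonal_succ]
  simp only [letters_apply, liftPure_pureTensor, hf, zero_apply, map_zero, zero_mul,
    zero_add]

theorem conv_one_word_succ {n : ℕ} (v : Fin (n + 1) → A) :
    (1 : Conv A (TensorCoalgebra B)).ofConv (pureTensor (n + 1) v) = 0 := by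
  rw [pureTensor_succ, conv_one_letter_mul]

theorem eq_geom_of_word {f : Family A B} (hf : f 0 = 0)
    {X : TensorCoalgebra A →ₗ[ℝ] TensorCoalgebra B} (h1 : X 1 = 1)
    (h : ∀ n (u : ℕ → A), X (pureTensor (n + 1) (fun i => u i)) =
      ∑ p ∈ Finset.HasAntidiagonal.antidiagonal n, letter (f (p.1 + 1) (fun i => u i)) *
        X (pureTensor p.2 (fun i => u (p.1 + 1 + i)))) :
    WithConv.toConv X = geom (letters (liftPure f)) := by
  have hv : Vanish 1 (letters (liftPure f)).ofConv :=
    Vanish.letters (vanish_one_iff.2 (liftPure_one_eq_zero hf))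
  refine eq_geom hv (WithConv.ofConv_injective (linearMap_ext fun n v => ?_))
  cases n with
  | zero =>
    rw [pureTensor_zero, WithConv.ofConv_add, LinearMap.add_apply, conv_one_apply_one,
      vanish_one_iff.1 (hv.mul_right _), WithConv.ofConv_toConv, h1, add_zero]
  | succ n =>
    obtain ⟨u, rfl⟩ := exists_sequence v
    rw [WithConv.ofConv_add, LinearMap.add_apply, letters_mul_word_succ hf, conv_one_word_succ,
      zero_add, WithConv.ofConv_toConv, h]

theorem liftPure_linFamily (σ : A →ₗ[ℝ] B) : liftPure (linFamily σ) = σ ∘ₗ cogenerators := by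
  apply linearMap_ext
  intro n v
  rw [LinearMap.comp_apply, cogenerators, liftPure_pureTensor, liftPure_pureTensor]
  match n with
  | 0 => simp [linFamily]
  | 1 => rfl
  | _ + 2 => simp [linFamily]

variable (𝒜 : ℤ → Submodule ℝ A) [DirectSum.Decomposition 𝒜]
variable (ℬ : ℤ → Submodule ℝ B) [DirectSum.Decomposition ℬ]

/-- A family of multilinear maps without member of arity zero, as a linear map on the tensor
coalgebra, after suspension. -/
def bar (f : Family A B) : TensorCoalgebra A →ₗ[ℝ] B := liftPure (suspend 𝒜 f)

variable {𝒜} {ℬ}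

theorem suspend_zero {f : Family A B} (hf : f 0 = 0) : suspend 𝒜 f 0 = 0 := by
  rw [suspend, hf]; rfl

theorem vanish_bar {f : Family A B} (hf : f 0 = 0) : Vanish 1 (bar 𝒜 f) :=
  vanish_one_iff.2 (liftPure_one_eq_zero (suspend_zero hf))

theorem barMap_word {f : Family A B} (n : ℕ) (u : ℕ → A) :
    barMap 𝒜 f (pureTensor n (fun i => u i)) =
      ∑ c : Composition n, blockProd (fun _ => suspend 𝒜 f) c.blocks u := by
  rw [barMap, liftPure_pureTensor, sum_apply]
  exact Finset.sum_congr rfl fun c _ => pureTensor_applyBlocks c (fun _ => suspend 𝒜 f) u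

/-- Splitting off the first block of a composition is exactly the recursion of the geometric series.
-/
theorem barMap_eq_geom {f : Family A B} (hf : f 0 = 0) :
    WithConv.toConv (barMap 𝒜 f) = geom (letters (bar 𝒜 f)) := by
  refine eq_geom_of_word (suspend_zero hf) ?_ fun n u => ?_
  · have := barMap_word (𝒜 := 𝒜) (f := f) 0 (fun _ => 0)
    rw [pureTensor_zero, sum_composition_zero (fun b => blockProd _ b _)] at this
    exact this
  · rw [barMap_word, sum_composition_succ n (fun b => blockProd (fun _ => suspend 𝒜 f) b u)]
    refine Finset.sum_congr rfl fun p _ => ?_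
    rw [barMap_word p.2 (fun a => u (p.1 + 1 + a)), Finset.mul_sum]
    rfl

theorem isCoalgMap_barMap {f : Family A B} (hf : f 0 = 0) : IsCoalgMap (barMap 𝒜 f) := by
  have := isCoalgMap_geom (vanish_bar (𝒜 := 𝒜) hf)
  rwa [← barMap_eq_geom hf] at this

theorem cogenerators_comp_barMap {f : Family A B} (hf : f 0 = 0) :
    cogenerators ∘ₗ barMap 𝒜 f = bar 𝒜 f := by
  have := cogenerators_comp_geom (vanish_bar (𝒜 := 𝒜) hf)
  rwa [← barMap_eq_geom hf] at this

theorem bar_desuspend (φ : TensorCoalgebra A →ₗ[ℝ] B) :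
    bar 𝒜 (desuspend 𝒜 (fun n => φ.compMultilinearMap (pureTensor n))) = φ := by
  rw [bar, suspend_desuspend]
  apply linearMap_ext
  intro n v
  rw [liftPure_pureTensor]
  rfl

theorem desuspend_zero {φ : TensorCoalgebra A →ₗ[ℝ] B} (h : φ 1 = 0) :
    desuspend 𝒜 (fun n => φ.compMultilinearMap (pureTensor n)) 0 = 0 := by
  ext v
  simp only [desuspend, MultilinearMap.compLinearMap_apply, LinearMap.compMultilinearMap_apply,
    pureTensor_zero, h]
  rfl

theorem bar_comp (g : Family B C) (f : Family A B) :
    bar 𝒜 (comp 𝒜 ℬ g f) = cogenerators ∘ₗ barMap ℬ g ∘ₗ barMap 𝒜 f := bar_desuspend _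

theorem comp_zero {g : Family B C} {f : Family A B} (hg : g 0 = 0) (hf : f 0 = 0) :
    comp 𝒜 ℬ g f 0 = 0 := by
  apply desuspend_zero
  rw [LinearMap.comp_apply, LinearMap.comp_apply, (isCoalgMap_barMap hf).one,
    (isCoalgMap_barMap hg).one, cogenerators_one]

theorem barMap_comp {g : Family B C} {f : Family A B} (hg : g 0 = 0) (hf : f 0 = 0) :
    barMap 𝒜 (comp 𝒜 ℬ g f) = barMap ℬ g ∘ₗ barMap 𝒜 f := by
  refine (isCoalgMap_barMap (comp_zero hg hf)).ext
    ((isCoalgMap_barMap hg).comp (isCoalgMap_barMap hf)) ?_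
  rw [cogenerators_comp_barMap (comp_zero hg hf), bar_comp]

theorem barMap_id : barMap 𝒜 (idMorphism A) = LinearMap.id := by
  have h0 : idMorphism A 0 = 0 := rfl
  refine (isCoalgMap_barMap h0).ext isCoalgMap_id ?_
  rw [cogenerators_comp_barMap h0, LinearMap.comp_id]
  apply linearMap_ext
  intro n v
  rw [bar, cogenerators, liftPure_pureTensor, liftPure_pureTensor]
  match n with
  | 0 => rfl
  | 1 => simp [suspend, idMorphism, linFamily]
  | _ + 2 => rfl

/-! #### The sign operator -/

theorem tensorParity_one : tensorParity 𝒜 1 = 1 := by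
  rw [← pureTensor_zero Fin.elim0, tensorParity, liftPure_pureTensor,
    MultilinearMap.compLinearMap_apply, pureTensor_zero, pureTensor_zero]

theorem tensorParity_letter_mul (a : A) (w : TensorCoalgebra A) :
    tensorParity 𝒜 (letter a * w) = letter (sparity 𝒜 a) * tensorParity 𝒜 w := by
  have : tensorParity 𝒜 ∘ₗ LinearMap.mulLeft ℝ (letter a) =
      LinearMap.mulLeft ℝ (letter (sparity 𝒜 a)) ∘ₗ tensorParity 𝒜 := by
    apply linearMap_ext
    intro n v
    have e : letter a * pureTensor n v = pureTensor (n + 1) (Fin.cons a v : Fin (n + 1) → A) := by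
      simp [pureTensor_succ]
    simp only [LinearMap.comp_apply, LinearMap.mulLeft_apply, e, tensorParity,
      liftPure_pureTensor, MultilinearMap.compLinearMap_apply]
    simp [pureTensor_succ]
  exact LinearMap.congr_fun this w

theorem tensorParity_eq_geom : WithConv.toConv (tensorParity 𝒜) =
    geom (letters (sparity 𝒜 ∘ₗ cogenerators)) :=
  eq_geom_of_letter _ tensorParity_one tensorParity_letter_mul

theorem vanish_comp_cogenerators (χ : A →ₗ[ℝ] B) : Vanish 1 (χ ∘ₗ cogenerators) :=
  vanish_one_iff.2 (by rw [LinearMap.comp_apply, cogenerators_one, map_zero])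

theorem isCoalgMap_tensorParity : IsCoalgMap (tensorParity 𝒜) := by
  have := isCoalgMap_geom (vanish_comp_cogenerators (sparity 𝒜))
  rwa [← tensorParity_eq_geom] at this

/-! #### The bar differential -/

/-- The families in `insertion σ m i`, as a sequence. -/
def insertionSeq (σ : A →ₗ[ℝ] A) (m : Family A A) (i j : ℕ) : Family A A :=
  if j < i then linFamily σ else if j = i then m else linFamily LinearMap.id

theorem barDifferential_word {m : Family A A} (n : ℕ) (u : ℕ → A) :
    barDifferential 𝒜 m (pureTensor n (fun i => u i)) =
      ∑ c : Composition n, ∑ i ∈ Finset.range c.blocks.length,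
        blockProd (insertionSeq (sparity 𝒜) (suspend 𝒜 m) i) c.blocks u := by
  rw [barDifferential, liftPure_pureTensor, sum_apply]
  refine Finset.sum_congr rfl fun c _ => ?_
  rw [sum_apply, Finset.sum_range]
  refine Finset.sum_congr rfl fun i _ => ?_
  rw [← pureTensor_applyBlocks]
  change pureTensor c.length (applyBlocks c _ _) = _
  congr 2
  funext j
  simp only [insertion, insertionSeq, Fin.lt_def, Fin.ext_iff]

/-- Only the composition into ones contributes. Written as a sum over compositions, the identity can
be matched with the blocks behind `m̄` in the bar differential. -/
theorem id_word (n : ℕ) (u : ℕ → A) :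
    ∑ c : Composition n, blockProd (fun _ => linFamily LinearMap.id) c.blocks u =
      pureTensor n (fun i => u i) := by
  induction n using Nat.strong_induction_on generalizing u with
  | _ n ih =>
    cases n with
    | zero => rw [sum_composition_zero (fun b => blockProd _ b u), pureTensor_zero]; rfl
    | succ n =>
      rw [sum_composition_succ n (fun b => blockProd _ b u)]
      have := LinearMap.congr_fun (congrArg WithConv.ofConv (id_eq (A := A)))
        (pureTensor (n + 1) (fun i => u i))
      rw [WithConv.ofConv_add, LinearMap.add_apply, conv_one_word_succ, zero_add, cogenerators,
        letters_mul_word_succ rfl] at this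
      refine Eq.trans ?_ this.symm
      refine Finset.sum_congr rfl fun p hp => ?_
      have hp := Finset.HasAntidiagonal.mem_antidiagonal.1 hp
      rw [WithConv.ofConv_toConv, LinearMap.id_apply,
        ← ih p.2 (by omega) (fun a => u (p.1 + 1 + a)), Finset.mul_sum]
      rfl

/-- The two terms distinguish whether the first block lies in front of `m̄`, and then is a single
letter carrying the Koszul sign, or is the block to which `m̄` is applied. -/
theorem barDifferential_eq_add {m : Family A A} (hm : m 0 = 0) :
    WithConv.toConv (barDifferential 𝒜 m) =
      letters (sparity 𝒜 ∘ₗ cogenerators) * WithConv.toConv (barDifferential 𝒜 m) +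
        letters (bar 𝒜 m) * WithConv.toConv LinearMap.id := by
  refine WithConv.ofConv_injective (linearMap_ext fun n v => ?_)
  obtain ⟨u, rfl⟩ := exists_sequence v
  cases n with
  | zero =>
    rw [WithConv.ofConv_toConv, barDifferential_word,
      sum_composition_zero (fun b => ∑ i ∈ Finset.range b.length,
        blockProd (insertionSeq (sparity 𝒜) (suspend 𝒜 m) i) b u),
      pureTensor_zero, WithConv.ofConv_add, LinearMap.add_apply,
      vanish_one_iff.1 ((vanish_comp_cogenerators _).letters.mul_right _),
      vanish_one_iff.1 ((vanish_bar hm).letters.mul_right _)]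
    simp
  | succ n =>
    rw [WithConv.ofConv_add, LinearMap.add_apply, bar, letters_mul_word_succ (suspend_zero hm),
      ← liftPure_linFamily, letters_mul_word_succ rfl, WithConv.ofConv_toConv,
      WithConv.ofConv_toConv, barDifferential_word,
      sum_composition_succ n (fun b => ∑ i ∈ Finset.range b.length,
        blockProd (insertionSeq (sparity 𝒜) (suspend 𝒜 m) i) b u),
      ← Finset.sum_add_distrib]
    refine Finset.sum_congr rfl fun p _ => ?_
    rw [barDifferential_word p.2 (fun a => u (p.1 + 1 + a)), LinearMap.id_apply,
      ← id_word p.2 (fun a => u (p.1 + 1 + a)), Finset.mul_sum, Finset.mul_sum,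
      ← Finset.sum_add_distrib]
    refine Finset.sum_congr rfl fun c _ => ?_
    rw [List.length_cons, Finset.sum_range_succ', Finset.mul_sum]
    congr 1
    · refine Finset.sum_congr rfl fun i _ => ?_
      rw [blockProd]
      congr 2
      funext j
      simp [insertionSeq]

/-- The left factor is the Koszul sign of everything that `m̄`, of degree one, has been moved past.
-/
theorem barDifferential_eq_mul {m : Family A A} (hm : m 0 = 0) :
    WithConv.toConv (barDifferential 𝒜 m) =
      WithConv.toConv (tensorParity 𝒜) * letters (bar 𝒜 m) * WithConv.toConv LinearMap.id := by
  rw [tensorParity_eq_geom, mul_assoc]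
  exact eq_geom_mul (vanish_comp_cogenerators _).letters (barDifferential_eq_add hm)

theorem isCoder_barDifferential {m : Family A A} (hm : m 0 = 0) :
    IsCoder (tensorParity 𝒜) LinearMap.id (barDifferential 𝒜 m) := by
  have := isCoalgMap_tensorParity.isCoder_mul (F := tensorParity 𝒜) isCoalgMap_id (bar 𝒜 m)
  rwa [← barDifferential_eq_mul hm] at this

theorem cogenerators_comp_barDifferential {m : Family A A} (hm : m 0 = 0) :
    cogenerators ∘ₗ barDifferential 𝒜 m = bar 𝒜 m := by
  have := cogenerators_comp_coderivation (f := WithConv.toConv (tensorParity 𝒜))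
    (g := WithConv.toConv LinearMap.id) isCoalgMap_tensorParity.counit rfl (bar 𝒜 m)
  rwa [← barDifferential_eq_mul hm] at this

end BarConv

/-! ### Degrees and signs -/

section Degree

variable {A B C : Type*} [AddCommGroup A] [Module ℝ A] [AddCommGroup B] [Module ℝ B]
  [AddCommGroup C] [Module ℝ C]
variable {𝒜 : ℤ → Submodule ℝ A} {ℬ : ℤ → Submodule ℝ B} {𝒞 : ℤ → Submodule ℝ C}

/-- `f` maps elements of degree `k` to elements of degree `k + d`. -/
def MapsDegree {V W : Type*} [AddCommGroup V] [Module ℝ V] [AddCommGroup W] [Module ℝ W]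
    (𝒱 : ℤ → Submodule ℝ V) (𝒲 : ℤ → Submodule ℝ W) (d : ℤ) (f : V →ₗ[ℝ] W) : Prop :=
  ∀ k, ∀ x ∈ 𝒱 k, f x ∈ 𝒲 (k + d)

section MapsDegree

variable {U V W : Type*} [AddCommGroup U] [Module ℝ U] [AddCommGroup V] [Module ℝ V]
  [AddCommGroup W] [Module ℝ W] {𝒰 : ℤ → Submodule ℝ U} {𝒱 : ℤ → Submodule ℝ V}
  {𝒲 : ℤ → Submodule ℝ W} {d e : ℤ}

theorem MapsDegree.comp {g : V →ₗ[ℝ] W} {f : U →ₗ[ℝ] V} (hg : MapsDegree 𝒱 𝒲 e g)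
    (hf : MapsDegree 𝒰 𝒱 d f) {c : ℤ} (h : d + e = c) : MapsDegree 𝒰 𝒲 c (g ∘ₗ f) := by
  intro k x hx
  have := hg _ _ (hf k x hx)
  rwa [add_assoc, h] at this

theorem MapsDegree.add {f g : V →ₗ[ℝ] W} (hf : MapsDegree 𝒱 𝒲 d f) (hg : MapsDegree 𝒱 𝒲 d g) :
    MapsDegree 𝒱 𝒲 d (f + g) := fun k x hx => add_mem (hf k x hx) (hg k x hx)

theorem MapsDegree.sub {f g : V →ₗ[ℝ] W} (hf : MapsDegree 𝒱 𝒲 d f) (hg : MapsDegree 𝒱 𝒲 d g) :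
    MapsDegree 𝒱 𝒲 d (f - g) := fun k x hx => sub_mem (hf k x hx) (hg k x hx)

theorem MapsDegree.zero : MapsDegree 𝒱 𝒲 d (0 : V →ₗ[ℝ] W) := fun _ _ _ => zero_mem _

end MapsDegree

theorem word_mem_tensorGrading {n : ℕ} {e : Fin n → ℤ} {v : Fin n → A}
    (h : ∀ i, v i ∈ shift 𝒜 (e i)) : pureTensor n v ∈ tensorGrading 𝒜 (∑ i, e i) :=
  Submodule.subset_span ⟨n, e, v, h, rfl, rfl⟩

/-- A linear map is homogeneous if it is so on words of homogeneous letters. -/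
theorem mapsDegree_of_word {W : Type*} [AddCommGroup W] [Module ℝ W] {𝒲 : ℤ → Submodule ℝ W}
    {d : ℤ} {f : TensorCoalgebra A →ₗ[ℝ] W}
    (h : ∀ (n : ℕ) (e : Fin n → ℤ) (v : Fin n → A), (∀ i, v i ∈ shift 𝒜 (e i)) →
      f (pureTensor n v) ∈ 𝒲 (∑ i, e i + d)) : MapsDegree (tensorGrading 𝒜) 𝒲 d f := by
  intro k x hx
  induction hx using Submodule.span_induction with
  | mem x hx =>
    obtain ⟨n, e, v, hv, rfl, rfl⟩ := hx
    exact h n e v hv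
  | zero => rw [map_zero]; exact zero_mem _
  | add x y _ _ hx hy => rw [map_add]; exact add_mem hx hy
  | smul r x _ hx => rw [map_smul]; exact Submodule.smul_mem _ _ hx

theorem tensorGrading_mul {i j : ℤ} {x y : TensorCoalgebra A} (hx : x ∈ tensorGrading 𝒜 i)
    (hy : y ∈ tensorGrading 𝒜 j) : x * y ∈ tensorGrading 𝒜 (i + j) := by
  induction hx using Submodule.span_induction with
  | mem x hx =>
    obtain ⟨m, e, v, hv, rfl, rfl⟩ := hx
    induction hy using Submodule.span_induction with
    | mem y hy =>
      obtain ⟨n, e', v', hv', rfl, rfl⟩ := hy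
      rw [pureTensor_mul]
      have := word_mem_tensorGrading (e := Fin.append e e') (v := Fin.append v v') (𝒜 := 𝒜)
        (fun i => by refine Fin.addCases (fun i => ?_) (fun i => ?_) i <;> simp [hv, hv'])
      simpa [Fin.sum_univ_add] using this
    | zero => rw [mul_zero]; exact zero_mem _
    | add x y _ _ hx hy => rw [mul_add]; exact add_mem hx hy
    | smul r x _ hx => rw [mul_smul_comm]; exact Submodule.smul_mem _ _ hx
  | zero => rw [zero_mul]; exact zero_mem _
  | add x y _ _ hx hy => rw [add_mul]; exact add_mem hx hy
  | smul r x _ hx => rw [smul_mul_assoc]; exact Submodule.smul_mem _ _ hx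

theorem one_mem_tensorGrading : (1 : TensorCoalgebra A) ∈ tensorGrading 𝒜 0 := by
  have := word_mem_tensorGrading (𝒜 := 𝒜) (n := 0) (e := Fin.elim0) (v := Fin.elim0)
    (fun i => i.elim0)
  rwa [pureTensor_zero] at this

theorem letter_mem_tensorGrading {k : ℤ} {a : A} (h : a ∈ shift 𝒜 k) :
    letter a ∈ tensorGrading 𝒜 k := by
  have := word_mem_tensorGrading (𝒜 := 𝒜) (n := 1) (e := fun _ => k) (v := fun _ => a) (fun _ => h)
  rwa [pureTensor_one, Fin.sum_univ_one] at this

theorem mapsDegree_letter : MapsDegree (shift 𝒜) (tensorGrading 𝒜) 0 letter := fun k x hx => by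
  rw [add_zero]; exact letter_mem_tensorGrading hx

theorem mapsDegree_cogenerators : MapsDegree (tensorGrading 𝒜) (shift 𝒜) 0 cogenerators := by
  refine mapsDegree_of_word fun n e v h => ?_
  rw [cogenerators, liftPure_pureTensor]
  match n with
  | 0 => exact zero_mem _
  | 1 =>
    rw [Fin.sum_univ_one, add_zero]
    exact h 0
  | _ + 2 => exact zero_mem _

theorem mapsDegree_mul {d e c : ℤ} {f g : Conv A (TensorCoalgebra B)}
    (hf : MapsDegree (tensorGrading 𝒜) (tensorGrading ℬ) d f.ofConv)
    (hg : MapsDegree (tensorGrading 𝒜) (tensorGrading ℬ) e g.ofConv) (h : d + e = c) :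
    MapsDegree (tensorGrading 𝒜) (tensorGrading ℬ) c (f * g).ofConv := by
  refine mapsDegree_of_word fun n ε v hv => ?_
  obtain ⟨u, rfl⟩ := exists_sequence v
  obtain ⟨ε, rfl⟩ := exists_sequence ε
  rw [conv_mul_word]
  refine Submodule.sum_mem _ fun p hp => ?_
  obtain ⟨p, q⟩ := p
  obtain rfl := Finset.HasAntidiagonal.mem_antidiagonal.1 hp
  have h1 := hf _ _ (word_mem_tensorGrading (𝒜 := 𝒜) (n := p) (e := fun i => ε i)
    (v := fun i => u i) (fun i => hv ⟨i, by have := i.2; simp only; omega⟩))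
  have h2 := hg _ _ (word_mem_tensorGrading (𝒜 := 𝒜) (n := q) (e := fun i => ε (p + i))
    (v := fun i => u (p + i)) (fun i => hv ⟨p + i, by have := i.2; simp only; omega⟩))
  have h3 := tensorGrading_mul h1 h2
  have : (∑ i : Fin (p + q), ε i) + c = ∑ i : Fin p, ε i + d + (∑ i : Fin q, ε (p + i) + e) := by
    rw [Fin.sum_univ_add, ← h]
    simp only [Fin.val_castAdd, Fin.val_natAdd]
    ring
  rw [this]
  exact h3

theorem mapsDegree_one :
    MapsDegree (tensorGrading 𝒜) (tensorGrading ℬ) 0 (1 : Conv A (TensorCoalgebra B)).ofConv := by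
  refine mapsDegree_of_word fun n e v h => ?_
  cases n with
  | zero =>
    rw [pureTensor_zero, conv_one_apply_one]
    simpa using one_mem_tensorGrading
  | succ n => rw [conv_one_word_succ]; exact zero_mem _

theorem mapsDegree_letters {d : ℤ} {φ : TensorCoalgebra A →ₗ[ℝ] B}
    (h : MapsDegree (tensorGrading 𝒜) (shift ℬ) d φ) :
    MapsDegree (tensorGrading 𝒜) (tensorGrading ℬ) d (letters φ).ofConv :=
  mapsDegree_letter.comp h (add_zero d)

theorem mapsDegree_pow {f : Conv A (TensorCoalgebra B)}
    (hf : MapsDegree (tensorGrading 𝒜) (tensorGrading ℬ) 0 f.ofConv) (n : ℕ) :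
    MapsDegree (tensorGrading 𝒜) (tensorGrading ℬ) 0 (f ^ n).ofConv := by
  induction n with
  | zero => exact mapsDegree_one
  | succ n ih => rw [pow_succ]; exact mapsDegree_mul ih hf (add_zero 0)

theorem mapsDegree_geom {φ : TensorCoalgebra A →ₗ[ℝ] B}
    (h : MapsDegree (tensorGrading 𝒜) (shift ℬ) 0 φ) :
    MapsDegree (tensorGrading 𝒜) (tensorGrading ℬ) 0 (geom (letters φ)).ofConv := by
  refine mapsDegree_of_word fun n e v hv => ?_
  rw [geom, WithConv.ofConv_toConv, liftPure_pureTensor, LinearMap.compMultilinearMap_apply,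
    WithConv.ofConv_sum, LinearMap.sum_apply]
  exact Submodule.sum_mem _ fun k _ =>
    mapsDegree_pow (mapsDegree_letters h) k _ _ (word_mem_tensorGrading hv)

theorem mapsDegree_id {V : Type*} [AddCommGroup V] [Module ℝ V] {𝒱 : ℤ → Submodule ℝ V} :
    MapsDegree 𝒱 𝒱 0 LinearMap.id := fun k x hx => by rwa [add_zero]

variable [DirectSum.Decomposition 𝒜]

/-! #### Sign operators -/

theorem parity_mul_parity : parity 𝒜 * parity 𝒜 = 1 := by
  refine LinearMap.ext fun x => ?_
  induction x using DirectSum.Decomposition.inductionOn 𝒜 with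
  | zero => simp
  | add a b ha hb => simp_all
  | @homogeneous i a =>
    rw [Module.End.mul_apply, parity_apply_of_mem 𝒜 a.2, map_zsmul,
      parity_apply_of_mem 𝒜 a.2, smul_smul, ← Units.val_mul]
    simp

theorem sparity_mul_sparity : sparity 𝒜 * sparity 𝒜 = 1 := by
  simp [sparity, parity_mul_parity]

theorem sparity_pow_eq {a b : ℕ} (h : a % 2 = b % 2) : sparity 𝒜 ^ a = sparity 𝒜 ^ b := by
  have key : ∀ n : ℕ, sparity 𝒜 ^ n = sparity 𝒜 ^ (n % 2) := fun n => by
    conv_lhs => rw [← Nat.div_add_mod n 2, pow_add, pow_mul, pow_two, sparity_mul_sparity, one_pow,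
      one_mul]
  rw [key a, key b, h]

theorem parity_pow (n : ℕ) : parity 𝒜 ^ n = (-1 : ℝ) ^ n • sparity 𝒜 ^ n := by
  have : parity 𝒜 = (-1 : ℝ) • sparity 𝒜 := by simp [sparity]
  rw [this, smul_pow]

/-- The sign `(-1)^k` as a real number. -/
def realSign (k : ℤ) : ℝ := ((Int.negOnePow k : ℤˣ) : ℤ)

theorem realSign_add (k l : ℤ) : realSign (k + l) = realSign k * realSign l := by
  simp [realSign, Int.negOnePow_add]

theorem realSign_zero : realSign 0 = 1 := by simp [realSign]

theorem realSign_one : realSign 1 = -1 := by simp [realSign]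

theorem realSign_neg_one : realSign (-1) = -1 := by simp [realSign]

theorem realSign_mul_self (k : ℤ) : realSign k * realSign k = 1 := by
  rw [realSign, ← Int.cast_mul, ← Units.val_mul]; simp

theorem realSign_sum {n : ℕ} (e : Fin n → ℤ) : realSign (∑ i, e i) = ∏ i, realSign (e i) := by
  induction n with
  | zero => simp [realSign_zero]
  | succ n ih => rw [Fin.sum_univ_succ, Fin.prod_univ_succ, realSign_add, ih]

theorem sparity_apply {k : ℤ} {x : A} (hx : x ∈ shift 𝒜 k) : sparity 𝒜 x = realSign k • x := by
  rw [sparity_apply_of_mem 𝒜 hx, realSign, Int.cast_smul_eq_zsmul]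

theorem parity_apply {k : ℤ} {x : A} (hx : x ∈ 𝒜 k) : parity 𝒜 x = realSign k • x := by
  rw [parity_apply_of_mem 𝒜 hx, realSign, Int.cast_smul_eq_zsmul]

theorem tensorParity_apply {k : ℤ} {x : TensorCoalgebra A} (hx : x ∈ tensorGrading 𝒜 k) :
    tensorParity 𝒜 x = realSign k • x := by
  induction hx using Submodule.span_induction with
  | mem x hx =>
    obtain ⟨n, e, v, hv, rfl, rfl⟩ := hx
    rw [tensorParity, liftPure_pureTensor, MultilinearMap.compLinearMap_apply, realSign_sum,
      ← MultilinearMap.map_smul_univ]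
    congr 1
    funext i
    exact sparity_apply (hv i)
  | zero => simp
  | add x y _ _ hx hy => rw [map_add, hx, hy, smul_add]
  | smul r x _ hx => rw [map_smul, hx, smul_comm]

/-- Only spanning is needed, as linear maps will be compared on homogeneous elements; directness of
the sum plays no role. -/
theorem iSup_tensorGrading : ⨆ k, tensorGrading 𝒜 k = ⊤ := by
  set S := ⨆ k, tensorGrading 𝒜 k with hS
  have h : S.mkQ = 0 := by
    refine linearMap_ext_letter ?_ fun a w hw => ?_
    · rw [LinearMap.zero_apply, Submodule.mkQ_apply, Submodule.Quotient.mk_eq_zero]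
      exact Submodule.mem_iSup_of_mem 0 one_mem_tensorGrading
    · rw [LinearMap.zero_apply, Submodule.mkQ_apply, Submodule.Quotient.mk_eq_zero] at *
      induction a using DirectSum.Decomposition.inductionOn 𝒜 with
      | zero => rw [map_zero, zero_mul]; exact zero_mem _
      | add a b ha hb => rw [map_add, add_mul]; exact add_mem ha hb
      | @homogeneous i a =>
        have ha : (a : A) ∈ shift 𝒜 (i - 1) := by simp [shift]
        refine Submodule.iSup_induction (tensorGrading 𝒜)
          (motive := fun w => letter (a : A) * w ∈ S) hw ?_ ?_ ?_
        · intro k x hx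
          exact Submodule.mem_iSup_of_mem _ (tensorGrading_mul (letter_mem_tensorGrading ha) hx)
        · rw [mul_zero]; exact zero_mem _
        · intro x y hx hy; rw [mul_add]; exact add_mem hx hy
  rw [← Submodule.ker_mkQ S, h, LinearMap.ker_zero]

theorem linearMap_ext_homogeneous {V : Type*} [AddCommGroup V] [Module ℝ V]
    {f g : TensorCoalgebra A →ₗ[ℝ] V} (h : ∀ k, ∀ x ∈ tensorGrading 𝒜 k, f x = g x) : f = g := by
  refine LinearMap.ext fun x => ?_
  have hx : x ∈ ⨆ k, tensorGrading 𝒜 k := by rw [iSup_tensorGrading]; trivial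
  induction hx using Submodule.iSup_induction' with
  | mem k x hx => exact h k x hx
  | zero => simp
  | add x y _ _ hx hy => rw [map_add, map_add, hx, hy]

theorem tensorParity_comp [DirectSum.Decomposition ℬ] {d : ℤ} {X : TensorCoalgebra A →ₗ[ℝ] TensorCoalgebra B}
    (hX : MapsDegree (tensorGrading 𝒜) (tensorGrading ℬ) d X) :
    tensorParity ℬ ∘ₗ X = realSign d • (X ∘ₗ tensorParity 𝒜) := by
  refine linearMap_ext_homogeneous (𝒜 := 𝒜) fun k x hx => ?_
  rw [LinearMap.comp_apply, LinearMap.smul_apply, LinearMap.comp_apply, tensorParity_apply hx,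
    tensorParity_apply (hX k x hx), map_smul, smul_smul, realSign_add, mul_comm]

theorem tensorParity_comp_tensorParity : tensorParity 𝒜 ∘ₗ tensorParity 𝒜 = LinearMap.id := by
  refine linearMap_ext_homogeneous (𝒜 := 𝒜) fun k x hx => ?_
  rw [LinearMap.comp_apply, tensorParity_apply hx, map_smul, tensorParity_apply hx, smul_smul,
    realSign_mul_self, one_smul]
  rfl

theorem mapsDegree_tensorParity :
    MapsDegree (tensorGrading 𝒜) (tensorGrading 𝒜) 0 (tensorParity 𝒜) := fun k x hx => by
  rw [tensorParity_apply hx, add_zero]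
  exact Submodule.smul_mem _ _ hx

/-! #### Degrees of families -/

theorem sparity_mem {k : ℤ} {x : A} (hx : x ∈ 𝒜 k) : sparity 𝒜 x ∈ 𝒜 k := by
  rw [sparity, LinearMap.neg_apply, parity_apply hx]
  exact neg_mem (Submodule.smul_mem _ _ hx)

theorem sparity_pow_mem {k : ℤ} {x : A} (hx : x ∈ 𝒜 k) (n : ℕ) : (sparity 𝒜 ^ n) x ∈ 𝒜 k := by
  induction n with
  | zero => simpa
  | succ n ih => rw [pow_succ']; exact sparity_mem ih

theorem mapsDegree_bar {c : ℤ} {f : Family A B} (hf : f.HasDegree 𝒜 ℬ (fun n => c - n)) :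
    MapsDegree (tensorGrading 𝒜) (shift ℬ) (c - 1) (bar 𝒜 f) := by
  refine mapsDegree_of_word fun n e v hv => ?_
  rw [bar, liftPure_pureTensor, suspend, MultilinearMap.compLinearMap_apply]
  have := hf n (fun i => e i + 1) _ (fun i => sparity_pow_mem (𝒜 := 𝒜) (hv i) (i.rev : ℕ))
  have e1 : ∑ i, (e i + 1) + (c - n) = ∑ i, e i + (c - 1) + 1 := by
    rw [Finset.sum_add_distrib]; simp; ring
  rw [e1] at this
  exact this

theorem hasDegree_of_bar {c : ℤ} {f : Family A B}
    (hf : MapsDegree (tensorGrading 𝒜) (shift ℬ) (c - 1) (bar 𝒜 f)) :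
    f.HasDegree 𝒜 ℬ (fun n => c - n) := by
  intro n e v hv
  have h := hf _ _ (word_mem_tensorGrading (𝒜 := 𝒜) (e := fun i => e i - 1)
    (v := fun i => (sparity 𝒜 ^ (i.rev : ℕ)) (v i)) (fun i => by
      have := sparity_pow_mem (hv i) (i.rev : ℕ)
      simpa [shift] using this))
  rw [bar, liftPure_pureTensor, suspend, MultilinearMap.compLinearMap_apply] at h
  have e1 : ∑ i, (e i - 1) + (c - 1) + 1 = ∑ i, e i + (c - n) := by
    rw [Finset.sum_sub_distrib]; simp; ring
  rw [shift, e1] at h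
  convert h using 2
  funext i
  rw [← Module.End.mul_apply, ← pow_add, sparity_pow_eq (b := 0) (by omega), pow_zero]
  rfl

/-- The sign rule for a member of a homogeneous family. -/
theorem sparity_apply_family [DirectSum.Decomposition ℬ] {c : ℤ} {f : Family A B} (hf : f.HasDegree 𝒜 ℬ (fun n => c - n))
    (n : ℕ) (v : Fin n → A) :
    sparity ℬ (f n v) = realSign (c - 1) • f n (fun i => sparity 𝒜 (v i)) := by
  have h : (sparity ℬ).compMultilinearMap (f n) =
      realSign (c - 1) • (f n).compLinearMap (fun _ => sparity 𝒜) := by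
    -- All arities are packed into linear maps on the tensor coalgebra, where an identity may be
    -- tested on words of homogeneous letters.
    have h2 : liftPure (fun n => (sparity ℬ).compMultilinearMap (f n)) =
        realSign (c - 1) • liftPure (fun n => (f n).compLinearMap (fun _ => sparity 𝒜)) := by
      refine linearMap_ext_homogeneous (𝒜 := 𝒜) fun k x hx => ?_
      induction hx using Submodule.span_induction with
      | mem x hx =>
        obtain ⟨n, e, v, hv, rfl, rfl⟩ := hx
        have h3 := hf n (fun i => e i + 1) v hv
        have e1 : ∑ i, (e i + 1) + (c - n) = ∑ i, e i + (c - 1) + 1 := by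
          rw [Finset.sum_add_distrib]; simp; ring
        rw [e1] at h3
        rw [LinearMap.smul_apply, liftPure_pureTensor, liftPure_pureTensor,
          LinearMap.compMultilinearMap_apply, MultilinearMap.compLinearMap_apply,
          sparity_apply (k := ∑ i, e i + (c - 1)) h3, realSign_add, mul_comm, mul_smul,
          realSign_sum, ← MultilinearMap.map_smul_univ]
        congr 2
        funext i
        exact (sparity_apply (hv i)).symm
      | zero => simp
      | add x y _ _ hx hy => rw [map_add, map_add, hx, hy]
      | smul r x _ hx => rw [map_smul, map_smul, hx]
    ext v
    have h3 := LinearMap.congr_fun h2 (pureTensor n v)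
    rwa [LinearMap.smul_apply, liftPure_pureTensor, liftPure_pureTensor] at h3
  exact congrArg (fun g => g v) h

theorem sparity_pow_apply_family [DirectSum.Decomposition ℬ] {c : ℤ} {f : Family A B}
    (hf : f.HasDegree 𝒜 ℬ (fun n => c - n)) (r n : ℕ) (v : Fin n → A) :
    (sparity ℬ ^ r) (f n v) =
      realSign (c - 1) ^ r • f n (fun i => (sparity 𝒜 ^ r) (v i)) := by
  induction r with
  | zero => simp
  | succ r ih =>
    rw [pow_succ', Module.End.mul_apply, ih, map_smul, sparity_apply_family hf, smul_smul, pow_succ]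
    simp only [pow_succ' (sparity 𝒜), Module.End.mul_apply]

end Degree

/-! ### The defining relations in terms of the bar construction -/

section Relations

variable {A B C : Type*} [AddCommGroup A] [Module ℝ A] [AddCommGroup B] [Module ℝ B]
  [AddCommGroup C] [Module ℝ C]
variable {𝒜 : ℤ → Submodule ℝ A} {ℬ : ℤ → Submodule ℝ B}

theorem linFamily_apply_of_eq_one (σ : A →ₗ[ℝ] B) {k : ℕ} (hk : k = 1) (w : Fin k → A) :
    linFamily σ k w = σ (w ⟨0, by omega⟩) := by
  subst hk; rfl

theorem linFamily_of_ne_one (σ : A →ₗ[ℝ] B) {k : ℕ} (hk : k ≠ 1) : linFamily σ k = 0 := by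
  match k, hk with
  | 0, _ => rfl
  | _ + 2, _ => rfl

theorem applyBlocks_insertion_eq_zero {n : ℕ} (c : Composition n) (σ : A →ₗ[ℝ] A)
    (m : Family A A) {i j : Fin c.length} (hj : j ≠ i) (h : c.blocksFun j ≠ 1) (v : Fin n → A) :
    applyBlocks c (insertion σ m i) v j = 0 := by
  rw [applyBlocks, insertion]
  split_ifs
  · rw [linFamily_of_ne_one _ h]; rfl
  · rw [linFamily_of_ne_one _ h]; rfl

/-- Positions of the blocks of a composition all of whose blocks but one have length one. -/
theorem sizeUpTo_of_blocks_eq_one {n : ℕ} (c : Composition n) (i : Fin c.length)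
    (h : ∀ j, j ≠ i → c.blocksFun j = 1) (j : ℕ) (hj : j ≤ c.length) :
    c.sizeUpTo j = if j ≤ i then j else j + c.blocksFun i - 1 := by
  have hpos : 0 < c.blocksFun i := c.one_le_blocksFun i
  induction j with
  | zero => simp
  | succ j ih =>
    have hj' : j < c.length := hj
    have h1 : c.sizeUpTo (j + 1) = c.sizeUpTo j + c.blocksFun ⟨j, hj'⟩ := c.sizeUpTo_succ' ⟨j, hj'⟩
    rw [h1, ih hj'.le]
    by_cases hji : j = i
    · have : (⟨j, hj'⟩ : Fin c.length) = i := Fin.ext hji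
      rw [this, if_pos hji.le, if_neg (by omega)]
      omega
    · rw [h ⟨j, hj'⟩ (fun e => hji (congrArg Fin.val e))]
      split_ifs <;> omega

variable [DirectSum.Decomposition 𝒜]

theorem twist_twist (n : ℕ) (v : Fin n → A) :
    (fun j : Fin n => (sparity 𝒜 ^ (j.rev : ℕ)) ((sparity 𝒜 ^ (j.rev : ℕ)) (v j))) = v := by
  funext j
  rw [← Module.End.mul_apply, ← pow_add, sparity_pow_eq (b := 0) (by omega), pow_zero]
  rfl

theorem neg_one_pow_eq_of_mod_two {a b : ℕ} (h : a % 2 = b % 2) : (-1 : ℝ) ^ a = (-1) ^ b := by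
  rw [neg_one_pow_eq_pow_mod_two, h, ← neg_one_pow_eq_pow_mod_two]

/-- If a block other than the `i`-th has length different from one, both sides vanish. Otherwise
each of the `i` letters in front contributes `(-1)^l`, from `parity = -sparity`, and moving the
suspension signs through `m̄_l`, of degree one, contributes `(-1)^(c.length - 1 - i)`. With `n =
c.length + l - 1` these combine to the stated sign. -/
theorem suspend_insertion {m : Family A A} (hm : m.HasDegree 𝒜 𝒜 (fun n => 2 - n))
    (g : Family A B) {n : ℕ} (c : Composition n) (i : Fin c.length) (v : Fin n → A) :
    suspend 𝒜 g c.length (applyBlocks c (insertion (sparity 𝒜) (suspend 𝒜 m) i) v) =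
      (-1 : ℝ) ^ (1 + n + ((i : ℕ) + 1) * (c.blocksFun i + 1)) •
        g c.length (applyBlocks c (insertion (parity 𝒜 ^ c.blocksFun i) m i)
          (fun j => (sparity 𝒜 ^ (j.rev : ℕ)) (v j))) := by
  rw [suspend, MultilinearMap.compLinearMap_apply]
  by_cases h : ∀ j, j ≠ i → c.blocksFun j = 1
  swap
  · push Not at h
    obtain ⟨j, hj, hj1⟩ := h
    rw [MultilinearMap.map_coord_zero _ j, MultilinearMap.map_coord_zero _ j, smul_zero]
    · exact applyBlocks_insertion_eq_zero c _ _ hj hj1 _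
    · rw [applyBlocks_insertion_eq_zero c _ _ hj hj1 _, map_zero]
  have hsize := sizeUpTo_of_blocks_eq_one c i h
  have hn : n = c.length + c.blocksFun i - 1 := by
    have := hsize c.length le_rfl
    rwa [c.sizeUpTo_length, if_neg (by omega)] at this
  have hl : 0 < c.blocksFun i := c.one_le_blocksFun i
  set l := c.blocksFun i with hl_def
  let s : Fin c.length → ℝ := fun j =>
    if j < i then (-1) ^ l else if j = i then (-1) ^ (c.length - 1 - i) else 1
  -- Once the sign is distributed over the entries, multilinearity reduces the claim to an identity
  -- in each entry.
  have hs : (-1 : ℝ) ^ (1 + n + ((i : ℕ) + 1) * (l + 1)) = ∏ j, s j := by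
    have h1 : ∏ j, s j = ((-1) ^ l) ^ (i : ℕ) * (-1) ^ (c.length - 1 - i) := by
      simp only [s, Finset.prod_ite, Finset.prod_const]
      congr 2
      · rw [Finset.filter_gt_eq_Iio, Fin.card_Iio]
      · rw [Finset.filter_filter]
        have : (Finset.univ.filter fun a : Fin c.length => ¬a < i ∧ a = i) = {i} := by
          ext a; simp only [Finset.mem_filter, Finset.mem_univ, true_and, Finset.mem_singleton]
          constructor
          · exact fun h => h.2
          · rintro rfl; exact ⟨lt_irrefl _, rfl⟩
        rw [this]; simp
    rw [h1, ← pow_mul, ← pow_add]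
    apply neg_one_pow_eq_of_mod_two
    have := i.2
    have e : ((i : ℕ) + 1) * (l + 1) = l * i + i + l + 1 := by ring
    rw [e]
    generalize l * (i : ℕ) = p
    omega
  rw [hs, ← MultilinearMap.map_smul_univ]
  congr 1
  funext j
  have hi := i.2
  have hj := j.2
  have hjsize := hsize j j.2.le
  rcases lt_trichotomy j i with hji | hji | hji
  · have hk := h j hji.ne
    simp only [applyBlocks, insertion, if_pos hji, s]
    rw [linFamily_apply_of_eq_one _ hk, linFamily_apply_of_eq_one _ hk, parity_pow,
      LinearMap.smul_apply, smul_smul, ← mul_pow, neg_one_mul, neg_neg, one_pow, one_smul]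
    simp only [Function.comp_apply]
    rw [← Module.End.mul_apply, ← Module.End.mul_apply, ← pow_succ, ← pow_add]
    refine congrArg (fun T : A →ₗ[ℝ] A => T _) (sparity_pow_eq ?_)
    rw [if_pos (by omega)] at hjsize
    rw [Fin.val_rev, Fin.val_rev, c.coe_embedding, hjsize]
    simp only
    omega
  · subst hji
    simp only [applyBlocks, insertion, lt_irrefl, if_false, if_true, s]
    rw [suspend, MultilinearMap.compLinearMap_apply, sparity_pow_apply_family hm,
      show (2 : ℤ) - 1 = 1 by norm_num, realSign_one]
    congr 1
    · congr 1
      rw [Fin.val_rev]; omega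
    · congr 1
      funext a
      simp only [Function.comp_apply]
      rw [← Module.End.mul_apply, ← pow_add]
      refine congrArg (fun T : A →ₗ[ℝ] A => T _) (sparity_pow_eq ?_)
      rw [if_pos (by omega)] at hjsize
      rw [Fin.val_rev, Fin.val_rev, Fin.val_rev, c.coe_embedding, hjsize]
      have := a.2
      omega
  · have hk := h j hji.ne'
    simp only [applyBlocks, insertion, if_neg hji.not_gt, if_neg hji.ne', s]
    rw [linFamily_apply_of_eq_one _ hk, linFamily_apply_of_eq_one _ hk, one_smul]
    simp only [Function.comp_apply, LinearMap.id_apply]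
    refine congrArg (fun T : A →ₗ[ℝ] A => T _) (sparity_pow_eq ?_)
    rw [if_neg (by omega)] at hjsize
    rw [Fin.val_rev, Fin.val_rev, c.coe_embedding, hjsize]
    simp only
    omega

theorem sum_ite_lt_blocksFun {n : ℕ} (c : Composition n) (k : ℕ) (hk : k ≤ c.length) :
    ∑ μ : Fin c.length, (if (μ : ℕ) < k then c.blocksFun μ else 0) = c.sizeUpTo k := by
  induction k with
  | zero => simp
  | succ k ih =>
    have hk' : k < c.length := hk
    have h1 : c.sizeUpTo (k + 1) = c.sizeUpTo k + c.blocksFun ⟨k, hk'⟩ :=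
      c.sizeUpTo_succ' ⟨k, hk'⟩
    rw [h1, ← ih hk'.le]
    have h2 : c.blocksFun ⟨k, hk'⟩ =
        ∑ μ : Fin c.length, (if μ = ⟨k, hk'⟩ then c.blocksFun μ else 0) := by simp
    rw [h2, ← Finset.sum_add_distrib]
    refine Finset.sum_congr rfl fun μ _ => ?_
    by_cases h : μ = ⟨k, hk'⟩
    · subst h; simp
    · have : (μ : ℕ) ≠ k := fun e => h (Fin.ext e)
      rw [if_neg h, add_zero]
      congr 1
      exact propext (by omega)

theorem sizeUpTo_add_sum {n : ℕ} (c : Composition n) (j : Fin c.length) :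
    c.sizeUpTo j + c.blocksFun j + ∑ μ : Fin c.length, (if j < μ then c.blocksFun μ else 0) = n := by
  rw [← c.sizeUpTo_succ' j, ← sum_ite_lt_blocksFun c (j + 1) j.2, ← Finset.sum_add_distrib]
  conv_rhs => rw [← c.sum_blocksFun]
  refine Finset.sum_congr rfl fun μ _ => ?_
  simp only [Fin.lt_def]
  split_ifs <;> omega

theorem sum_ite_lt_one {l : ℕ} (j : Fin l) :
    ∑ μ : Fin l, (if j < μ then 1 else 0) = l - 1 - (j : ℕ) := by
  rw [Finset.sum_boole, Finset.filter_lt_eq_Ioi, Fin.card_Ioi]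
  simp

/-- The components `f̄_k` have degree zero, so the only signs come from replacing `parity` by
`-sparity`. Each of the `k_j` arguments of block `j` contributes `(-1)^(E_j)` with `E_j = ∑_{μ > j}
(k_μ + 1)`, and `∑ k_j E_j` is `signExponent`. -/
theorem suspend_blocks [DirectSum.Decomposition ℬ] {f : Family A B}
    (hf : f.HasDegree 𝒜 ℬ (fun n => 1 - n)) (g : Family B C) {n : ℕ} (c : Composition n)
    (v : Fin n → A) :
    suspend ℬ g c.length (applyBlocks c (fun _ => suspend 𝒜 f) v) =
      (-1 : ℝ) ^ signExponent c • g c.length (applyBlocks c (fun i => f.precomp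
          (parity 𝒜 ^ ∑ μ : Fin c.length, if i < μ then c.blocksFun μ + 1 else 0))
          (fun j => (sparity 𝒜 ^ (j.rev : ℕ)) (v j))) := by
  rw [suspend, MultilinearMap.compLinearMap_apply]
  have hE : ∀ j : Fin c.length, (∑ μ : Fin c.length, if j < μ then c.blocksFun μ + 1 else 0) =
      (∑ μ : Fin c.length, if j < μ then c.blocksFun μ else 0) + (c.length - 1 - (j : ℕ)) := by
    intro j
    rw [← sum_ite_lt_one, ← Finset.sum_add_distrib]
    refine Finset.sum_congr rfl fun μ _ => ?_
    split_ifs <;> rfl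
  have hs : (-1 : ℝ) ^ signExponent c = ∏ j : Fin c.length, (-1 : ℝ) ^ (c.blocksFun j *
      ∑ μ : Fin c.length, if j < μ then c.blocksFun μ + 1 else 0) := by
    rw [Finset.prod_pow_eq_pow_sum]
    congr 1
    simp only [hE, signExponent, mul_add, Finset.sum_add_distrib]
    rw [add_comm]
    congr 1
    rw [Finset.sum_comm]
    refine Finset.sum_congr rfl fun ν _ => ?_
    rw [Finset.mul_sum]
    refine Finset.sum_congr rfl fun μ _ => ?_
    split_ifs <;> simp
  rw [hs, ← MultilinearMap.map_smul_univ]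
  congr 1
  funext j
  simp only [applyBlocks, suspend, Family.precomp, MultilinearMap.compLinearMap_apply]
  rw [sparity_pow_apply_family hf, show (1 : ℤ) - 1 = 0 by norm_num, realSign_zero, one_pow,
    one_smul]
  set E := ∑ μ : Fin c.length, if j < μ then c.blocksFun μ + 1 else 0 with hE'
  have e1 : ((-1 : ℝ) ^ (c.blocksFun j * E)) = ∏ _a : Fin (c.blocksFun j), (-1 : ℝ) ^ E := by
    rw [Finset.prod_const, Finset.card_univ, Fintype.card_fin, mul_comm, pow_mul]
  rw [e1, ← MultilinearMap.map_smul_univ]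
  congr 1
  funext a
  rw [parity_pow, LinearMap.smul_apply, smul_smul, ← mul_pow, neg_one_mul, neg_neg, one_pow,
    one_smul]
  simp only [Function.comp_apply]
  rw [← Module.End.mul_apply, ← Module.End.mul_apply, ← pow_add, ← pow_add]
  refine congrArg (fun T : A →ₗ[ℝ] A => T _) (sparity_pow_eq ?_)
  have h1 := sizeUpTo_add_sum c j
  rw [hE', hE, Fin.val_rev, Fin.val_rev, Fin.val_rev, c.coe_embedding]
  have := a.2
  have := j.2
  omega

theorem bar_barDifferential_word {g : Family A B} {m : Family A A} (n : ℕ) (v : Fin n → A) :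
    bar 𝒜 g (barDifferential 𝒜 m (pureTensor n v)) =
      ∑ c : Composition n, ∑ i : Fin c.length,
        suspend 𝒜 g c.length (applyBlocks c (insertion (sparity 𝒜) (suspend 𝒜 m) i) v) := by
  rw [barDifferential, liftPure_pureTensor, sum_apply, map_sum]
  refine Finset.sum_congr rfl fun c _ => ?_
  rw [sum_apply, map_sum]
  exact Finset.sum_congr rfl fun i _ => liftPure_pureTensor _ _ _

theorem bar_barMap_word [DirectSum.Decomposition ℬ] {g : Family B C} {f : Family A B} (n : ℕ)
    (v : Fin n → A) :
    bar ℬ g (barMap 𝒜 f (pureTensor n v)) =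
      ∑ c : Composition n,
        suspend ℬ g c.length (applyBlocks c (fun _ => suspend 𝒜 f) v) := by
  rw [barMap, liftPure_pureTensor, sum_apply, map_sum]
  exact Finset.sum_congr rfl fun c _ => liftPure_pureTensor _ _ _

theorem IsAlgebra.mapsDegree {m : Family A A} (hm : IsAlgebra 𝒜 m) :
    MapsDegree (tensorGrading 𝒜) (shift 𝒜) 1 (bar 𝒜 m) := mapsDegree_bar (c := 2) hm.degree

theorem IsAlgebra.mapsDegree_barDifferential {m : Family A A} (hm : IsAlgebra 𝒜 m) :
    MapsDegree (tensorGrading 𝒜) (tensorGrading 𝒜) 1 (barDifferential 𝒜 m) := by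
  have := mapsDegree_mul (mapsDegree_mul (f := WithConv.toConv (tensorParity 𝒜))
    mapsDegree_tensorParity (mapsDegree_letters hm.mapsDegree) (zero_add 1))
    (g := WithConv.toConv LinearMap.id) mapsDegree_id (add_zero 1)
  rwa [← barDifferential_eq_mul hm.zero] at this

theorem IsAlgebra.parity_comp {m : Family A A} (hm : IsAlgebra 𝒜 m) :
    tensorParity 𝒜 ∘ₗ barDifferential 𝒜 m = -(barDifferential 𝒜 m ∘ₗ tensorParity 𝒜) := by
  rw [tensorParity_comp hm.mapsDegree_barDifferential, realSign_one]
  exact LinearMap.ext fun x => neg_one_smul ℝ _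

/-- The square of an odd coderivation is a coderivation over the identity, hence is zero as soon as
its projection to letters is; that projection is the A_∞ relation. -/
theorem IsAlgebra.comp_self {m : Family A A} (hm : IsAlgebra 𝒜 m) :
    barDifferential 𝒜 m ∘ₗ barDifferential 𝒜 m = 0 := by
  have h1 : bar 𝒜 m ∘ₗ barDifferential 𝒜 m = 0 := by
    refine linearMap_ext fun n v => ?_
    rw [LinearMap.comp_apply, bar_barDifferential_word, LinearMap.zero_apply]
    -- The factor `(-1)^(1 + n)`, constant for fixed `n`, passes from the sign convention of
    -- algebras to that of `suspend_insertion`.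
    have h := congrArg (fun x => (-1 : ℝ) ^ (1 + n) • x)
      (hm.relation n (fun j => (sparity 𝒜 ^ (j.rev : ℕ)) (v j)))
    simp only [smul_zero, Finset.smul_sum, smul_smul, ← pow_add] at h
    rw [← h]
    refine Finset.sum_congr rfl fun c _ => Finset.sum_congr rfl fun i _ => ?_
    exact suspend_insertion hm.degree m c i v
  have h2 : IsCoder LinearMap.id LinearMap.id
      (barDifferential 𝒜 m ∘ₗ barDifferential 𝒜 m) := by
    have hc := isCoder_barDifferential (𝒜 := 𝒜) hm.zero
    unfold IsCoder at hc ⊢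
    rw [← LinearMap.comp_assoc, hc, LinearMap.comp_assoc, hc, ← LinearMap.comp_assoc]
    congr 1
    -- The mixed terms `D ⊗ D` cancel because the odd map `D` anticommutes with the sign operator.
    have e1 : TensorProduct.map (tensorParity 𝒜 ∘ₗ barDifferential 𝒜 m) (barDifferential 𝒜 m) +
        TensorProduct.map (barDifferential 𝒜 m ∘ₗ tensorParity 𝒜) (barDifferential 𝒜 m) = 0 := by
      rw [← TensorProduct.map_add_left, hm.parity_comp, neg_add_cancel, TensorProduct.map_zero_left]
    simp only [LinearMap.comp_add, LinearMap.add_comp, ← TensorProduct.map_comp,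
      LinearMap.comp_id, LinearMap.id_comp, tensorParity_comp_tensorParity]
    calc _ = TensorProduct.map LinearMap.id (barDifferential 𝒜 m ∘ₗ barDifferential 𝒜 m) +
          TensorProduct.map (barDifferential 𝒜 m ∘ₗ barDifferential 𝒜 m) LinearMap.id +
          (TensorProduct.map (tensorParity 𝒜 ∘ₗ barDifferential 𝒜 m) (barDifferential 𝒜 m) +
        TensorProduct.map (barDifferential 𝒜 m ∘ₗ tensorParity 𝒜) (barDifferential 𝒜 m)) := by abel
      _ = _ := by rw [e1, add_zero]
  apply WithConv.toConv_injective
  rw [h2.eq_mul isCoalgMap_id rfl, ← LinearMap.comp_assoc,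
    cogenerators_comp_barDifferential hm.zero, h1, letters_zero]
  simp

theorem IsMorphism.mapsDegree {m : Family A A} {m' : Family B B} {f : Family A B}
    (hf : IsMorphism 𝒜 ℬ m m' f) : MapsDegree (tensorGrading 𝒜) (shift ℬ) 0 (bar 𝒜 f) :=
  mapsDegree_bar (c := 1) hf.degree

theorem mapsDegree_barMap {f : Family A B} (h0 : f 0 = 0)
    (hf : MapsDegree (tensorGrading 𝒜) (shift ℬ) 0 (bar 𝒜 f)) :
    MapsDegree (tensorGrading 𝒜) (tensorGrading ℬ) 0 (barMap 𝒜 f) := by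
  have := mapsDegree_geom hf
  rwa [← barMap_eq_geom h0] at this

variable [DirectSum.Decomposition ℬ]

theorem sum_relation_left {f : Family A B} {m' : Family B B}
    (hf : f.HasDegree 𝒜 ℬ (fun n => 1 - n)) (n : ℕ) (v : Fin n → A) :
    ∑ c : Composition n, (-1 : ℝ) ^ signExponent c •
        m' c.length (applyBlocks c (fun i => f.precomp
          (parity 𝒜 ^ ∑ μ : Fin c.length, if i < μ then c.blocksFun μ + 1 else 0))
          (fun j => (sparity 𝒜 ^ (j.rev : ℕ)) (v j))) =
      bar ℬ m' (barMap 𝒜 f (pureTensor n v)) := by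
  rw [bar_barMap_word]
  exact Finset.sum_congr rfl fun c _ => (suspend_blocks hf m' c v).symm

theorem sum_relation_right {f : Family A B} {m : Family A A}
    (hm : m.HasDegree 𝒜 𝒜 (fun n => 2 - n)) (n : ℕ) (v : Fin n → A) :
    ∑ c : Composition n, ∑ i : Fin c.length,
        (-1 : ℝ) ^ (1 + n + ((i : ℕ) + 1) * (c.blocksFun i + 1)) •
          f c.length (applyBlocks c (insertion (parity 𝒜 ^ c.blocksFun i) m i)
            (fun j => (sparity 𝒜 ^ (j.rev : ℕ)) (v j))) =
      bar 𝒜 f (barDifferential 𝒜 m (pureTensor n v)) := by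
  rw [bar_barDifferential_word]
  exact Finset.sum_congr rfl fun c _ => Finset.sum_congr rfl fun i _ =>
    (suspend_insertion hm f c i v).symm

/-- A coalgebra map of degree zero intertwines bar differentials if it does so after projection to
cogenerators. -/
theorem comp_barDifferential_eq {m : Family A A} {m' : Family B B} (hm : m 0 = 0) (hm' : m' 0 = 0)
    {F : TensorCoalgebra A →ₗ[ℝ] TensorCoalgebra B} (hF : IsCoalgMap F)
    (hd : MapsDegree (tensorGrading 𝒜) (tensorGrading ℬ) 0 F) :
    WithConv.toConv (barDifferential ℬ m' ∘ₗ F) - WithConv.toConv (F ∘ₗ barDifferential 𝒜 m) =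
      WithConv.toConv (F ∘ₗ tensorParity 𝒜) *
        letters (bar ℬ m' ∘ₗ F - cogenerators ∘ₗ F ∘ₗ barDifferential 𝒜 m) *
        WithConv.toConv F := by
  have hP : tensorParity ℬ ∘ₗ F = F ∘ₗ tensorParity 𝒜 := by
    rw [tensorParity_comp hd, realSign_zero, one_smul]
  have h1 : IsCoder (F ∘ₗ tensorParity 𝒜) F (barDifferential ℬ m' ∘ₗ F) := by
    have hc := isCoder_barDifferential (𝒜 := ℬ) hm'
    unfold IsCoder at hc ⊢
    rw [← LinearMap.comp_assoc, hc, LinearMap.comp_assoc, hF.comul, ← LinearMap.comp_assoc,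
      LinearMap.add_comp, ← TensorProduct.map_comp, ← TensorProduct.map_comp, hP,
      LinearMap.id_comp]
  have h2 : IsCoder (F ∘ₗ tensorParity 𝒜) F (F ∘ₗ barDifferential 𝒜 m) := by
    have hc := isCoder_barDifferential (𝒜 := 𝒜) hm
    unfold IsCoder at hc ⊢
    rw [← LinearMap.comp_assoc, hF.comul, LinearMap.comp_assoc, hc, ← LinearMap.comp_assoc,
      LinearMap.comp_add, ← TensorProduct.map_comp, ← TensorProduct.map_comp, LinearMap.comp_id]
  have hFP := hF.comp (isCoalgMap_tensorParity (𝒜 := 𝒜))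
  rw [h1.eq_mul hFP hF.counit, h2.eq_mul hFP hF.counit, ← sub_mul, ← mul_sub, ← letters_sub,
    ← LinearMap.comp_assoc _ _ cogenerators, cogenerators_comp_barDifferential hm']

/-- The failure to commute is a coderivation whose projection to letters is the difference of the
two sides of the morphism relation. -/
theorem IsMorphism.comm {m : Family A A} {m' : Family B B} {f : Family A B}
    (hm : IsAlgebra 𝒜 m) (hm' : IsAlgebra ℬ m') (hf : IsMorphism 𝒜 ℬ m m' f) :
    barDifferential ℬ m' ∘ₗ barMap 𝒜 f = barMap 𝒜 f ∘ₗ barDifferential 𝒜 m := by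
  have h := comp_barDifferential_eq hm.zero hm'.zero (isCoalgMap_barMap hf.zero)
    (mapsDegree_barMap hf.zero hf.mapsDegree)
  have h1 : bar ℬ m' ∘ₗ barMap 𝒜 f - cogenerators ∘ₗ barMap 𝒜 f ∘ₗ barDifferential 𝒜 m = 0 := by
    rw [← LinearMap.comp_assoc, cogenerators_comp_barMap hf.zero, sub_eq_zero]
    refine linearMap_ext fun n v => ?_
    rw [LinearMap.comp_apply, LinearMap.comp_apply, ← sum_relation_left hf.degree,
      ← sum_relation_right hm.degree]
    exact hf.relation n _
  rw [h1, letters_zero, mul_zero, zero_mul, sub_eq_zero] at h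
  exact WithConv.toConv_injective h

theorem isMorphism_of_comm {m : Family A A} {m' : Family B B} {f : Family A B}
    (hm : IsAlgebra 𝒜 m) (hm' : IsAlgebra ℬ m') (h0 : f 0 = 0)
    (hd : MapsDegree (tensorGrading 𝒜) (shift ℬ) 0 (bar 𝒜 f))
    (h : barDifferential ℬ m' ∘ₗ barMap 𝒜 f = barMap 𝒜 f ∘ₗ barDifferential 𝒜 m) :
    IsMorphism 𝒜 ℬ m m' f where
  zero := h0
  degree := hasDegree_of_bar (c := 1) hd
  relation n v := by
    have hdeg : f.HasDegree 𝒜 ℬ (fun n => 1 - n) := hasDegree_of_bar (c := 1) hd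
    -- The twist by suspension signs is an involution, so evaluating at twisted arguments recovers
    -- the relation at `v`.
    have h1 := sum_relation_left (m' := m') hdeg n (fun j => (sparity 𝒜 ^ (j.rev : ℕ)) (v j))
    have h2 := sum_relation_right (f := f) hm.degree n (fun j => (sparity 𝒜 ^ (j.rev : ℕ)) (v j))
    rw [twist_twist] at h1 h2
    rw [h1, h2, ← cogenerators_comp_barDifferential hm'.zero, ← cogenerators_comp_barMap h0,
      LinearMap.comp_apply, LinearMap.comp_apply]
    exact congrArg cogenerators (LinearMap.congr_fun h _)

end Relations

/-! ### Polynomial curves in vector spaces without topology -/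

section Curves

variable {U V W Z : Type*} [AddCommGroup U] [Module ℝ U] [AddCommGroup V] [Module ℝ V]
  [AddCommGroup W] [Module ℝ W] [AddCommGroup Z] [Module ℝ Z]

/-- The pairs of a polynomial curve in `V` and its derivative. -/
def polyDeriv (V : Type*) [AddCommGroup V] [Module ℝ V] : Submodule ℝ ((ℝ → V) × (ℝ → V)) :=
  Submodule.span ℝ {p | ∃ (k : ℕ) (v : V),
    p = (fun t => t ^ k • v, fun t => ((k : ℝ) * t ^ (k - 1)) • v)}

theorem polyDeriv_monomial (k : ℕ) (v : V) :
    ((fun t => t ^ k • v, fun t => ((k : ℝ) * t ^ (k - 1)) • v) : (ℝ → V) × (ℝ → V)) ∈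
      polyDeriv V :=
  Submodule.subset_span ⟨k, v, rfl⟩

theorem polyDeriv_const (v : V) : ((fun _ => v, fun _ => 0) : (ℝ → V) × (ℝ → V)) ∈ polyDeriv V := by
  simpa using polyDeriv_monomial 0 v

theorem polyDeriv_induction {motive : ∀ γ γ' : ℝ → V, (γ, γ') ∈ polyDeriv V → Prop}
    (monomial : ∀ (k : ℕ) (v : V), motive _ _ (polyDeriv_monomial k v))
    (zero : motive 0 0 (zero_mem _))
    (add : ∀ p p' q q' (hp : (p, p') ∈ polyDeriv V) (hq : (q, q') ∈ polyDeriv V),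
      motive p p' hp → motive q q' hq → motive (p + q) (p' + q') (add_mem hp hq))
    (smul : ∀ (c : ℝ) p p' (hp : (p, p') ∈ polyDeriv V), motive p p' hp →
      motive (c • p) (c • p') (Submodule.smul_mem _ c hp))
    {γ γ' : ℝ → V} (h : (γ, γ') ∈ polyDeriv V) : motive γ γ' h := by
  suffices H : ∀ x, ∀ hx : x ∈ polyDeriv V, motive x.1 x.2 hx from H _ h
  intro x hx
  induction hx using Submodule.span_induction with
  | mem x hx => obtain ⟨k, v, rfl⟩ := hx; exact monomial k v
  | zero => exact zero
  | add x y hx' hy' hx hy => exact add _ _ _ _ hx' hy' hx hy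
  | smul c x hx' hx => exact smul _ _ _ hx' hx

theorem polyDeriv_hasDerivAt {γ γ' : ℝ → V} (h : (γ, γ') ∈ polyDeriv V) (φ : Module.Dual ℝ V)
    (t : ℝ) : HasDerivAt (fun t => φ (γ t)) (φ (γ' t)) t := by
  induction h using polyDeriv_induction with
  | monomial k v =>
    simp only [map_smul, smul_eq_mul]
    exact (hasDerivAt_pow k t).mul_const _
  | zero => simpa using hasDerivAt_const t (0 : ℝ)
  | add p p' q q' _ _ hp hq =>
    simp only [Pi.add_apply, map_add]
    exact hp.add hq
  | smul c p p' _ hp => simpa using hp.const_mul c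

theorem polyDeriv_contDiff {γ γ' : ℝ → V} (h : (γ, γ') ∈ polyDeriv V) (φ : Module.Dual ℝ V) :
    ContDiff ℝ ∞ (fun t => φ (γ t)) := by
  induction h using polyDeriv_induction with
  | monomial k v =>
    simp only [map_smul, smul_eq_mul]
    exact (contDiff_id.pow k).mul contDiff_const
  | zero => simpa using contDiff_const
  | add p p' q q' _ _ hp hq => simpa using hp.add hq
  | smul c p p' _ hp => simpa using contDiff_const.mul hp

/-- A polynomial curve whose derivative lies in a subspace stays in it. -/
theorem polyDeriv_mem {γ γ' : ℝ → V} (h : (γ, γ') ∈ polyDeriv V) (S : Submodule ℝ V)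
    (hS : ∀ t, γ' t ∈ S) (h0 : γ 0 ∈ S) (t : ℝ) : γ t ∈ S := by
  by_contra hn
  -- A functional that kills `S` but not `γ t` would have derivative zero along the curve and start
  -- at zero.
  obtain ⟨φ, hφ, hker⟩ := Submodule.exists_le_ker_of_notMem hn
  refine hφ ?_
  have hd : ∀ s, HasDerivAt (fun t => φ (γ t)) 0 s := fun s => by
    have := polyDeriv_hasDerivAt h φ s
    rwa [LinearMap.mem_ker.1 (hker (hS s))] at this
  rw [is_const_of_deriv_eq_zero (fun s => (hd s).differentiableAt) (fun s => (hd s).deriv) t 0]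
  exact hker h0

theorem polyDeriv_unique {γ γ' γ'' : ℝ → V} (h : (γ, γ') ∈ polyDeriv V)
    (h' : (γ, γ'') ∈ polyDeriv V) : γ' = γ'' := by
  funext t
  rw [← sub_eq_zero, ← Module.forall_dual_apply_eq_zero_iff ℝ]
  intro φ
  rw [map_sub, (polyDeriv_hasDerivAt h φ t).unique (polyDeriv_hasDerivAt h' φ t), sub_self]

theorem polyDeriv_primitive_unique {γ₁ γ₂ γ' : ℝ → V} (h₁ : (γ₁, γ') ∈ polyDeriv V)
    (h₂ : (γ₂, γ') ∈ polyDeriv V) (h : γ₁ 0 = γ₂ 0) : γ₁ = γ₂ := by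
  funext t
  rw [← sub_eq_zero, ← Submodule.mem_bot ℝ]
  exact polyDeriv_mem (γ := γ₁ - γ₂) (γ' := γ' - γ') ((polyDeriv V).sub_mem h₁ h₂) ⊥
    (fun t => by simp) (by simp [h]) t

theorem polyDeriv_exists_primitive {γ γ' : ℝ → V} (h : (γ, γ') ∈ polyDeriv V) :
    ∃ Γ, (Γ, γ) ∈ polyDeriv V ∧ Γ 0 = 0 := by
  induction h using polyDeriv_induction with
  | monomial k v =>
    have h := polyDeriv_monomial (k + 1) (((k : ℝ) + 1)⁻¹ • v)
    have hk : (k : ℝ) + 1 ≠ 0 := Nat.cast_add_one_ne_zero k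
    have e : ∀ t : ℝ, ((k : ℝ) + 1) * t ^ k * ((k : ℝ) + 1)⁻¹ = t ^ k := fun t => by field_simp
    simp only [smul_smul, Nat.cast_add, Nat.cast_one, Nat.add_sub_cancel, e] at h
    refine ⟨_, h, ?_⟩
    simp
  | zero => exact ⟨0, zero_mem _, rfl⟩
  | add p p' q q' _ _ hp hq =>
    obtain ⟨x, hx, hx0⟩ := hp
    obtain ⟨y, hy, hy0⟩ := hq
    exact ⟨_, add_mem hx hy, by simp [hx0, hy0]⟩
  | smul c p p' _ hp =>
    obtain ⟨x, hx, hx0⟩ := hp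
    exact ⟨_, Submodule.smul_mem _ c hx, by simp [hx0]⟩

theorem polyDeriv_map (f : V →ₗ[ℝ] W) {γ γ' : ℝ → V} (h : (γ, γ') ∈ polyDeriv V) :
    ((fun t => f (γ t), fun t => f (γ' t)) : (ℝ → W) × (ℝ → W)) ∈ polyDeriv W := by
  induction h using polyDeriv_induction with
  | monomial k v => simpa using polyDeriv_monomial k (f v)
  | zero =>
    simp only [Pi.zero_apply, map_zero]
    exact (polyDeriv W).zero_mem
  | add p p' q q' _ _ hp hq =>
    simp only [Pi.add_apply, map_add]
    exact add_mem hp hq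
  | smul c p p' _ hp =>
    simp only [Pi.smul_apply, map_smul]
    exact Submodule.smul_mem _ c hp

/-- The product rule. -/
theorem polyDeriv_map₂ (β : V →ₗ[ℝ] W →ₗ[ℝ] Z) {γ γ' : ℝ → V} {δ δ' : ℝ → W}
    (h : (γ, γ') ∈ polyDeriv V) (h' : (δ, δ') ∈ polyDeriv W) :
    ((fun t => β (γ t) (δ t), fun t => β (γ' t) (δ t) + β (γ t) (δ' t)) : (ℝ → Z) × (ℝ → Z)) ∈
      polyDeriv Z := by
  induction h using polyDeriv_induction with
  | monomial k v =>
    induction h' using polyDeriv_induction with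
    | monomial l w =>
      have := polyDeriv_monomial (k + l) (β v w)
      convert this using 2
      · funext t
        simp [smul_smul, pow_add, mul_comm]
      · funext t
        simp only [map_smul, LinearMap.smul_apply, smul_smul, ← add_smul]
        congr 1
        -- The exponents `k - 1` and `l - 1` are truncated, so exponent zero is treated apart; its
        -- coefficient vanishes there.
        rcases k with _ | k
        · simp
        rcases l with _ | l
        · simp
        simp only [Nat.add_sub_cancel, Nat.cast_add, Nat.cast_one,
          show k + 1 + (l + 1) - 1 = k + l + 1 by omega]
        ring
    | zero =>
      simp only [Pi.zero_apply, map_zero, add_zero]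
      exact (polyDeriv Z).zero_mem
    | add p p' q q' _ _ hp hq =>
      convert add_mem hp hq using 2
      · funext t; simp
      · funext t; simp; abel
    | smul c p p' _ hp =>
      convert Submodule.smul_mem _ c hp using 2
      · funext t; simp
      · funext t; simp
  | zero =>
    simp only [Pi.zero_apply, map_zero, LinearMap.zero_apply, add_zero]
    exact (polyDeriv Z).zero_mem
  | add p p' q q' _ _ hp hq =>
    convert add_mem hp hq using 2
    · funext t; simp
    · funext t; simp; abel
  | smul c p p' _ hp =>
    convert Submodule.smul_mem _ c hp using 2
    · funext t; simp
    · funext t; simp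

/-- The pointwise polynomial family `Φ` of linear maps has the derivative `Φ'`. -/
def HasPolyDeriv (Φ Φ' : ℝ → (V →ₗ[ℝ] W)) : Prop :=
  ∀ x, ((fun t => Φ t x, fun t => Φ' t x) : (ℝ → W) × (ℝ → W)) ∈ polyDeriv W

namespace HasPolyDeriv

variable {Φ Φ' Ψ Ψ' : ℝ → (V →ₗ[ℝ] W)}

theorem const (f : V →ₗ[ℝ] W) : HasPolyDeriv (fun _ => f) (fun _ => 0) :=
  fun x => polyDeriv_const (f x)

theorem id_smul (f : V →ₗ[ℝ] W) : HasPolyDeriv (fun t => t • f) (fun _ => f) :=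
  fun x => by simpa using polyDeriv_monomial 1 (f x)

theorem add (h : HasPolyDeriv Φ Φ') (h' : HasPolyDeriv Ψ Ψ') :
    HasPolyDeriv (fun t => Φ t + Ψ t) (fun t => Φ' t + Ψ' t) := fun x => add_mem (h x) (h' x)

theorem sub (h : HasPolyDeriv Φ Φ') (h' : HasPolyDeriv Ψ Ψ') :
    HasPolyDeriv (fun t => Φ t - Ψ t) (fun t => Φ' t - Ψ' t) := fun x => sub_mem (h x) (h' x)

theorem comp_left (h : HasPolyDeriv Φ Φ') (f : W →ₗ[ℝ] Z) :
    HasPolyDeriv (fun t => f ∘ₗ Φ t) (fun t => f ∘ₗ Φ' t) := fun x => polyDeriv_map f (h x)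

theorem comp_right (h : HasPolyDeriv Φ Φ') (f : U →ₗ[ℝ] V) :
    HasPolyDeriv (fun t => Φ t ∘ₗ f) (fun t => Φ' t ∘ₗ f) := fun x => h (f x)

/-- Primitives are chosen vector by vector. Those vanishing at time zero are unique, and uniqueness
makes the choice linear in the vector. -/
theorem exists_primitive (h : HasPolyDeriv Φ Φ') : ∃ Ψ, HasPolyDeriv Ψ Φ ∧ Ψ 0 = 0 := by
  choose Γ hΓ h0 using fun x => polyDeriv_exists_primitive (h x)
  refine ⟨fun t => { toFun := fun x => Γ x t, map_add' := fun x y => ?_, map_smul' := fun c x => ?_ },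
    hΓ, LinearMap.ext h0⟩
  · refine congrFun (polyDeriv_primitive_unique (γ₂ := Γ x + Γ y) (hΓ (x + y)) ?_ ?_) t
    · simp only [map_add]
      exact add_mem (hΓ x) (hΓ y)
    · simp [h0]
  · refine congrFun (polyDeriv_primitive_unique (γ₂ := c • Γ x) (hΓ (c • x)) ?_ ?_) t
    · simp only [map_smul]
      exact Submodule.smul_mem _ c (hΓ x)
    · simp [h0]

theorem mapsDegree {𝒱 : ℤ → Submodule ℝ V} {𝒲 : ℤ → Submodule ℝ W} {d : ℤ}
    (h : HasPolyDeriv Φ Φ') (hd : ∀ t, MapsDegree 𝒱 𝒲 d (Φ' t)) (h0 : MapsDegree 𝒱 𝒲 d (Φ 0))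
    (t : ℝ) : MapsDegree 𝒱 𝒲 d (Φ t) :=
  fun k x hx => polyDeriv_mem (h x) _ (fun s => hd s k x hx) (h0 k x hx) t

end HasPolyDeriv

end Curves

/-! ### Word length filtration: derivatives, fixed points and limits -/

section Filtration

variable {A B : Type*} [AddCommGroup A] [Module ℝ A] [AddCommGroup B] [Module ℝ B]
variable {V : Type*} [AddCommGroup V] [Module ℝ V]

theorem HasPolyDeriv.vanish {Φ Φ' : ℝ → (TensorCoalgebra A →ₗ[ℝ] V)} {n : ℕ}
    (h : HasPolyDeriv Φ Φ') (hd : ∀ t, Vanish n (Φ' t)) (h0 : Vanish n (Φ 0)) (t : ℝ) :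
    Vanish n (Φ t) := fun k hk v => by
  rw [← Submodule.mem_bot ℝ]
  exact polyDeriv_mem (h _) ⊥ (fun s => hd s k hk v) (h0 k hk v) t

/-- Families that are pointwise polynomial on words are pointwise polynomial. -/
theorem hasPolyDeriv_of_word {Φ Φ' : ℝ → (TensorCoalgebra A →ₗ[ℝ] V)}
    (h : ∀ n (u : ℕ → A), ((fun t => Φ t (pureTensor n fun i => u i),
      fun t => Φ' t (pureTensor n fun i => u i)) : (ℝ → V) × (ℝ → V)) ∈ polyDeriv V) :
    HasPolyDeriv Φ Φ' := fun x => by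
  have hx : x ∈ Submodule.span ℝ {x : TensorCoalgebra A | ∃ n v, x = pureTensor n v} := by
    rw [span_pureTensor]; trivial
  induction hx using Submodule.span_induction with
  | mem x hx =>
    obtain ⟨n, v, rfl⟩ := hx
    obtain ⟨u, rfl⟩ := exists_sequence v
    exact h n u
  | zero =>
    simp only [map_zero]
    exact (polyDeriv V).zero_mem
  | add x y _ _ hx hy =>
    simp only [map_add]
    exact add_mem hx hy
  | smul c x _ hx =>
    simp only [map_smul]
    exact Submodule.smul_mem _ c hx

theorem polyDeriv_conv_mul_word {f f' g g' : ℝ → Conv A (TensorCoalgebra B)} (n : ℕ) (u : ℕ → A)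
    (h : ∀ p ∈ Finset.HasAntidiagonal.antidiagonal n,
      ((fun t => (f t).ofConv (pureTensor p.1 (fun i => u i)) *
          (g t).ofConv (pureTensor p.2 (fun i => u (p.1 + i))),
        fun t => (f' t).ofConv (pureTensor p.1 (fun i => u i)) *
            (g t).ofConv (pureTensor p.2 (fun i => u (p.1 + i))) +
          (f t).ofConv (pureTensor p.1 (fun i => u i)) *
            (g' t).ofConv (pureTensor p.2 (fun i => u (p.1 + i)))) :
        (ℝ → TensorCoalgebra B) × (ℝ → TensorCoalgebra B)) ∈ polyDeriv (TensorCoalgebra B)) :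
    ((fun t => (f t * g t).ofConv (pureTensor n fun i => u i),
      fun t => (f' t * g t + f t * g' t).ofConv (pureTensor n fun i => u i)) :
        (ℝ → TensorCoalgebra B) × (ℝ → TensorCoalgebra B)) ∈ polyDeriv (TensorCoalgebra B) := by
  convert Submodule.sum_mem (polyDeriv (TensorCoalgebra B)) h using 1
  refine Prod.ext ?_ ?_
  · funext t
    simp only [conv_mul_word, Prod.fst_sum, Finset.sum_apply]
  · funext t
    simp only [WithConv.ofConv_add, LinearMap.add_apply, conv_mul_word, Prod.snd_sum,
      Finset.sum_apply, Finset.sum_add_distrib]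

theorem HasPolyDeriv.mul {f f' g g' : ℝ → Conv A (TensorCoalgebra B)}
    (hf : HasPolyDeriv (fun t => (f t).ofConv) (fun t => (f' t).ofConv))
    (hg : HasPolyDeriv (fun t => (g t).ofConv) (fun t => (g' t).ofConv)) :
    HasPolyDeriv (fun t => (f t * g t).ofConv) (fun t => (f' t * g t + f t * g' t).ofConv) :=
  hasPolyDeriv_of_word fun n u => polyDeriv_conv_mul_word n u fun p _ =>
    polyDeriv_map₂ (LinearMap.mul ℝ (TensorCoalgebra B)) (hf (pureTensor p.1 (fun i => u i)))
      (hg (pureTensor p.2 (fun i => u (p.1 + i))))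

theorem HasPolyDeriv.letters {φ φ' : ℝ → (TensorCoalgebra A →ₗ[ℝ] B)} (h : HasPolyDeriv φ φ') :
    HasPolyDeriv (fun t => (letters (φ t)).ofConv) (fun t => (letters (φ' t)).ofConv) :=
  h.comp_left letter

theorem HasPolyDeriv.vanish_one {φ φ' : ℝ → (TensorCoalgebra A →ₗ[ℝ] V)} (h : HasPolyDeriv φ φ')
    (h1 : ∀ t, Vanish 1 (φ t)) (t : ℝ) : Vanish 1 (φ' t) := fun k hk v => by
  have := polyDeriv_unique (h (pureTensor k v)) (γ'' := fun _ => 0) (by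
    have : (fun t => φ t (pureTensor k v)) = fun _ => 0 := funext fun t => h1 t k hk v
    rw [this]
    exact polyDeriv_const 0)
  exact congrFun this t

/-- Since `f t` and `f' t` vanish on the empty word, the recursion expresses `g t` on a word by its
values on shorter words; the product rule then applies inductively. -/
theorem hasPolyDeriv_of_eq_one_add_mul {f f' g g' : ℝ → Conv A (TensorCoalgebra B)}
    (h : HasPolyDeriv (fun t => (f t).ofConv) (fun t => (f' t).ofConv))
    (h1 : ∀ t, Vanish 1 (f t).ofConv) (hg : ∀ t, g t = 1 + f t * g t)
    (hg' : ∀ t, g' t = f' t * g t + f t * g' t) :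
    HasPolyDeriv (fun t => (g t).ofConv) (fun t => (g' t).ofConv) := by
  have h1' := h.vanish_one h1
  refine hasPolyDeriv_of_word fun n => ?_
  induction n using Nat.strong_induction_on with
  | _ n ih =>
  intro u
  have key := add_mem (polyDeriv_const ((1 : Conv A (TensorCoalgebra B)).ofConv
    (pureTensor n fun i => u i))) (polyDeriv_conv_mul_word (f := f) (f' := f') (g := g) (g' := g')
    n u fun p hp => by
      have hp' := Finset.HasAntidiagonal.mem_antidiagonal.1 hp
      rcases Nat.eq_zero_or_pos p.1 with h0 | h0
      · obtain ⟨a, b⟩ := p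
        simp only at h0
        subst h0
        simp only [h1 _ 0 one_pos, h1' _ 0 one_pos, zero_mul, add_zero]
        exact (polyDeriv _).zero_mem
      · exact polyDeriv_map₂ (LinearMap.mul ℝ (TensorCoalgebra B))
          (h (pureTensor p.1 (fun i => u i))) (ih p.2 (by omega) fun i => u (p.1 + i)))
  convert key using 1
  refine Prod.ext (funext fun t => ?_) (funext fun t => ?_)
  · exact congrArg (fun x : Conv A (TensorCoalgebra B) => x.ofConv (pureTensor n fun i => u i))
      (hg t)
  · refine (congrArg (fun x : Conv A (TensorCoalgebra B) => x.ofConv (pureTensor n fun i => u i))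
      (hg' t)).trans (zero_add _).symm

theorem hasPolyDeriv_geom {φ φ' : ℝ → (TensorCoalgebra A →ₗ[ℝ] B)} (h : HasPolyDeriv φ φ')
    (h1 : ∀ t, Vanish 1 (φ t)) :
    HasPolyDeriv (fun t => (geom (letters (φ t))).ofConv)
      (fun t => (geom (letters (φ t)) * letters (φ' t) * geom (letters (φ t))).ofConv) := by
  have e0 : ∀ t, geom (letters (φ t)) = 1 + letters (φ t) * geom (letters (φ t)) :=
    fun t => geom_eq (h1 t).letters
  refine hasPolyDeriv_of_eq_one_add_mul h.letters (fun t => (h1 t).letters) e0 fun t => ?_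
  -- Expanding the leftmost series in `g φ' g` by `g = 1 + φ g` gives the differentiated recursion.
  conv_lhs => rw [mul_assoc, e0 t, add_mul, one_mul, ← e0 t]
  simp only [mul_assoc]

/-- A map between spaces of families of linear maps on the tensor coalgebra that increases the
order of agreement has a fixed point. -/
theorem exists_fixedPoint {I : Type*} (Good : (I → (TensorCoalgebra A →ₗ[ℝ] V)) → Prop)
    (U : (I → (TensorCoalgebra A →ₗ[ℝ] V)) → (I → (TensorCoalgebra A →ₗ[ℝ] V)))
    (φ₀ : I → (TensorCoalgebra A →ₗ[ℝ] V)) (h₀ : Good φ₀) (hU : ∀ φ, Good φ → Good (U φ))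
    (hc : ∀ n φ ψ, Good φ → Good ψ → (∀ i, Vanish n (φ i - ψ i)) →
      ∀ i, Vanish (n + 1) (U φ i - U ψ i))
    (hlim : ∀ φ, (∀ n, ∃ ψ, Good ψ ∧ ∀ i, Vanish n (φ i - ψ i)) → Good φ) :
    ∃ φ, Good φ ∧ U φ = φ := by
  let u : ℕ → I → (TensorCoalgebra A →ₗ[ℝ] V) := fun k => U^[k] φ₀
  have hu : ∀ k, u (k + 1) = U (u k) := fun k => Function.iterate_succ_apply' _ _ _
  have hg : ∀ k, Good (u k) := fun k => by
    induction k with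
    | zero => exact h₀
    | succ k ih => rw [hu]; exact hU _ ih
  have h1 : ∀ k i, Vanish k (u (k + 1) i - u k i) := fun k => by
    induction k with
    | zero => exact fun i => vanish_zero _
    | succ k ih =>
      intro i
      have := hc k _ _ (hg (k + 1)) (hg k) ih i
      rwa [← hu, ← hu] at this
  have h2 : ∀ k l i, Vanish k (u (k + l) i - u k i) := fun k l => by
    induction l with
    | zero => intro i; rw [add_zero, sub_self]; exact fun _ _ _ => rfl
    | succ l ih =>
      intro i
      have := ((h1 (k + l) i).mono (Nat.le_add_right k l)).add (ih i)
      rwa [sub_add_sub_cancel] at this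
  -- On words of length `n` the iterates are stationary from the `(n + 1)`-st on, so that value is
  -- taken as the limit.
  let φ : I → (TensorCoalgebra A →ₗ[ℝ] V) := fun i =>
    liftPure fun n => (u (n + 1) i).compMultilinearMap (pureTensor n)
  have h3 : ∀ k i, Vanish k (φ i - u k i) := fun k i n hn v => by
    rw [LinearMap.sub_apply, liftPure_pureTensor, LinearMap.compMultilinearMap_apply]
    have := h2 (n + 1) (k - (n + 1)) i n (Nat.lt_succ_self n) v
    rw [show n + 1 + (k - (n + 1)) = k by omega, LinearMap.sub_apply, sub_eq_zero] at this
    rw [this, sub_self]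
  have hφ : Good φ := hlim φ fun n => ⟨u n, hg n, h3 n⟩
  refine ⟨φ, hφ, funext fun i => sub_eq_zero.1 (eq_zero_of_vanish fun n => ?_)⟩
  have e : U φ i - φ i = (U φ i - U (u n) i) - (φ i - u (n + 1) i) := by rw [hu]; abel
  rw [e]
  exact ((hc n _ _ hφ (hg n) (h3 n) i).mono (Nat.le_succ n)).sub
    ((h3 (n + 1) i).mono (Nat.le_succ n))

/-- On words of length `n` the family equals its approximant of order `n + 1`, whose derivative is
used there. No uniformity between word lengths is required. -/
theorem hasPolyDeriv_limit {φ : ℝ → (TensorCoalgebra A →ₗ[ℝ] V)}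
    (h : ∀ n, ∃ ψ, (∃ ψ', HasPolyDeriv ψ ψ') ∧ ∀ t, Vanish n (φ t - ψ t)) :
    ∃ φ', HasPolyDeriv φ φ' := by
  choose ψ hψ hv using h
  choose ψ' hψ' using hψ
  refine ⟨fun t => liftPure fun n => (ψ' (n + 1) t).compMultilinearMap (pureTensor n),
    hasPolyDeriv_of_word fun n u => ?_⟩
  convert hψ' (n + 1) (pureTensor n fun i => u i) using 2
  · funext t
    have := hv (n + 1) t n (Nat.lt_succ_self n) (fun i => u i)
    rwa [LinearMap.sub_apply, sub_eq_zero] at this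
  · funext t
    rw [liftPure_pureTensor, LinearMap.compMultilinearMap_apply]

theorem mapsDegree_limit {𝒜 : ℤ → Submodule ℝ A} {𝒱 : ℤ → Submodule ℝ V} {d : ℤ}
    {φ : TensorCoalgebra A →ₗ[ℝ] V}
    (h : ∀ n, ∃ ψ, MapsDegree (tensorGrading 𝒜) 𝒱 d ψ ∧ Vanish n (φ - ψ)) :
    MapsDegree (tensorGrading 𝒜) 𝒱 d φ := by
  refine mapsDegree_of_word fun n e v hv => ?_
  obtain ⟨ψ, hψ, h⟩ := h (n + 1)
  have := h n (Nat.lt_succ_self n) v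
  rw [LinearMap.sub_apply, sub_eq_zero] at this
  rw [this]
  exact hψ _ _ (word_mem_tensorGrading hv)

end Filtration

/-! ### Codifferentials and the word length filtration -/

section Codifferential

variable {A B : Type*} [AddCommGroup A] [Module ℝ A] [AddCommGroup B] [Module ℝ B]
variable {V : Type*} [AddCommGroup V] [Module ℝ V]

/-- A codifferential on `T^c(A[1])`: a coderivation of degree one and square zero. -/
structure IsCodifferential (𝒜 : ℤ → Submodule ℝ A) [DirectSum.Decomposition 𝒜]
    (D : TensorCoalgebra A →ₗ[ℝ] TensorCoalgebra A) : Prop where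
  one : D 1 = 0
  coder : IsCoder (tensorParity 𝒜) LinearMap.id D
  degree : MapsDegree (tensorGrading 𝒜) (tensorGrading 𝒜) 1 D
  sq : D ∘ₗ D = 0

variable {𝒜 : ℤ → Submodule ℝ A} [DirectSum.Decomposition 𝒜]
variable {ℬ : ℤ → Submodule ℝ B}

theorem IsAlgebra.isCodifferential {m : Family A A} (hm : IsAlgebra 𝒜 m) :
    IsCodifferential 𝒜 (barDifferential 𝒜 m) where
  one := by
    have h : Vanish 1 (WithConv.toConv (barDifferential 𝒜 m)).ofConv := by
      rw [barDifferential_eq_mul hm.zero]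
      exact ((vanish_bar hm.zero).letters.mul_left _).mul_right _
    exact vanish_one_iff.1 h
  coder := isCoder_barDifferential hm.zero
  degree := hm.mapsDegree_barDifferential
  sq := hm.comp_self

theorem tensorParity_word (n : ℕ) (v : Fin n → A) :
    tensorParity 𝒜 (pureTensor n v) = pureTensor n (fun i => sparity 𝒜 (v i)) :=
  liftPure_pureTensor _ _ _

theorem Vanish.comp_tensorParity {n : ℕ} {X : TensorCoalgebra A →ₗ[ℝ] V} (h : Vanish n X) :
    Vanish n (X ∘ₗ tensorParity 𝒜) := fun k hk v => by
  rw [LinearMap.comp_apply, tensorParity_word]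
  exact h k hk _

namespace IsCodifferential

variable {D : TensorCoalgebra A →ₗ[ℝ] TensorCoalgebra A} (hD : IsCodifferential 𝒜 D)
include hD

theorem parity_comp : tensorParity 𝒜 ∘ₗ D = -(D ∘ₗ tensorParity 𝒜) := by
  rw [tensorParity_comp hD.degree, realSign_one]
  exact LinearMap.ext fun x => neg_one_smul ℝ _

theorem counit_comp : counitMap ∘ₗ D = 0 :=
  hD.coder.counitMap_comp isCoalgMap_tensorParity.counit rfl

/-- A codifferential does not increase the length of words. -/
theorem word_mem (k : ℕ) (v : Fin k → A) :
    D (pureTensor k v) ∈ Submodule.span ℝ {x | ∃ j ≤ k, ∃ w : Fin j → A, x = pureTensor j w} := by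
  obtain ⟨u, rfl⟩ := exists_sequence v
  have h := congrArg (fun X : Conv A (TensorCoalgebra A) => X.ofConv (pureTensor k fun i => u i))
    (hD.coder.eq_mul isCoalgMap_tensorParity rfl)
  simp only [conv_mul_word] at h
  rw [h]
  refine Submodule.sum_mem _ fun p hp => ?_
  rw [Finset.sum_mul]
  refine Submodule.sum_mem _ fun q hq => ?_
  have hp' := Finset.HasAntidiagonal.mem_antidiagonal.1 hp
  have hq' := Finset.HasAntidiagonal.mem_antidiagonal.1 hq
  obtain ⟨q1, q2⟩ := q
  simp only at hq' ⊢
  rcases q2 with _ | q2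
  · rw [letters_apply, LinearMap.comp_apply, pureTensor_zero, hD.one, map_zero, map_zero, mul_zero,
      zero_mul]
    exact zero_mem _
  · rw [tensorParity_word, letters_apply, letter_apply, pureTensor_mul, LinearMap.id_apply,
      pureTensor_mul]
    exact Submodule.subset_span ⟨_, by omega, _, rfl⟩

end IsCodifferential

/-- Short words are mapped to combinations of words that are no longer, so precomposition with `D`
loses no order. -/
theorem Vanish.comp_codifferential {D : TensorCoalgebra A →ₗ[ℝ] TensorCoalgebra A} {n : ℕ}
    {X : TensorCoalgebra A →ₗ[ℝ] V} (h : Vanish n X) (hD : IsCodifferential 𝒜 D) :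
    Vanish n (X ∘ₗ D) := fun k hk v => by
  have := hD.word_mem k v
  rw [LinearMap.comp_apply, ← LinearMap.mem_ker]
  refine (Submodule.span_le.2 ?_) this
  rintro _ ⟨j, hj, w, rfl⟩
  exact h j (by omega) w

theorem letters_neg (φ : TensorCoalgebra A →ₗ[ℝ] B) : letters (-φ) = -letters φ := by
  rw [← zero_sub, letters_sub, letters_zero, zero_sub]

theorem geom_mul_vanish {φ x y : Conv A (TensorCoalgebra B)} {n : ℕ} (hφ : Vanish 1 φ.ofConv)
    (h : x = φ * x + y) (hy : Vanish n y.ofConv) : Vanish n x.ofConv := by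
  rw [eq_geom_mul hφ h]
  exact hy.mul_left _

variable [DirectSum.Decomposition ℬ]

/-- If `F` commutes with the codifferentials on words of length less than `n`, then the
coderivation of `F` with the same projection to cogenerators as `D' h + h D` agrees with it on
words of length at most `n`. -/
theorem vanish_coder_sub {D : TensorCoalgebra A →ₗ[ℝ] TensorCoalgebra A}
    {D' : TensorCoalgebra B →ₗ[ℝ] TensorCoalgebra B} (hD : IsCodifferential 𝒜 D)
    (hD' : IsCodifferential ℬ D')
    {F h X : TensorCoalgebra A →ₗ[ℝ] TensorCoalgebra B} (hF : IsCoalgMap F)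
    (hPF : tensorParity ℬ ∘ₗ F = F ∘ₗ tensorParity 𝒜)
    (hh : IsCoder (F ∘ₗ tensorParity 𝒜) F h) (hPh : tensorParity ℬ ∘ₗ h = -(h ∘ₗ tensorParity 𝒜))
    (h1 : h 1 = 0) (hX : IsCoder F F X)
    (hπ : cogenerators ∘ₗ X = cogenerators ∘ₗ D' ∘ₗ h + cogenerators ∘ₗ h ∘ₗ D) {n : ℕ}
    (hE : Vanish n (D' ∘ₗ F - F ∘ₗ D)) : Vanish (n + 1) (X - (D' ∘ₗ h + h ∘ₗ D)) := by
  have hFP : counitMap ∘ₗ (F ∘ₗ tensorParity 𝒜) = counitMap := by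
    rw [← LinearMap.comp_assoc, hF.counit, isCoalgMap_tensorParity.counit]
  have hPFP : tensorParity ℬ ∘ₗ F ∘ₗ tensorParity 𝒜 = F := by
    rw [← LinearMap.comp_assoc, hPF, LinearMap.comp_assoc, tensorParity_comp_tensorParity,
      LinearMap.comp_id]
  have hFPP : F ∘ₗ tensorParity 𝒜 ∘ₗ tensorParity 𝒜 = F := by
    rw [tensorParity_comp_tensorParity, LinearMap.comp_id]
  have hc : counitMap ∘ₗ h = 0 := hh.counitMap_comp hFP hF.counit
  -- Both `D' h` and `h D` have a four-term coproduct: two terms of coderivation type and two mixed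
  -- ones. In the sum, the mixed terms would cancel if `D' F = F D`.
  have e1 := eq_of_coproduct Finset.univ (X := D' ∘ₗ h)
    ![tensorParity ℬ ∘ₗ F ∘ₗ tensorParity 𝒜, tensorParity ℬ ∘ₗ h,
      D' ∘ₗ F ∘ₗ tensorParity 𝒜, D' ∘ₗ h] ![D' ∘ₗ h, D' ∘ₗ F, h, F] (by
    have c := hD'.coder
    unfold IsCoder at c hh
    rw [← LinearMap.comp_assoc, c, LinearMap.comp_assoc, hh, ← LinearMap.comp_assoc]
    congr 1
    simp only [Fin.sum_univ_four, LinearMap.add_comp, LinearMap.comp_add, ← TensorProduct.map_comp,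
      LinearMap.id_comp, Matrix.cons_val]
    abel)
  have e2 := eq_of_coproduct Finset.univ (X := h ∘ₗ D)
    ![F ∘ₗ tensorParity 𝒜 ∘ₗ tensorParity 𝒜, h ∘ₗ tensorParity 𝒜,
      F ∘ₗ tensorParity 𝒜 ∘ₗ D, h ∘ₗ D] ![h ∘ₗ D, F ∘ₗ D, h, F] (by
    have c := hD.coder
    unfold IsCoder at c hh
    rw [← LinearMap.comp_assoc, hh, LinearMap.comp_assoc, c, ← LinearMap.comp_assoc]
    congr 1
    simp only [Fin.sum_univ_four, LinearMap.add_comp, LinearMap.comp_add, ← TensorProduct.map_comp,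
      LinearMap.comp_id, Matrix.cons_val, LinearMap.comp_assoc]
    abel)
  have e3 := hX.eq_add hF.counit hF.counit
  simp only [Fin.sum_univ_four, Matrix.cons_val] at e1 e2
  rw [hPFP, ← LinearMap.comp_assoc h D' counitMap, hD'.counit_comp, LinearMap.zero_comp, LinearMap.comp_zero,
    WithConv.toConv_zero, zero_add] at e1
  rw [hFPP, ← LinearMap.comp_assoc D h counitMap, hc, LinearMap.zero_comp, LinearMap.comp_zero,
    WithConv.toConv_zero, zero_add, hD.parity_comp, LinearMap.comp_neg, LinearMap.comp_neg,
    letters_neg] at e2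
  rw [hPh, LinearMap.comp_neg, letters_neg] at e1
  rw [hπ, letters_add] at e3
  have e4 : letters (cogenerators ∘ₗ D' ∘ₗ F ∘ₗ tensorParity 𝒜) =
      letters (cogenerators ∘ₗ F ∘ₗ D ∘ₗ tensorParity 𝒜) +
        letters (cogenerators ∘ₗ (D' ∘ₗ F - F ∘ₗ D) ∘ₗ tensorParity 𝒜) := by
    rw [← letters_add]
    congr 1
    simp only [LinearMap.sub_comp, LinearMap.comp_sub, LinearMap.comp_assoc]
    abel
  have e5 : WithConv.toConv (D' ∘ₗ F) =
      WithConv.toConv (F ∘ₗ D) + WithConv.toConv (D' ∘ₗ F - F ∘ₗ D) := by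
    rw [WithConv.toConv_sub]; abel
  have hφ : Vanish 1 (letters (cogenerators ∘ₗ F)).ofConv := by
    refine Vanish.letters (vanish_one_iff.2 ?_)
    rw [LinearMap.comp_apply, hF.one, cogenerators_one]
  have hv : Vanish 1 h := vanish_one_iff.2 h1
  rw [e4, e5] at e1
  -- Only products of `h` with the error `D' F - F D` remain. As `h` vanishes on the empty word,
  -- they gain one word length over the error.
  refine geom_mul_vanish (x := WithConv.toConv (X - (D' ∘ₗ h + h ∘ₗ D))) hφ
    (y := letters (cogenerators ∘ₗ h ∘ₗ tensorParity 𝒜) *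
        WithConv.toConv (D' ∘ₗ F - F ∘ₗ D) -
      letters (cogenerators ∘ₗ (D' ∘ₗ F - F ∘ₗ D) ∘ₗ tensorParity 𝒜) * WithConv.toConv h) ?_ ?_
  · rw [WithConv.toConv_sub, WithConv.toConv_add]
    generalize WithConv.toConv X = x at *
    generalize WithConv.toConv (D' ∘ₗ h) = y at *
    generalize WithConv.toConv (h ∘ₗ D) = z at *
    generalize WithConv.toConv (D' ∘ₗ F - F ∘ₗ D) = e at *
    conv_lhs => rw [e1, e2, e3]
    noncomm_ring
  · rw [WithConv.ofConv_sub]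
    refine Vanish.sub ?_ ?_
    · rw [add_comm n]
      exact Vanish.mul ((hv.comp_tensorParity.comp cogenerators).letters) hE
    · exact Vanish.mul ((hE.comp_tensorParity.comp cogenerators).letters) hv

end Codifferential

/-! ### Flows `dF/dt = D h + h D` on the tensor coalgebra -/

section Flow

variable {A B : Type*} [AddCommGroup A] [Module ℝ A] [AddCommGroup B] [Module ℝ B]
variable (𝒜 : ℤ → Submodule ℝ A) [DirectSum.Decomposition 𝒜]
variable {ℬ : ℤ → Submodule ℝ B}

/-- The coderivation over `F` with the projection `δ` to cogenerators. -/
def coderOver (F : TensorCoalgebra A →ₗ[ℝ] TensorCoalgebra B) (δ : TensorCoalgebra A →ₗ[ℝ] B) :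
    TensorCoalgebra A →ₗ[ℝ] TensorCoalgebra B :=
  (WithConv.toConv (F ∘ₗ tensorParity 𝒜) * letters δ * WithConv.toConv F).ofConv

variable {𝒜}

section CoderOver

variable {F G : TensorCoalgebra A →ₗ[ℝ] TensorCoalgebra B} {δ ε : TensorCoalgebra A →ₗ[ℝ] B} {n : ℕ}

theorem isCoder_coderOver (hF : IsCoalgMap F) (δ : TensorCoalgebra A →ₗ[ℝ] B) :
    IsCoder (F ∘ₗ tensorParity 𝒜) F (coderOver 𝒜 F δ) :=
  (hF.comp isCoalgMap_tensorParity).isCoder_mul hF δ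

theorem cogenerators_comp_coderOver (hF : IsCoalgMap F) (δ : TensorCoalgebra A →ₗ[ℝ] B) :
    cogenerators ∘ₗ coderOver 𝒜 F δ = δ :=
  cogenerators_comp_coderivation (hF.comp isCoalgMap_tensorParity).counit hF.counit δ

theorem vanish_coderOver (F : TensorCoalgebra A →ₗ[ℝ] TensorCoalgebra B) (hδ : Vanish n δ) :
    Vanish n (coderOver 𝒜 F δ) :=
  (hδ.letters.mul_left _).mul_right _

theorem mapsDegree_coderOver {d : ℤ} (hF : MapsDegree (tensorGrading 𝒜) (tensorGrading ℬ) 0 F)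
    (hδ : MapsDegree (tensorGrading 𝒜) (shift ℬ) d δ) :
    MapsDegree (tensorGrading 𝒜) (tensorGrading ℬ) d (coderOver 𝒜 F δ) :=
  mapsDegree_mul (mapsDegree_mul (hF.comp mapsDegree_tensorParity (add_zero 0))
    (mapsDegree_letters hδ) (zero_add d)) hF (add_zero d)

theorem coderOver_sub_right : coderOver 𝒜 F δ - coderOver 𝒜 F ε = coderOver 𝒜 F (δ - ε) := by
  simp only [coderOver, letters_sub, mul_sub, sub_mul, WithConv.ofConv_sub]

/-- To leading order, a coderivation is given by its projection to cogenerators. -/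
theorem vanish_coderOver_sub_letters (hF : IsCoalgMap F) (hδ : Vanish n δ) :
    Vanish (n + 1) (coderOver 𝒜 F δ - (letters δ).ofConv) := by
  refine vanish_mul_mul_sub ?_ ?_ hδ.letters
  · refine vanish_one_iff.2 ?_
    rw [WithConv.ofConv_sub, LinearMap.sub_apply, conv_one_apply_one]
    exact sub_eq_zero.2 (hF.comp isCoalgMap_tensorParity).one
  · refine vanish_one_iff.2 ?_
    rw [WithConv.ofConv_sub, LinearMap.sub_apply, conv_one_apply_one]
    exact sub_eq_zero.2 hF.one

/-- In each of the two terms of the difference, `F - G` stands next to `δ`, and `δ` contributes at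
least one further letter. -/
theorem vanish_coderOver_sub_left (h : Vanish n (F - G)) (hδ : Vanish 1 δ) :
    Vanish (n + 1) (coderOver 𝒜 F δ - coderOver 𝒜 G δ) := by
  have e : coderOver 𝒜 F δ - coderOver 𝒜 G δ =
      (WithConv.toConv ((F - G) ∘ₗ tensorParity 𝒜) * letters δ * WithConv.toConv F +
        WithConv.toConv (G ∘ₗ tensorParity 𝒜) * letters δ * WithConv.toConv (F - G)).ofConv := by
    rw [coderOver, coderOver, ← WithConv.ofConv_sub, LinearMap.sub_comp, WithConv.toConv_sub,
      WithConv.toConv_sub]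
    congr 1
    simp only [sub_mul, mul_sub]
    abel
  rw [e, WithConv.ofConv_add]
  refine Vanish.add ?_ ?_
  · exact (Vanish.mul (f := WithConv.toConv ((F - G) ∘ₗ tensorParity 𝒜)) h.comp_tensorParity
      hδ.letters).mul_right _
  · rw [mul_assoc, add_comm n]
    exact (Vanish.mul hδ.letters (g := WithConv.toConv (F - G)) h).mul_left _

theorem HasPolyDeriv.coderOver {F F' : ℝ → (TensorCoalgebra A →ₗ[ℝ] TensorCoalgebra B)}
    (h : HasPolyDeriv F F') (δ : TensorCoalgebra A →ₗ[ℝ] B) :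
    ∃ H', HasPolyDeriv (fun t => coderOver 𝒜 (F t) δ) H' := by
  have h1 : HasPolyDeriv (fun t => (WithConv.toConv (F t ∘ₗ tensorParity 𝒜)).ofConv)
      (fun t => (WithConv.toConv (F' t ∘ₗ tensorParity 𝒜)).ofConv) := h.comp_right _
  have h2 : HasPolyDeriv (fun _ : ℝ => (AInfty.letters δ).ofConv)
    (fun _ => (0 : Conv A (TensorCoalgebra B)).ofConv) := HasPolyDeriv.const _
  have h3 : HasPolyDeriv (fun t => (WithConv.toConv (F t)).ofConv)
      (fun t => (WithConv.toConv (F' t)).ofConv) := h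
  exact ⟨_, (h1.mul h2).mul h3⟩

end CoderOver

theorem vanish_geom_sub {φ ψ : TensorCoalgebra A →ₗ[ℝ] B} (hφ : Vanish 1 φ) (hψ : Vanish 1 ψ)
    {n : ℕ} (h : Vanish n (φ - ψ)) :
    Vanish n ((geom (letters φ)).ofConv - (geom (letters ψ)).ofConv) := by
  rw [← WithConv.ofConv_sub, geom_sub_geom hφ.letters hψ.letters, ← letters_sub]
  exact (h.letters.mul_left _).mul_right _

variable (𝒜) in
/-- The projection to cogenerators of the vector field `F ↦ D h + h D`, where `F` is the coalgebra
map with components `φ` and `h` the coderivation over `F` with components `δ`. -/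
def flowField (D : TensorCoalgebra A →ₗ[ℝ] TensorCoalgebra A) (δ φ : TensorCoalgebra A →ₗ[ℝ] A) :
    TensorCoalgebra A →ₗ[ℝ] A :=
  cogenerators ∘ₗ D ∘ₗ coderOver 𝒜 (geom (letters φ)).ofConv δ + δ ∘ₗ D

variable (𝒜) in
/-- The components of the flow with generator `δ` that starts at the identity. -/
structure IsFlow (D : TensorCoalgebra A →ₗ[ℝ] TensorCoalgebra A) (δ : TensorCoalgebra A →ₗ[ℝ] A)
    (φ : ℝ → (TensorCoalgebra A →ₗ[ℝ] A)) : Prop where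
  zero : φ 0 = cogenerators
  deriv : HasPolyDeriv φ (fun t => flowField 𝒜 D δ (φ t))
  vanish : ∀ t, Vanish 1 (φ t)
  degree : ∀ t, MapsDegree (tensorGrading 𝒜) (shift 𝒜) 0 (φ t)

variable {D : TensorCoalgebra A →ₗ[ℝ] TensorCoalgebra A} {δ ε : TensorCoalgebra A →ₗ[ℝ] A}

theorem flowField_vanish (hD : IsCodifferential 𝒜 D) (hδ : Vanish 1 δ)
    (φ : TensorCoalgebra A →ₗ[ℝ] A) : Vanish 1 (flowField 𝒜 D δ φ) := by
  refine Vanish.add ?_ (hδ.comp_codifferential hD)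
  rw [← LinearMap.comp_assoc]
  exact (vanish_coderOver _ hδ).comp _

theorem flowField_mapsDegree (hD : IsCodifferential 𝒜 D)
    (hδ : MapsDegree (tensorGrading 𝒜) (shift 𝒜) (-1) δ) {φ : TensorCoalgebra A →ₗ[ℝ] A}
    (hφ : MapsDegree (tensorGrading 𝒜) (shift 𝒜) 0 φ) :
    MapsDegree (tensorGrading 𝒜) (shift 𝒜) 0 (flowField 𝒜 D δ φ) :=
  (mapsDegree_cogenerators.comp (hD.degree.comp (mapsDegree_coderOver (mapsDegree_geom hφ) hδ)
    (neg_add_cancel 1)) (add_zero 0)).add (hδ.comp hD.degree (add_neg_cancel 1))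

/-- The summand `δ ∘ D` does not involve `φ`, and the other one gains a word length from `δ`. The
vector field is thus contracting for the filtration, which makes Picard iteration stabilize. -/
theorem flowField_sub {φ ψ : TensorCoalgebra A →ₗ[ℝ] A}
    (hφ : Vanish 1 φ) (hψ : Vanish 1 ψ) (hδ : Vanish 1 δ) {n : ℕ} (h : Vanish n (φ - ψ)) :
    Vanish (n + 1) (flowField 𝒜 D δ φ - flowField 𝒜 D δ ψ) := by
  rw [flowField, flowField, add_sub_add_right_eq_sub, ← LinearMap.comp_sub, ← LinearMap.comp_sub,
    ← LinearMap.comp_assoc]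
  exact (vanish_coderOver_sub_left (vanish_geom_sub hφ hψ h) hδ).comp _

/-- To leading order, the vector field changes by `d η + η D` if `η` is added to `δ`. -/
theorem flowField_sub_generator {φ : TensorCoalgebra A →ₗ[ℝ] A} (hφ : Vanish 1 φ) {n : ℕ}
    (h : Vanish n (δ - ε)) :
    Vanish (n + 1) (flowField 𝒜 D δ φ - flowField 𝒜 D ε φ -
      (cogenerators ∘ₗ D ∘ₗ letter ∘ₗ (δ - ε) + (δ - ε) ∘ₗ D)) := by
  have e : flowField 𝒜 D δ φ - flowField 𝒜 D ε φ -
      (cogenerators ∘ₗ D ∘ₗ letter ∘ₗ (δ - ε) + (δ - ε) ∘ₗ D) = (cogenerators ∘ₗ D) ∘ₗ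
        (coderOver 𝒜 (geom (letters φ)).ofConv (δ - ε) - (letters (δ - ε)).ofConv) := by
    rw [← coderOver_sub_right]
    simp only [flowField, letters, LinearMap.comp_sub, LinearMap.sub_comp, LinearMap.comp_assoc]
    abel
  rw [e]
  exact (vanish_coderOver_sub_letters (isCoalgMap_geom hφ) h).comp _

theorem exists_flowField_deriv (D : TensorCoalgebra A →ₗ[ℝ] TensorCoalgebra A)
    (δ : TensorCoalgebra A →ₗ[ℝ] A) {φ φ' : ℝ → (TensorCoalgebra A →ₗ[ℝ] A)}
    (h : HasPolyDeriv φ φ') (h1 : ∀ t, Vanish 1 (φ t)) :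
    ∃ Ψ, HasPolyDeriv (fun t => flowField 𝒜 D δ (φ t)) Ψ := by
  obtain ⟨H', hH⟩ := (hasPolyDeriv_geom h h1).coderOver (𝒜 := 𝒜) δ
  exact ⟨_, ((hH.comp_left D).comp_left cogenerators).add (HasPolyDeriv.const (δ ∘ₗ D))⟩

/-- Picard iteration, carried out among pointwise polynomial families that vanish on the empty word
and have degree zero. -/
theorem exists_isFlow (hD : IsCodifferential 𝒜 D) (hδ : Vanish 1 δ)
    (hd : MapsDegree (tensorGrading 𝒜) (shift 𝒜) (-1) δ) : ∃ φ, IsFlow 𝒜 D δ φ := by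
  -- The Picard operator `π + ∫₀ᵗ`. The choice makes it total; its value has a meaning only on
  -- `Good` families, for which a primitive exists.
  let U : (ℝ → (TensorCoalgebra A →ₗ[ℝ] A)) → (ℝ → (TensorCoalgebra A →ₗ[ℝ] A)) := fun φ t =>
    cogenerators + Classical.epsilon
      (fun Ψ => HasPolyDeriv Ψ (fun t => flowField 𝒜 D δ (φ t)) ∧ Ψ 0 = 0) t
  let Good : (ℝ → (TensorCoalgebra A →ₗ[ℝ] A)) → Prop := fun φ => (∃ φ', HasPolyDeriv φ φ') ∧
    ∀ t, Vanish 1 (φ t) ∧ MapsDegree (tensorGrading 𝒜) (shift 𝒜) 0 (φ t)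
  have hpi : Vanish 1 (cogenerators : TensorCoalgebra A →ₗ[ℝ] A) :=
    vanish_one_iff.2 cogenerators_one
  have hspec : ∀ φ, Good φ → HasPolyDeriv (U φ) (fun t => flowField 𝒜 D δ (φ t)) ∧
      U φ 0 = cogenerators := by
    intro φ hφ
    obtain ⟨⟨φ', h⟩, h1⟩ := hφ
    obtain ⟨Ψ, hΨ⟩ := exists_flowField_deriv (𝒜 := 𝒜) D δ h (fun t => (h1 t).1)
    have := Classical.epsilon_spec hΨ.exists_primitive
    refine ⟨?_, ?_⟩
    · have h2 := (HasPolyDeriv.const cogenerators).add this.1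
      simpa using h2
    · simp only [U]
      rw [this.2, add_zero]
  obtain ⟨φ, hφ, hfix⟩ := exists_fixedPoint Good U (fun _ => cogenerators)
    ⟨⟨_, HasPolyDeriv.const _⟩, fun _ => ⟨hpi, mapsDegree_cogenerators⟩⟩
    (fun φ hφ => by
      obtain ⟨h1, h2⟩ := hspec φ hφ
      exact ⟨⟨_, h1⟩, fun t =>
        ⟨h1.vanish (fun t => flowField_vanish hD hδ _) (by rw [h2]; exact hpi) t,
        h1.mapsDegree (fun t => flowField_mapsDegree hD hd (hφ.2 t).2)
          (by rw [h2]; exact mapsDegree_cogenerators) t⟩⟩)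
    (fun n φ ψ hφ hψ h => by
      obtain ⟨h1, h2⟩ := hspec φ hφ
      obtain ⟨h3, h4⟩ := hspec ψ hψ
      refine (h1.sub h3).vanish (fun t => flowField_sub (hφ.2 t).1 (hψ.2 t).1 hδ (h t)) ?_
      rw [h2, h4, sub_self]
      exact fun _ _ _ => rfl)
    (fun φ h => by
      refine ⟨hasPolyDeriv_limit fun n => ?_, fun t => ⟨?_, mapsDegree_limit fun n => ?_⟩⟩
      · obtain ⟨ψ, hψ, h⟩ := h n
        exact ⟨ψ, hψ.1, h⟩
      · obtain ⟨ψ, hψ, h⟩ := h 1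
        have := (h t).add (hψ.2 t).1
        rwa [sub_add_cancel] at this
      · obtain ⟨ψ, hψ, h⟩ := h n
        exact ⟨ψ t, (hψ.2 t).2, h t⟩)
  obtain ⟨h1, h2⟩ := hspec φ hφ
  rw [hfix] at h1 h2
  exact ⟨φ, h2, h1, fun t => (hφ.2 t).1, fun t => (hφ.2 t).2⟩

namespace IsFlow

variable {φ ψ : ℝ → (TensorCoalgebra A →ₗ[ℝ] A)}

/-- Induction on the order of agreement: the flows start at the same point, and the derivative of
their difference vanishes to one order more than the difference itself, up to the order `n` of `δ -
ε`. -/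
theorem vanish_sub (hφ : IsFlow 𝒜 D δ φ) (hψ : IsFlow 𝒜 D ε ψ) (hD : IsCodifferential 𝒜 D)
    (hδ : Vanish 1 δ) {n : ℕ} (h : Vanish n (δ - ε)) (t : ℝ) : Vanish n (φ t - ψ t) := by
  suffices H : ∀ k ≤ n, ∀ t, Vanish k (φ t - ψ t) from H n le_rfl t
  intro k
  induction k with
  | zero => exact fun _ _ => vanish_zero _
  | succ k ih =>
    intro hk
    refine (hφ.deriv.sub hψ.deriv).vanish (fun t => ?_) ?_
    · have h1 := flowField_sub (𝒜 := 𝒜) (D := D) (hφ.vanish t) (hψ.vanish t) hδ (ih (by omega) t)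
      have h2 := flowField_sub_generator (𝒜 := 𝒜) (D := D) (hψ.vanish t) h
      have h3 : Vanish n (cogenerators ∘ₗ D ∘ₗ letter ∘ₗ (δ - ε) + (δ - ε) ∘ₗ D) := by
        refine Vanish.add ?_ (h.comp_codifferential hD)
        rw [← LinearMap.comp_assoc, ← LinearMap.comp_assoc]
        exact h.comp _
      have := h1.add (((h2.mono (Nat.le_succ n)).add h3).mono hk)
      rwa [sub_add_cancel, sub_add_sub_cancel] at this
    · rw [hφ.zero, hψ.zero, sub_self]
      exact fun _ _ _ => rfl

/-- To leading order, the end point of the flow changes by `d η + η D` if `η` is added to `δ`. -/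
theorem vanish_sub_sub (hφ : IsFlow 𝒜 D δ φ) (hψ : IsFlow 𝒜 D ε ψ) (hD : IsCodifferential 𝒜 D)
    (hδ : Vanish 1 δ) {n : ℕ} (h : Vanish n (δ - ε)) :
    Vanish (n + 1) (φ 1 - ψ 1 -
      (cogenerators ∘ₗ D ∘ₗ letter ∘ₗ (δ - ε) + (δ - ε) ∘ₗ D)) := by
  -- To leading order the two vector fields differ by a term that is constant in time. Subtracting
  -- `t` times this term leaves a curve whose derivative vanishes to order `n + 1`.
  have := ((hφ.deriv.sub hψ.deriv).sub (HasPolyDeriv.id_smul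
    (cogenerators ∘ₗ D ∘ₗ letter ∘ₗ (δ - ε) + (δ - ε) ∘ₗ D))).vanish (n := n + 1) (fun t => ?_)
    (by
      rw [hφ.zero, hψ.zero, sub_self, zero_smul, sub_zero]
      exact fun _ _ _ => rfl) 1
  · rwa [one_smul] at this
  · have h1 := flowField_sub (𝒜 := 𝒜) (D := D) (hφ.vanish t) (hψ.vanish t) hδ (vanish_sub hφ hψ hD hδ h t)
    have h2 := flowField_sub_generator (𝒜 := 𝒜) (D := D) (hψ.vanish t) h
    have := h1.add h2
    rwa [← add_sub_assoc, sub_add_sub_cancel] at this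

end IsFlow

variable {φ : ℝ → (TensorCoalgebra A →ₗ[ℝ] A)}

theorem IsFlow.hasPolyDeriv_geom (hφ : IsFlow 𝒜 D δ φ) :
    HasPolyDeriv (fun t => (geom (letters (φ t))).ofConv)
      (fun t => (geom (letters (φ t)) * letters (flowField 𝒜 D δ (φ t)) *
        geom (letters (φ t))).ofConv) := AInfty.hasPolyDeriv_geom hφ.deriv hφ.vanish

/-- The coalgebra maps in a flow are compatible with the codifferential, and their derivative is
`D h + h D`. -/
theorem IsFlow.comm_and_deriv (hφ : IsFlow 𝒜 D δ φ) (hD : IsCodifferential 𝒜 D) (hδ : Vanish 1 δ)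
    (hd : MapsDegree (tensorGrading 𝒜) (shift 𝒜) (-1) δ) :
    (∀ t, D ∘ₗ (geom (letters (φ t))).ofConv = (geom (letters (φ t))).ofConv ∘ₗ D) ∧
    HasPolyDeriv (fun t => (geom (letters (φ t))).ofConv)
      (fun t => D ∘ₗ coderOver 𝒜 (geom (letters (φ t))).ofConv δ +
        coderOver 𝒜 (geom (letters (φ t))).ofConv δ ∘ₗ D) := by
  set F : ℝ → (TensorCoalgebra A →ₗ[ℝ] TensorCoalgebra A) :=
    fun t => (geom (letters (φ t))).ofConv with hF
  set X : ℝ → (TensorCoalgebra A →ₗ[ℝ] TensorCoalgebra A) := fun t => (geom (letters (φ t)) *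
    letters (flowField 𝒜 D δ (φ t)) * geom (letters (φ t))).ofConv with hX
  set h : ℝ → (TensorCoalgebra A →ₗ[ℝ] TensorCoalgebra A) := fun t => coderOver 𝒜 (F t) δ with hh
  have hder : HasPolyDeriv F X := hφ.hasPolyDeriv_geom
  have hFc : ∀ t, IsCoalgMap (F t) := fun t => isCoalgMap_geom (hφ.vanish t)
  have hFd : ∀ t, MapsDegree (tensorGrading 𝒜) (tensorGrading 𝒜) 0 (F t) :=
    fun t => mapsDegree_geom (hφ.degree t)
  have hF0 : F 0 = LinearMap.id := by
    simp only [hF, hφ.zero]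
    rw [← id_eq_geom]
  -- The flow prescribes only the projection of the derivative `X`. Identifying `X` with `D h + h D`
  -- needs that `F` commutes with `D`, and commuting follows from this identification; the two are
  -- proved together, one word length at a time.
  have step : ∀ n, (∀ t, Vanish n (D ∘ₗ F t - F t ∘ₗ D)) →
      ∀ t, Vanish (n + 1) (X t - (D ∘ₗ h t + h t ∘ₗ D)) := fun n hn t => by
    refine vanish_coder_sub hD hD (hFc t) ?_ (isCoder_coderOver (hFc t) δ) ?_ ?_ ?_ ?_ (hn t)
    · rw [tensorParity_comp (hFd t), realSign_zero, one_smul]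
    · rw [tensorParity_comp (mapsDegree_coderOver (hFd t) hd), realSign_neg_one]
      exact LinearMap.ext fun x => neg_one_smul ℝ _
    · exact vanish_one_iff.1 (vanish_coderOver _ hδ)
    · exact (hFc t).isCoder_mul (hFc t) _
    · rw [← LinearMap.comp_assoc D (coderOver 𝒜 (F t) δ) cogenerators,
        cogenerators_comp_coderOver (hFc t)]
      exact cogenerators_comp_coderivation (hFc t).counit (hFc t).counit _
  have hE : ∀ n t, Vanish n (D ∘ₗ F t - F t ∘ₗ D) := fun n => by
    induction n with
    | zero => exact fun _ => vanish_zero _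
    | succ n ih =>
      refine ((hder.comp_left D).sub (hder.comp_right D)).vanish (fun t => ?_) ?_
      · have h1 := step n ih t
        -- As `D² = 0`, the map `D h + h D` commutes with `D` and may be subtracted from `X`. So the
        -- derivative of the commutator vanishes to one order more than the commutator was known to.
        have e : D ∘ₗ X t - X t ∘ₗ D = D ∘ₗ (X t - (D ∘ₗ h t + h t ∘ₗ D)) -
            (X t - (D ∘ₗ h t + h t ∘ₗ D)) ∘ₗ D := by
          have e1 : D ∘ₗ D ∘ₗ h t = 0 := by
            rw [← LinearMap.comp_assoc, hD.sq, LinearMap.zero_comp]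
          simp only [LinearMap.comp_sub, LinearMap.sub_comp, LinearMap.comp_add,
            LinearMap.add_comp, LinearMap.comp_assoc, hD.sq, e1, LinearMap.comp_zero]
          abel
        rw [e]
        exact (h1.comp D).sub (h1.comp_codifferential hD)
      · rw [hF0, LinearMap.comp_id, LinearMap.id_comp, sub_self]
        exact fun _ _ _ => rfl
  refine ⟨fun t => sub_eq_zero.1 (eq_zero_of_vanish fun n => hE n t), ?_⟩
  have e : X = fun t => D ∘ₗ h t + h t ∘ₗ D := funext fun t =>
    sub_eq_zero.1 (eq_zero_of_vanish fun n => (step n (hE n) t).mono (Nat.le_succ n))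
  rw [← e]
  exact hder

end Flow

/-! ### Contractions of acyclic complexes -/

section Contraction

variable {W : Type*} [AddCommGroup W] [Module ℝ W]

/-- A linear section of `d` over its range, extended to the whole space. -/
theorem exists_comp_comp_eq (d : W →ₗ[ℝ] W) : ∃ s : W →ₗ[ℝ] W, ∀ x, d (s (d x)) = d x := by
  obtain ⟨r, hr⟩ := d.rangeRestrict.exists_rightInverse_of_surjective d.range_rangeRestrict
  obtain ⟨s, hs⟩ := LinearMap.exists_extend r
  refine ⟨s, fun x => ?_⟩
  have h1 := congrArg (fun f => f (d.rangeRestrict x)) hs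
  have h2 := congrArg (fun f => (f (d.rangeRestrict x) : W)) hr
  exact (congrArg d h1).trans h2

variable (𝒲 : ℤ → Submodule ℝ W) [DirectSum.Decomposition 𝒲]

/-- The projection to the part of degree `k`. -/
def homogeneousPart (k : ℤ) : W →ₗ[ℝ] W :=
  (𝒲 k).subtype ∘ₗ DirectSum.component ℝ ℤ (fun k => 𝒲 k) k ∘ₗ
    (DirectSum.decomposeLinearEquiv 𝒲).toLinearMap

variable {𝒲}

theorem homogeneousPart_apply (k : ℤ) (x : W) :
    homogeneousPart 𝒲 k x = DirectSum.decompose 𝒲 x k := rfl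

theorem homogeneousPart_mem (k : ℤ) (x : W) : homogeneousPart 𝒲 k x ∈ 𝒲 k :=
  (DirectSum.decompose 𝒲 x k).2

theorem homogeneousPart_of_mem {k : ℤ} {x : W} (hx : x ∈ 𝒲 k) : homogeneousPart 𝒲 k x = x :=
  DirectSum.decompose_of_mem_same 𝒲 hx

theorem linearMap_ext_decomposition {V : Type*} [AddCommGroup V] [Module ℝ V] {f g : W →ₗ[ℝ] V}
    (h : ∀ k, ∀ x ∈ 𝒲 k, f x = g x) : f = g := by
  refine LinearMap.ext fun x => ?_
  induction x using DirectSum.Decomposition.inductionOn 𝒲 with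
  | zero => simp
  | add a b ha hb => simp [ha, hb]
  | @homogeneous i a => exact h i a a.2

theorem homogeneousPart_comp {d : W →ₗ[ℝ] W} {e : ℤ} (hd : MapsDegree 𝒲 𝒲 e d) (k : ℤ) (x : W) :
    homogeneousPart 𝒲 (k + e) (d x) = d (homogeneousPart 𝒲 k x) := by
  refine congrArg (fun f : W →ₗ[ℝ] W => f x) (linearMap_ext_decomposition (𝒲 := 𝒲)
    (f := homogeneousPart 𝒲 (k + e) ∘ₗ d) (g := d ∘ₗ homogeneousPart 𝒲 k) fun j y hy => ?_)
  simp only [LinearMap.comp_apply]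
  by_cases h : j = k
  · subst h
    rw [homogeneousPart_of_mem hy, homogeneousPart_of_mem (hd j y hy)]
  · rw [homogeneousPart_apply, homogeneousPart_apply, DirectSum.decompose_of_mem_ne 𝒲 hy h,
      DirectSum.decompose_of_mem_ne 𝒲 (hd j y hy) (by omega), map_zero]

variable (𝒲) in
/-- The part of degree `e` of a linear map. -/
def homogeneousMap (e : ℤ) (s : W →ₗ[ℝ] W) : W →ₗ[ℝ] W :=
  DirectSum.toModule ℝ ℤ W (fun k => homogeneousPart 𝒲 (k + e) ∘ₗ s ∘ₗ (𝒲 k).subtype) ∘ₗ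
    (DirectSum.decomposeLinearEquiv 𝒲).toLinearMap

theorem homogeneousMap_of_mem (e : ℤ) (s : W →ₗ[ℝ] W) {k : ℤ} {x : W} (hx : x ∈ 𝒲 k) :
    homogeneousMap 𝒲 e s x = homogeneousPart 𝒲 (k + e) (s x) := by
  lift x to 𝒲 k using hx
  simp [homogeneousMap]

/-- An acyclic complex of vector spaces is contractible. -/
theorem exists_contraction {d : W →ₗ[ℝ] W} (hd : MapsDegree 𝒲 𝒲 1 d) (hdd : ∀ x, d (d x) = 0)
    (hac : ∀ x, d x = 0 → ∃ y, d y = x) :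
    ∃ S : W →ₗ[ℝ] W, MapsDegree 𝒲 𝒲 (-1) S ∧ ∀ x, d (S x) + S (d x) = x := by
  obtain ⟨s₀, hs₀⟩ := exists_comp_comp_eq d
  set s := homogeneousMap 𝒲 (-1) s₀ with hs
  have hsd : MapsDegree 𝒲 𝒲 (-1) s := fun k x hx => by
    rw [hs, homogeneousMap_of_mem _ _ hx]
    exact homogeneousPart_mem _ _
  -- Since `d` is homogeneous of degree one, `d s d = d` survives the passage to the part of degree
  -- `-1` of `s₀`.
  have h1 : ∀ x, d (s (d x)) = d x := by
    refine fun x => congrArg (fun f : W →ₗ[ℝ] W => f x) (linearMap_ext_decomposition (𝒲 := 𝒲)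
      (f := d ∘ₗ s ∘ₗ d) (g := d) fun k y hy => ?_)
    simp only [LinearMap.comp_apply]
    rw [hs, homogeneousMap_of_mem _ _ (hd k y hy), ← homogeneousPart_comp hd, hs₀,
      show k + 1 + -1 + 1 = k + 1 by ring, homogeneousPart_of_mem (hd k y hy)]
  -- The error of `s` as a contraction. It kills boundaries and has values in cocycles, which are
  -- boundaries by acyclicity, so `d s e = e`; the correction `s + s e` therefore removes it.
  set e : W →ₗ[ℝ] W := LinearMap.id - d ∘ₗ s - s ∘ₗ d with he
  have hed : MapsDegree 𝒲 𝒲 0 e :=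
    (mapsDegree_id.sub (hd.comp hsd (neg_add_cancel 1))).sub (hsd.comp hd (add_neg_cancel 1))
  have he' : ∀ x, e x = x - d (s x) - s (d x) := fun x => rfl
  refine ⟨s + s ∘ₗ e, hsd.add (hsd.comp hed (zero_add _)), fun x => ?_⟩
  have h2 : e (d x) = 0 := by
    rw [he', hdd, map_zero, h1, sub_self, sub_zero]
  have h3 : d (s (e x)) = e x := by
    obtain ⟨y, hy⟩ := hac (e x) (by
      rw [he', map_sub, map_sub, hdd, h1, sub_zero, sub_self])
    rw [← hy, h1]
  rw [LinearMap.add_apply, LinearMap.add_apply, LinearMap.comp_apply, LinearMap.comp_apply, h2,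
    map_zero, map_add, h3, he']
  abel

end Contraction

/-! ### The cone of the linear part -/

section Cone

variable {A B : Type*} [AddCommGroup A] [Module ℝ A] [AddCommGroup B] [Module ℝ B]
variable (𝒜 : ℤ → Submodule ℝ A) (ℬ : ℤ → Submodule ℝ B)

/-- The grading of the cone, with `B` shifted by one with respect to `A`. -/
def coneGrading (k : ℤ) : Submodule ℝ (A × B) := (𝒜 k).prod (ℬ (k - 1))

instance coneDecomposition [DirectSum.Decomposition 𝒜] [DirectSum.Decomposition ℬ] :
    DirectSum.Decomposition (coneGrading 𝒜 ℬ) :=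
  DirectSum.Decomposition.ofLinearMap (coneGrading 𝒜 ℬ)
    (LinearMap.coprod
      (DirectSum.toModule ℝ ℤ _ (fun k => DirectSum.lof ℝ ℤ (fun k => coneGrading 𝒜 ℬ k) k ∘ₗ
        (LinearMap.inl ℝ A B ∘ₗ (𝒜 k).subtype).codRestrict (coneGrading 𝒜 ℬ k)
          (fun a => ⟨a.2, zero_mem _⟩)) ∘ₗ (DirectSum.decomposeLinearEquiv 𝒜).toLinearMap)
      (DirectSum.toModule ℝ ℤ _ (fun k => DirectSum.lof ℝ ℤ (fun k => coneGrading 𝒜 ℬ k) (k + 1) ∘ₗ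
        (LinearMap.inr ℝ A B ∘ₗ (ℬ k).subtype).codRestrict (coneGrading 𝒜 ℬ (k + 1))
          (fun b => ⟨zero_mem _, by simp⟩)) ∘ₗ (DirectSum.decomposeLinearEquiv ℬ).toLinearMap))
    (by
      refine LinearMap.prod_ext (linearMap_ext_decomposition (𝒲 := 𝒜) fun k a ha => ?_)
        (linearMap_ext_decomposition (𝒲 := ℬ) fun k b hb => ?_)
      · lift a to 𝒜 k using ha
        simp
        rfl
      · lift b to ℬ k using hb
        simp
        rfl)
    (by
      refine DirectSum.linearMap_ext _ fun k => LinearMap.ext fun x => ?_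
      obtain ⟨⟨a, b⟩, ha, hb⟩ := x
      have hk : k - 1 + 1 = k := by ring
      -- The component of degree `k - 1` of `B` is placed in cone degree `k - 1 + 1`, which has to
      -- be identified with `k`.
      have hlof : ∀ j (h : j = k) (y : A × B) (hy : y ∈ coneGrading 𝒜 ℬ j),
          DirectSum.lof ℝ ℤ (fun k => coneGrading 𝒜 ℬ k) j ⟨y, hy⟩ =
            DirectSum.lof ℝ ℤ (fun k => coneGrading 𝒜 ℬ k) k ⟨y, h ▸ hy⟩ := by
        rintro j rfl y hy
        rfl
      simp only [LinearMap.comp_apply, DirectSum.coeLinearMap_lof, LinearMap.coprod_apply,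
        LinearEquiv.coe_coe, DirectSum.decomposeLinearEquiv_apply, LinearMap.id_apply]
      rw [DirectSum.decompose_of_mem 𝒜 ha, DirectSum.decompose_of_mem ℬ hb,
        ← DirectSum.lof_eq_of ℝ, ← DirectSum.lof_eq_of ℝ, DirectSum.toModule_lof,
        DirectSum.toModule_lof]
      simp only [LinearMap.comp_apply]
      refine (congrArg₂ (· + ·) rfl (hlof _ hk (0, b) ⟨zero_mem _, by simpa using hb⟩)).trans ?_
      rw [← map_add]
      congr 1
      refine Subtype.ext ?_
      exact Prod.ext (add_zero a) (zero_add b))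

variable {𝒜 ℬ} {d : A →ₗ[ℝ] A} {d' : B →ₗ[ℝ] B} {φ : A →ₗ[ℝ] B}

theorem cohomologyMap_injective_iff (h : ∀ x, d' (φ x) = φ (d x)) :
    Function.Injective (cohomologyMap φ h) ↔ ∀ x, d x = 0 → (∃ y, d' y = φ x) → ∃ y, d y = x := by
  rw [← LinearMap.ker_eq_bot, LinearMap.ker_eq_bot']
  constructor
  · rintro H x hx ⟨y, hy⟩
    have := H (Submodule.Quotient.mk ⟨x, hx⟩) (by
      rw [cohomologyMap, Submodule.mapQ_apply, Submodule.Quotient.mk_eq_zero]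
      exact ⟨y, hy⟩)
    rwa [Submodule.Quotient.mk_eq_zero] at this
  · intro H q
    induction q using Submodule.Quotient.induction_on with
    | _ x =>
    intro hx
    rw [cohomologyMap, Submodule.mapQ_apply, Submodule.Quotient.mk_eq_zero] at hx
    rw [Submodule.Quotient.mk_eq_zero]
    exact H x x.2 hx

theorem cohomologyMap_surjective_iff (h : ∀ x, d' (φ x) = φ (d x)) :
    Function.Surjective (cohomologyMap φ h) ↔
      ∀ y, d' y = 0 → ∃ x z, d x = 0 ∧ φ x + d' z = y := by
  constructor
  · intro H y hy
    obtain ⟨q, hq⟩ := H (Submodule.Quotient.mk ⟨y, hy⟩)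
    induction q using Submodule.Quotient.induction_on with
    | _ x =>
    rw [cohomologyMap, Submodule.mapQ_apply, Submodule.Quotient.eq'] at hq
    obtain ⟨z, hz⟩ := hq
    refine ⟨x, z, x.2, ?_⟩
    rw [hz]
    exact add_neg_cancel_left _ _
  · intro H q
    induction q using Submodule.Quotient.induction_on with
    | _ y =>
    obtain ⟨x, z, hx, hz⟩ := H y y.2
    refine ⟨Submodule.Quotient.mk ⟨x, hx⟩, ?_⟩
    rw [cohomologyMap, Submodule.mapQ_apply, Submodule.Quotient.eq']
    refine ⟨z, ?_⟩
    rw [← add_right_inj (φ x), hz]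
    exact (add_neg_cancel_left _ _).symm

variable (d d' φ) in
/-- The differential of the cone of `φ`. -/
def coneDifferential : A × B →ₗ[ℝ] A × B :=
  LinearMap.prod (d ∘ₗ LinearMap.fst ℝ A B) (φ.coprod (-d'))

theorem coneDifferential_apply (a : A) (b : B) :
    coneDifferential d d' φ (a, b) = (d a, φ a - d' b) := by
  simp [coneDifferential, sub_eq_add_neg]

theorem mapsDegree_coneDifferential (hd : MapsDegree 𝒜 𝒜 1 d) (hd' : MapsDegree ℬ ℬ 1 d')
    (hφ : MapsDegree 𝒜 ℬ 0 φ) :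
    MapsDegree (coneGrading 𝒜 ℬ) (coneGrading 𝒜 ℬ) 1 (coneDifferential d d' φ) := by
  rintro k ⟨a, b⟩ ⟨ha, hb⟩
  rw [coneDifferential_apply]
  refine ⟨hd k a ha, ?_⟩
  have h1 := hφ k a ha
  have h2 := hd' _ b hb
  simp only [add_zero, sub_add_cancel, add_sub_cancel_right] at h1 h2 ⊢
  exact sub_mem h1 h2

theorem coneDifferential_coneDifferential (hdd : ∀ x, d (d x) = 0) (hdd' : ∀ x, d' (d' x) = 0)
    (h : ∀ x, d' (φ x) = φ (d x)) (x : A × B) :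
    coneDifferential d d' φ (coneDifferential d d' φ x) = 0 := by
  obtain ⟨a, b⟩ := x
  rw [coneDifferential_apply, coneDifferential_apply, hdd, map_sub, hdd', h, sub_zero, sub_self]
  rfl

/-- The cone of an isomorphism on cohomology is contractible. -/
theorem exists_cone_contraction [DirectSum.Decomposition 𝒜] [DirectSum.Decomposition ℬ]
    (hd : MapsDegree 𝒜 𝒜 1 d) (hd' : MapsDegree ℬ ℬ 1 d') (hφ : MapsDegree 𝒜 ℬ 0 φ)
    (hdd : ∀ x, d (d x) = 0) (hdd' : ∀ x, d' (d' x) = 0) (h : ∀ x, d' (φ x) = φ (d x))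
    (hiso : Function.Bijective (cohomologyMap φ h)) :
    ∃ S : A × B →ₗ[ℝ] A × B, MapsDegree (coneGrading 𝒜 ℬ) (coneGrading 𝒜 ℬ) (-1) S ∧
      ∀ x, coneDifferential d d' φ (S x) + S (coneDifferential d d' φ x) = x := by
  refine exists_contraction (mapsDegree_coneDifferential hd hd' hφ)
    (coneDifferential_coneDifferential hdd hdd' h) ?_
  rintro ⟨a, b⟩ hab
  rw [coneDifferential_apply, Prod.mk_eq_zero, sub_eq_zero] at hab
  -- A cocycle `(a, b)` has `d a = 0` and `φ a = d' b`. Injectivity gives `a = d x`; then `b - φ x`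
  -- is a cocycle, and surjectivity writes it as `φ z + d' y` with `d z = 0`. So `(a, b)` is the
  -- boundary of `(x + z, -y)`.
  obtain ⟨x, hx⟩ := (cohomologyMap_injective_iff h).1 hiso.1 a hab.1 ⟨b, hab.2.symm⟩
  obtain ⟨z, y, hz, hy⟩ := (cohomologyMap_surjective_iff h).1 hiso.2 (b - φ x)
    (by rw [map_sub, h, hx, hab.2, sub_self])
  refine ⟨(x + z, -y), ?_⟩
  rw [coneDifferential_apply, map_add, map_add, hx, hz, map_neg, add_zero, sub_neg_eq_add,
    add_assoc, hy, add_sub_cancel]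

/-- The contraction is found for the unshifted gradings, while components of maps of bar
constructions have values in the shifted ones. -/
theorem MapsDegree.cone_shift {k : ℤ} {f : A × B →ₗ[ℝ] A × B}
    (h : MapsDegree (coneGrading 𝒜 ℬ) (coneGrading 𝒜 ℬ) k f) :
    MapsDegree (coneGrading (shift 𝒜) (shift ℬ)) (coneGrading (shift 𝒜) (shift ℬ)) k f := by
  have e : ∀ j, coneGrading (shift 𝒜) (shift ℬ) j = coneGrading 𝒜 ℬ (j + 1) := fun j => by
    simp only [coneGrading, shift, sub_add_cancel, add_sub_cancel_right]
  intro j x hx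
  rw [e] at hx ⊢
  rw [add_right_comm]
  exact h _ x hx

end Cone

/-! ### Leading terms of coalgebra maps and of their failure to commute -/

section Leading

variable {A B : Type*} [AddCommGroup A] [Module ℝ A] [AddCommGroup B] [Module ℝ B]
variable {𝒜 : ℤ → Submodule ℝ A} [DirectSum.Decomposition 𝒜]
variable {ℬ : ℤ → Submodule ℝ B} [DirectSum.Decomposition ℬ]

/-- To leading order, the difference of two coalgebra maps is given by the difference of their
projections to cogenerators. -/
theorem vanish_geom_sub_letters {φ ψ : TensorCoalgebra A →ₗ[ℝ] B} (hφ : Vanish 1 φ)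
    (hψ : Vanish 1 ψ) {n : ℕ} (h : Vanish n (φ - ψ)) :
    Vanish (n + 1) ((geom (letters φ)).ofConv - (geom (letters ψ)).ofConv -
      letter ∘ₗ (φ - ψ)) := by
  have := vanish_mul_mul_sub (geom_sub_one hφ.letters) (geom_sub_one hψ.letters) h.letters
  rw [letters_sub, ← geom_sub_geom hφ.letters hψ.letters, ← letters_sub] at this
  exact this

theorem IsCoalgMap.vanish_one {F : TensorCoalgebra A →ₗ[ℝ] TensorCoalgebra B} (hF : IsCoalgMap F) :
    Vanish 1 (cogenerators ∘ₗ F) :=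
  vanish_one_iff.2 (by rw [LinearMap.comp_apply, hF.one, cogenerators_one])

theorem IsCoalgMap.vanish_sub_sub_letters {F G : TensorCoalgebra A →ₗ[ℝ] TensorCoalgebra B}
    (hF : IsCoalgMap F) (hG : IsCoalgMap G) {n : ℕ}
    (h : Vanish n (cogenerators ∘ₗ F - cogenerators ∘ₗ G)) :
    Vanish (n + 1) (F - G - letter ∘ₗ (cogenerators ∘ₗ F - cogenerators ∘ₗ G)) := by
  have := vanish_geom_sub_letters hF.vanish_one hG.vanish_one h
  rwa [← hF.eq_geom, ← hG.eq_geom] at this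

variable {D : TensorCoalgebra A →ₗ[ℝ] TensorCoalgebra A}
  {D' : TensorCoalgebra B →ₗ[ℝ] TensorCoalgebra B}
  {F : TensorCoalgebra A →ₗ[ℝ] TensorCoalgebra B}

theorem parity_comp_of_mapsDegree (hd : MapsDegree (tensorGrading 𝒜) (tensorGrading ℬ) 0 F) :
    tensorParity ℬ ∘ₗ F = F ∘ₗ tensorParity 𝒜 := by
  rw [tensorParity_comp hd, realSign_zero, one_smul]

/-- The failure of a coalgebra map to be compatible with codifferentials is a coderivation. -/
theorem comm_sub_eq_coderOver (hD : IsCodifferential 𝒜 D) (hD' : IsCodifferential ℬ D')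
    (hF : IsCoalgMap F) (hd : MapsDegree (tensorGrading 𝒜) (tensorGrading ℬ) 0 F) :
    D' ∘ₗ F - F ∘ₗ D =
      coderOver 𝒜 F (cogenerators ∘ₗ D' ∘ₗ F - (cogenerators ∘ₗ F) ∘ₗ D) := by
  have h1 : IsCoder (F ∘ₗ tensorParity 𝒜) F (D' ∘ₗ F) := by
    have hc := hD'.coder
    unfold IsCoder at hc ⊢
    rw [← LinearMap.comp_assoc, hc, LinearMap.comp_assoc, hF.comul, ← LinearMap.comp_assoc,
      LinearMap.add_comp, ← TensorProduct.map_comp, ← TensorProduct.map_comp,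
      parity_comp_of_mapsDegree hd, LinearMap.id_comp]
  have h2 : IsCoder (F ∘ₗ tensorParity 𝒜) F (F ∘ₗ D) := by
    have hc := hD.coder
    unfold IsCoder at hc ⊢
    rw [← LinearMap.comp_assoc, hF.comul, LinearMap.comp_assoc, hc, ← LinearMap.comp_assoc,
      LinearMap.comp_add, ← TensorProduct.map_comp, ← TensorProduct.map_comp, LinearMap.comp_id]
  have hFP := hF.comp (isCoalgMap_tensorParity (𝒜 := 𝒜))
  rw [← coderOver_sub_right]
  congr 1
  · exact congrArg WithConv.ofConv (h1.eq_mul hFP hF.counit)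
  · exact congrArg WithConv.ofConv (h2.eq_mul hFP hF.counit)

end Leading

/-! ### Obstruction theory for a right inverse up to homotopy -/

section Inverse

variable {A B : Type*} [AddCommGroup A] [Module ℝ A] [AddCommGroup B] [Module ℝ B]

/-- The linear part of a map between tensor coalgebras. -/
def linearPart (F : TensorCoalgebra A →ₗ[ℝ] TensorCoalgebra B) : A →ₗ[ℝ] B :=
  cogenerators ∘ₗ F ∘ₗ letter

variable {𝒜 : ℤ → Submodule ℝ A} {ℬ : ℤ → Submodule ℝ B}

variable (𝒜 ℬ) in
/-- The admissible components `s = (g, δ)`. -/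
structure IsAdmissible (s : TensorCoalgebra B →ₗ[ℝ] A × B) : Prop where
  vanish : Vanish 1 s
  degree : MapsDegree (tensorGrading ℬ) (coneGrading (shift 𝒜) (shift ℬ)) 0 s

namespace IsAdmissible

variable {s : TensorCoalgebra B →ₗ[ℝ] A × B} (hs : IsAdmissible 𝒜 ℬ s)
include hs

theorem vanish_fst : Vanish 1 (LinearMap.fst ℝ A B ∘ₗ s) := hs.vanish.comp _

theorem vanish_snd : Vanish 1 (LinearMap.snd ℝ A B ∘ₗ s) := hs.vanish.comp _

theorem degree_fst : MapsDegree (tensorGrading ℬ) (shift 𝒜) 0 (LinearMap.fst ℝ A B ∘ₗ s) :=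
  fun k x hx => (hs.degree k x hx).1

theorem degree_snd : MapsDegree (tensorGrading ℬ) (shift ℬ) (-1) (LinearMap.snd ℝ A B ∘ₗ s) :=
  fun k x hx => by
    have := (hs.degree k x hx).2
    rwa [add_zero] at this

theorem isCoalgMap : IsCoalgMap (geom (letters (LinearMap.fst ℝ A B ∘ₗ s))).ofConv :=
  isCoalgMap_geom hs.vanish_fst

end IsAdmissible

variable [DirectSum.Decomposition ℬ]

variable (ℬ) in
/-- The components of the end point of the flow with generator `δ`. -/
def flowEnd (D' : TensorCoalgebra B →ₗ[ℝ] TensorCoalgebra B) (δ : TensorCoalgebra B →ₗ[ℝ] B) :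
    TensorCoalgebra B →ₗ[ℝ] B :=
  Classical.epsilon (IsFlow ℬ D' δ) 1

variable (ℬ) in
/-- The obstructions for the components `s = (g, δ)`: the failure of the coalgebra map `G` given by
`g` to be compatible with the codifferentials, and the difference between `F ∘ G` and the end point
of the flow generated by `δ`. -/
def obstruction (D : TensorCoalgebra A →ₗ[ℝ] TensorCoalgebra A)
    (D' : TensorCoalgebra B →ₗ[ℝ] TensorCoalgebra B)
    (F : TensorCoalgebra A →ₗ[ℝ] TensorCoalgebra B) (s : TensorCoalgebra B →ₗ[ℝ] A × B) :
    TensorCoalgebra B →ₗ[ℝ] A × B :=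
  LinearMap.prod
    (cogenerators ∘ₗ D ∘ₗ (geom (letters (LinearMap.fst ℝ A B ∘ₗ s))).ofConv -
      (LinearMap.fst ℝ A B ∘ₗ s) ∘ₗ D')
    (cogenerators ∘ₗ F ∘ₗ (geom (letters (LinearMap.fst ℝ A B ∘ₗ s))).ofConv -
      flowEnd ℬ D' (LinearMap.snd ℝ A B ∘ₗ s))

/-- The differential `∂ s = d s - s D'` of maps to the cone. -/
def coneHomDifferential (dC : A × B →ₗ[ℝ] A × B) (D' : TensorCoalgebra B →ₗ[ℝ] TensorCoalgebra B)
    (s : TensorCoalgebra B →ₗ[ℝ] A × B) : TensorCoalgebra B →ₗ[ℝ] A × B :=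
  dC ∘ₗ s - s ∘ₗ D'

variable {D : TensorCoalgebra A →ₗ[ℝ] TensorCoalgebra A}
  {D' : TensorCoalgebra B →ₗ[ℝ] TensorCoalgebra B}
  {F : TensorCoalgebra A →ₗ[ℝ] TensorCoalgebra B}

theorem isFlow_epsilon (hD' : IsCodifferential ℬ D') {δ : TensorCoalgebra B →ₗ[ℝ] B}
    (hδ : Vanish 1 δ) (hd : MapsDegree (tensorGrading ℬ) (shift ℬ) (-1) δ) :
    IsFlow ℬ D' δ (Classical.epsilon (IsFlow ℬ D' δ)) :=
  Classical.epsilon_spec (exists_isFlow hD' hδ hd)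

namespace IsAdmissible

variable {s s' : TensorCoalgebra B →ₗ[ℝ] A × B} (hs : IsAdmissible 𝒜 ℬ s)
include hs

theorem isFlow (hD' : IsCodifferential ℬ D') : IsFlow ℬ D' (LinearMap.snd ℝ A B ∘ₗ s)
    (Classical.epsilon (IsFlow ℬ D' (LinearMap.snd ℝ A B ∘ₗ s))) :=
  isFlow_epsilon hD' hs.vanish_snd hs.degree_snd

/-- To leading order, the obstruction changes by `∂ (s - s')`. -/
theorem vanish_obstruction_sub (hs' : IsAdmissible 𝒜 ℬ s') (hD' : IsCodifferential ℬ D') {n : ℕ}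
    (h : Vanish n (s - s')) :
    Vanish (n + 1) (obstruction ℬ D D' F s - obstruction ℬ D D' F s' - coneHomDifferential
      (coneDifferential (linearPart D) (linearPart D') (linearPart F)) D' (s - s')) := by
  have h1 := vanish_geom_sub_letters hs.vanish_fst hs'.vanish_fst
    (n := n) (by rw [← LinearMap.comp_sub]; exact h.comp _)
  have h2 := (hs.isFlow hD').vanish_sub_sub (hs'.isFlow hD') hD' hs.vanish_snd
    (n := n) (by rw [← LinearMap.comp_sub]; exact h.comp _)
  rw [← LinearMap.comp_sub] at h1 h2
  -- In either component, the deviation from `∂ (s - s')` is a combination of the errors of the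
  -- linear approximations in `h1` and `h2`.
  have e1 : LinearMap.fst ℝ A B ∘ₗ (obstruction ℬ D D' F s - obstruction ℬ D D' F s' -
      coneHomDifferential (coneDifferential (linearPart D) (linearPart D') (linearPart F)) D'
        (s - s')) = (cogenerators ∘ₗ D) ∘ₗ
      ((geom (letters (LinearMap.fst ℝ A B ∘ₗ s))).ofConv -
        (geom (letters (LinearMap.fst ℝ A B ∘ₗ s'))).ofConv -
          letter ∘ₗ LinearMap.fst ℝ A B ∘ₗ (s - s')) := by
    refine LinearMap.ext fun x => ?_
    simp only [LinearMap.comp_apply, LinearMap.sub_apply, map_sub]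
    change (cogenerators (D _) - (s (D' x)).1) - (cogenerators (D _) - (s' (D' x)).1) -
      (cogenerators (D (letter ((s - s') x).1)) - ((s - s') (D' x)).1) = _
    simp only [LinearMap.sub_apply, Prod.fst_sub, map_sub, LinearMap.fst_apply]
    abel
  have e2 : LinearMap.snd ℝ A B ∘ₗ (obstruction ℬ D D' F s - obstruction ℬ D D' F s' -
      coneHomDifferential (coneDifferential (linearPart D) (linearPart D') (linearPart F)) D'
        (s - s')) = (cogenerators ∘ₗ F) ∘ₗ
      ((geom (letters (LinearMap.fst ℝ A B ∘ₗ s))).ofConv -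
        (geom (letters (LinearMap.fst ℝ A B ∘ₗ s'))).ofConv -
          letter ∘ₗ LinearMap.fst ℝ A B ∘ₗ (s - s')) -
      (Classical.epsilon (IsFlow ℬ D' (LinearMap.snd ℝ A B ∘ₗ s)) 1 -
        Classical.epsilon (IsFlow ℬ D' (LinearMap.snd ℝ A B ∘ₗ s')) 1 -
        (cogenerators ∘ₗ D' ∘ₗ letter ∘ₗ LinearMap.snd ℝ A B ∘ₗ (s - s') +
          (LinearMap.snd ℝ A B ∘ₗ (s - s')) ∘ₗ D')) := by
    refine LinearMap.ext fun x => ?_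
    simp only [LinearMap.comp_apply, LinearMap.sub_apply, LinearMap.add_apply, map_sub]
    change (cogenerators (F _) - flowEnd ℬ D' _ x) - (cogenerators (F _) - flowEnd ℬ D' _ x) -
      ((cogenerators (F (letter ((s - s') x).1)) + -cogenerators (D' (letter ((s - s') x).2))) -
        ((s - s') (D' x)).2) = _
    simp only [LinearMap.sub_apply, Prod.fst_sub, Prod.snd_sub, map_sub, LinearMap.fst_apply,
      LinearMap.snd_apply, flowEnd]
    abel
  have v1 := h1.comp (cogenerators ∘ₗ D)
  have v2 := (h1.comp (cogenerators ∘ₗ F)).sub h2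
  rw [← e1] at v1
  rw [← e2] at v2
  exact fun k hk v => Prod.ext (v1 k hk v) (v2 k hk v)

variable [DirectSum.Decomposition 𝒜]

theorem vanish_obstruction (hD : IsCodifferential 𝒜 D) (hD' : IsCodifferential ℬ D')
    (hF : IsCoalgMap F) : Vanish 1 (obstruction ℬ D D' F s) := by
  refine vanish_one_iff.2 (Prod.ext ?_ ?_)
  · change cogenerators (D ((geom (letters (LinearMap.fst ℝ A B ∘ₗ s))).ofConv 1)) -
      (LinearMap.fst ℝ A B ∘ₗ s) (D' 1) = 0
    rw [hs.isCoalgMap.one, hD.one, hD'.one, map_zero, map_zero, sub_zero]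
  · change cogenerators (F ((geom (letters (LinearMap.fst ℝ A B ∘ₗ s))).ofConv 1)) -
      flowEnd ℬ D' (LinearMap.snd ℝ A B ∘ₗ s) 1 = 0
    rw [hs.isCoalgMap.one, hF.one, cogenerators_one, flowEnd,
      vanish_one_iff.1 ((hs.isFlow hD').vanish 1), sub_zero]

theorem mapsDegree_obstruction (hD : IsCodifferential 𝒜 D) (hD' : IsCodifferential ℬ D')
    (hFd : MapsDegree (tensorGrading 𝒜) (tensorGrading ℬ) 0 F) :
    MapsDegree (tensorGrading ℬ) (coneGrading (shift 𝒜) (shift ℬ)) 1 (obstruction ℬ D D' F s) := by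
  intro k x hx
  have hG := mapsDegree_geom hs.degree_fst
  refine ⟨?_, ?_⟩
  · exact ((mapsDegree_cogenerators.comp (hD.degree.comp hG (zero_add 1)) (add_zero 1)).sub
      (hs.degree_fst.comp hD'.degree (add_zero 1))) k x hx
  · have := ((mapsDegree_cogenerators.comp (hFd.comp hG (zero_add 0)) (add_zero 0)).sub
      ((hs.isFlow hD').degree 1)) k x hx
    rw [add_zero] at this
    rw [add_sub_cancel_right]
    exact this

/-- To leading order, the obstruction is a cocycle. -/
theorem vanish_obstruction_cocycle (hD : IsCodifferential 𝒜 D) (hD' : IsCodifferential ℬ D')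
    (hF : IsCoalgMap F) (hcomm : D' ∘ₗ F = F ∘ₗ D) {n : ℕ}
    (h : Vanish n (obstruction ℬ D D' F s)) :
    Vanish (n + 1) (coneDifferential (linearPart D) (linearPart D') (linearPart F) ∘ₗ
      obstruction ℬ D D' F s + obstruction ℬ D D' F s ∘ₗ D') := by
  set g := LinearMap.fst ℝ A B ∘ₗ s with hg
  set G := (geom (letters g)).ofConv with hGdef
  have hG : IsCoalgMap G := hs.isCoalgMap
  have hGd : MapsDegree (tensorGrading ℬ) (tensorGrading 𝒜) 0 G := mapsDegree_geom hs.degree_fst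
  have hπG : cogenerators ∘ₗ G = g := cogenerators_comp_geom hs.vanish_fst
  have hflow := hs.isFlow hD'
  set Φ := (geom (letters (flowEnd ℬ D' (LinearMap.snd ℝ A B ∘ₗ s)))).ofConv with hΦdef
  have hΦ : IsCoalgMap Φ := isCoalgMap_geom (hflow.vanish 1)
  have hΦc : D' ∘ₗ Φ = Φ ∘ₗ D' :=
    (hflow.comm_and_deriv hD' hs.vanish_snd hs.degree_snd).1 1
  have hπΦ : cogenerators ∘ₗ Φ = flowEnd ℬ D' (LinearMap.snd ℝ A B ∘ₗ s) :=
    cogenerators_comp_geom (hflow.vanish 1)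
  set o₁ := cogenerators ∘ₗ D ∘ₗ G - g ∘ₗ D' with ho₁
  set o₂ := cogenerators ∘ₗ F ∘ₗ G - flowEnd ℬ D' (LinearMap.snd ℝ A B ∘ₗ s) with ho₂
  have ho : obstruction ℬ D D' F s = o₁.prod o₂ := rfl
  have h₁ : Vanish n o₁ := h.comp (LinearMap.fst ℝ A B)
  have h₂ : Vanish n o₂ := h.comp (LinearMap.snd ℝ A B)
  -- To leading order, the failure of `G` to commute is its projection `o₁` placed on words of
  -- length one; `hFG` is the analogue for `F ∘ G` and the flow.
  have hE : Vanish (n + 1) (D ∘ₗ G - G ∘ₗ D' - letter ∘ₗ o₁) := by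
    rw [comm_sub_eq_coderOver hD' hD hG hGd, hπG]
    exact vanish_coderOver_sub_letters hG h₁
  have hFG : Vanish (n + 1) (F ∘ₗ G - Φ - letter ∘ₗ o₂) := by
    have := (hF.comp hG).vanish_sub_sub_letters hΦ (n := n) (by rw [hπΦ]; exact h₂)
    rwa [hπΦ] at this
  -- The full expressions satisfy the cocycle identity exactly because `D² = 0` and `D'² = 0`. Only
  -- the errors of the leading terms remain.
  have k₁ : linearPart D ∘ₗ o₁ + o₁ ∘ₗ D' =
      -((cogenerators ∘ₗ D) ∘ₗ (D ∘ₗ G - G ∘ₗ D' - letter ∘ₗ o₁)) := by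
    have hDD : ∀ x, D (D x) = 0 := fun x => congrArg (fun f => f x) hD.sq
    have hDD' : ∀ x, D' (D' x) = 0 := fun x => congrArg (fun f => f x) hD'.sq
    refine LinearMap.ext fun x => ?_
    simp only [ho₁, linearPart, ← hπG, LinearMap.add_apply, LinearMap.sub_apply,
      LinearMap.neg_apply, LinearMap.comp_apply, map_sub, hDD, hDD', map_zero]
    abel
  -- Here the exact identity rests on `D' F = F D` and on the fact that the end point of the flow
  -- commutes with `D'`.
  have k₂ : linearPart F ∘ₗ o₁ - linearPart D' ∘ₗ o₂ + o₂ ∘ₗ D' =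
      (cogenerators ∘ₗ D') ∘ₗ (F ∘ₗ G - Φ - letter ∘ₗ o₂) -
        (cogenerators ∘ₗ F) ∘ₗ (D ∘ₗ G - G ∘ₗ D' - letter ∘ₗ o₁) := by
    have c1 : ∀ x, D' (F x) = F (D x) := fun x => congrArg (fun f => f x) hcomm
    have c2 : ∀ x, D' (Φ x) = Φ (D' x) := fun x => congrArg (fun f => f x) hΦc
    refine LinearMap.ext fun x => ?_
    simp only [ho₂, linearPart, ← hπΦ, LinearMap.add_apply, LinearMap.sub_apply,
      LinearMap.comp_apply, map_sub, c1, c2]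
    abel
  have v₁ : Vanish (n + 1) (linearPart D ∘ₗ o₁ + o₁ ∘ₗ D') := by
    rw [k₁]
    exact (hE.comp _).neg
  have v₂ : Vanish (n + 1) (linearPart F ∘ₗ o₁ - linearPart D' ∘ₗ o₂ + o₂ ∘ₗ D') := by
    rw [k₂]
    exact (hFG.comp _).sub (hE.comp _)
  rw [ho]
  intro k hk v
  refine Prod.ext (v₁ k hk v) ?_
  have := v₂ k hk v
  rw [sub_eq_add_neg] at this
  exact this

end IsAdmissible

variable [DirectSum.Decomposition 𝒜]

/-- A coalgebra map compatible with codifferentials whose linear part has a contractible cone has a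
right inverse up to the end point of a flow. -/
theorem exists_inverse_of_contraction (hD : IsCodifferential 𝒜 D) (hD' : IsCodifferential ℬ D')
    (hF : IsCoalgMap F) (hFd : MapsDegree (tensorGrading 𝒜) (tensorGrading ℬ) 0 F)
    (hcomm : D' ∘ₗ F = F ∘ₗ D) {S : A × B →ₗ[ℝ] A × B}
    (hSd : MapsDegree (coneGrading (shift 𝒜) (shift ℬ)) (coneGrading (shift 𝒜) (shift ℬ)) (-1) S)
    (hdd : ∀ x, coneDifferential (linearPart D) (linearPart D') (linearPart F)
      (coneDifferential (linearPart D) (linearPart D') (linearPart F) x) = 0)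
    (hdC : MapsDegree (coneGrading (shift 𝒜) (shift ℬ)) (coneGrading (shift 𝒜) (shift ℬ)) 1
      (coneDifferential (linearPart D) (linearPart D') (linearPart F)))
    (hS : ∀ x, coneDifferential (linearPart D) (linearPart D') (linearPart F) (S x) +
      S (coneDifferential (linearPart D) (linearPart D') (linearPart F) x) = x) :
    ∃ s, IsAdmissible 𝒜 ℬ s ∧ obstruction ℬ D D' F s = 0 := by
  set dC := coneDifferential (linearPart D) (linearPart D') (linearPart F) with hdCdef
  -- The operator is `s ↦ S (∂ s - o(s))`. By `vanish_obstruction_sub` the leading change of `o` is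
  -- `∂` of the change of `s`, so the two cancel and the operator raises the order of agreement.
  obtain ⟨s, hs, hfix⟩ := exists_fixedPoint (I := Unit) (fun s => IsAdmissible 𝒜 ℬ (s ()))
    (fun s _ => S ∘ₗ (coneHomDifferential dC D' (s ()) - obstruction ℬ D D' F (s ())))
    (fun _ => 0) ⟨fun _ _ _ => rfl, MapsDegree.zero⟩
    (fun s hs => ⟨(((hs.vanish.comp _).sub (hs.vanish.comp_codifferential hD')).sub
        (hs.vanish_obstruction hD hD' hF)).comp _,
      hSd.comp (((hdC.comp hs.degree (zero_add 1)).sub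
        (hs.degree.comp hD'.degree (add_zero 1))).sub (hs.mapsDegree_obstruction hD hD' hFd))
        (add_neg_cancel 1)⟩)
    (fun n s s' hs hs' h i => by
      have := ((hs.vanish_obstruction_sub (D := D) (F := F) hs' hD' (h ())).comp S).neg
      convert this using 1
      rw [← LinearMap.comp_sub, ← LinearMap.comp_neg]
      congr 1
      simp only [coneHomDifferential, LinearMap.comp_sub, LinearMap.sub_comp, hdCdef]
      abel)
    (fun s h => ⟨by
      obtain ⟨ψ, hψ, h⟩ := h 1
      have := (h ()).add hψ.vanish
      rwa [sub_add_cancel] at this, mapsDegree_limit fun n => by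
      obtain ⟨ψ, hψ, h⟩ := h n
      exact ⟨_, hψ.degree, h ()⟩⟩)
  refine ⟨s (), hs, eq_zero_of_vanish fun n => ?_⟩
  have hfix' : s () = S ∘ₗ (coneHomDifferential dC D' (s ()) - obstruction ℬ D D' F (s ())) :=
    (congrFun hfix ()).symm
  set o := obstruction ℬ D D' F (s ()) with ho
  have hDD' : ∀ x, D' (D' x) = 0 := fun x => congrArg (fun f => f x) hD'.sq
  -- By the contraction identity, the fixed point equation expresses `S o` through `S s`. Inserting
  -- this in `o = dC S o + S dC o`, with `dC² = 0` and `D'² = 0`, gives the formula. Its bracket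
  -- vanishes to one order more than `o`, which forces `o = 0`.
  have key : o = S ∘ₗ (dC ∘ₗ o + o ∘ₗ D') := by
    have e1 : ∀ x, S (o x) = -(dC (S (s () x)) + S (s () (D' x))) := fun x => by
      have h1 := congrArg (fun f => f x) hfix'
      simp only [coneHomDifferential, LinearMap.comp_apply, LinearMap.sub_apply, map_sub] at h1
      have h2 := hS (s () x)
      rw [← sub_eq_zero]
      have h3 : S (dC (s () x)) = s () x - dC (S (s () x)) := eq_sub_of_add_eq' h2
      rw [h3] at h1
      rw [← sub_eq_zero] at h1
      rw [← h1]
      abel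
    refine LinearMap.ext fun x => ?_
    have h1 := hS (o x)
    rw [e1 x, map_neg, map_add, hdd, zero_add] at h1
    have h2 := e1 (D' x)
    rw [hDD', map_zero, map_zero, add_zero] at h2
    rw [LinearMap.comp_apply, LinearMap.add_apply, map_add, LinearMap.comp_apply,
      LinearMap.comp_apply, h2, add_comm]
    exact h1.symm
  induction n with
  | zero => exact vanish_zero _
  | succ n ih =>
    rw [key]
    exact (hs.vanish_obstruction_cocycle hD hD' hF hcomm ih).comp S

end Inverse

/-! ### Primitive elements, linear parts and the passage back to families -/

section Primitive

variable {A B C : Type*} [AddCommGroup A] [Module ℝ A] [AddCommGroup B] [Module ℝ B]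
  [AddCommGroup C] [Module ℝ C]

/-- The primitive elements of the tensor coalgebra are the words of length one. -/
theorem eq_letter_of_primitive {y : TensorCoalgebra A}
    (h : coproduct y = 1 ⊗ₜ[ℝ] y + y ⊗ₜ[ℝ] 1) : y = letter (cogenerators y) := by
  have hε : counitMap y • (1 : TensorCoalgebra A) = 0 := by
    have := Coalgebra.rTensor_counit_comul (R := ℝ) y
    rw [comul_eq, counit_eq, h, map_add, LinearMap.rTensor_tmul, LinearMap.rTensor_tmul,
      counitMap_one] at this
    simpa using congrArg (TensorProduct.lid ℝ (TensorCoalgebra A)) this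
  have h1 := congrArg (fun f : Conv A (TensorCoalgebra A) => f.ofConv y) id_eq
  simp only [WithConv.ofConv_add, LinearMap.add_apply] at h1
  have h2 : (1 : Conv A (TensorCoalgebra A)).ofConv y = counitMap y • 1 := by
    rw [LinearMap.convOne_def, ← counit_eq]
    simp [Algebra.smul_def]
  have h3 : (letters cogenerators * WithConv.toConv LinearMap.id :
      Conv A (TensorCoalgebra A)).ofConv y = letter (cogenerators y) := by
    rw [LinearMap.convMul_def]
    simp [comul_eq, h, letters_apply, cogenerators_one]
  rw [h2, h3, hε, zero_add] at h1
  exact h1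

/-- A coalgebra map preserving `1` maps primitive elements to primitive elements. -/
theorem IsCoalgMap.apply_letter {F : TensorCoalgebra A →ₗ[ℝ] TensorCoalgebra B} (hF : IsCoalgMap F)
    (a : A) : F (letter a) = letter (linearPart F a) := by
  refine eq_letter_of_primitive ?_
  have := congrArg (fun f => f (letter a)) hF.comul
  simp only [LinearMap.comp_apply, coproduct_letter, map_add, TensorProduct.map_tmul, hF.one]
    at this
  exact this

theorem IsCoder.apply_letter {F G X : TensorCoalgebra A →ₗ[ℝ] TensorCoalgebra B}
    (hX : IsCoder F G X) (hF : F 1 = 1) (hG : G 1 = 1) (h1 : X 1 = 0) (a : A) :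
    X (letter a) = letter (linearPart X a) := by
  refine eq_letter_of_primitive ?_
  have := congrArg (fun f => f (letter a)) hX
  simp only [LinearMap.comp_apply, coproduct_letter, map_add, TensorProduct.map_tmul, hF, hG, h1,
    LinearMap.add_apply, TensorProduct.tmul_zero, TensorProduct.zero_tmul, zero_add, add_zero]
    at this
  exact this

theorem linearPart_comp (G : TensorCoalgebra B →ₗ[ℝ] TensorCoalgebra C)
    {F : TensorCoalgebra A →ₗ[ℝ] TensorCoalgebra B} (hF : IsCoalgMap F) (a : A) :
    linearPart (G ∘ₗ F) a = linearPart G (linearPart F a) := by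
  simp only [linearPart, LinearMap.comp_apply]
  rw [hF.apply_letter, cogenerators_letter]

variable {𝒜 : ℤ → Submodule ℝ A} [DirectSum.Decomposition 𝒜]
variable {ℬ : ℤ → Submodule ℝ B} [DirectSum.Decomposition ℬ]

theorem IsCodifferential.apply_letter {D : TensorCoalgebra A →ₗ[ℝ] TensorCoalgebra A}
    (hD : IsCodifferential 𝒜 D) (a : A) : D (letter a) = letter (linearPart D a) :=
  hD.coder.apply_letter isCoalgMap_tensorParity.one rfl hD.one a

theorem bar_letter (f : Family A B) (a : A) : bar 𝒜 f (letter a) = f.linear a := by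
  rw [bar, letter_apply, liftPure_pureTensor]
  change f 1 (fun j => (sparity 𝒜 ^ (j.rev : ℕ)) a) = f 1 (fun _ => a)
  congr 1
  funext j
  fin_cases j
  rfl

theorem linearPart_barMap {f : Family A B} (hf : f 0 = 0) : linearPart (barMap 𝒜 f) = f.linear := by
  rw [linearPart, ← LinearMap.comp_assoc, cogenerators_comp_barMap hf]
  exact LinearMap.ext fun a => bar_letter f a

theorem linearPart_barDifferential {m : Family A A} (hm : m 0 = 0) :
    linearPart (barDifferential 𝒜 m) = m.linear := by
  rw [linearPart, ← LinearMap.comp_assoc, cogenerators_comp_barDifferential hm]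
  exact LinearMap.ext fun a => bar_letter m a

variable (𝒜) in
/-- The family with a given coalgebra map as its bar construction. -/
def toFamily (F : TensorCoalgebra A →ₗ[ℝ] TensorCoalgebra B) : Family A B :=
  desuspend 𝒜 (fun n => (cogenerators ∘ₗ F).compMultilinearMap (pureTensor n))

theorem bar_toFamily (F : TensorCoalgebra A →ₗ[ℝ] TensorCoalgebra B) :
    bar 𝒜 (toFamily 𝒜 F) = cogenerators ∘ₗ F := bar_desuspend _

theorem toFamily_zero {F : TensorCoalgebra A →ₗ[ℝ] TensorCoalgebra B} (hF : F 1 = 1) :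
    toFamily 𝒜 F 0 = 0 :=
  desuspend_zero (by rw [LinearMap.comp_apply, hF, cogenerators_one])

theorem barMap_toFamily {F : TensorCoalgebra A →ₗ[ℝ] TensorCoalgebra B} (hF : IsCoalgMap F) :
    barMap 𝒜 (toFamily 𝒜 F) = F :=
  (isCoalgMap_barMap (toFamily_zero hF.one)).ext hF (by
    rw [cogenerators_comp_barMap (toFamily_zero hF.one), bar_toFamily])

theorem toFamily_barMap {f : Family A B} (hf : f 0 = 0) : toFamily 𝒜 (barMap 𝒜 f) = f := by
  rw [toFamily, cogenerators_comp_barMap hf]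
  funext n
  refine MultilinearMap.ext fun v => ?_
  simp only [desuspend, MultilinearMap.compLinearMap_apply, LinearMap.compMultilinearMap_apply,
    bar, liftPure_pureTensor, suspend]
  exact congrArg (f n) (twist_twist n v)

theorem isMorphism_toFamily {m : Family A A} {m' : Family B B} (hm : IsAlgebra 𝒜 m)
    (hm' : IsAlgebra ℬ m') {F : TensorCoalgebra A →ₗ[ℝ] TensorCoalgebra B} (hF : IsCoalgMap F)
    (hd : MapsDegree (tensorGrading 𝒜) (tensorGrading ℬ) 0 F)
    (h : barDifferential ℬ m' ∘ₗ F = F ∘ₗ barDifferential 𝒜 m) :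
    IsMorphism 𝒜 ℬ m m' (toFamily 𝒜 F) := by
  refine isMorphism_of_comm hm hm' (toFamily_zero hF.one) ?_ ?_
  · rw [bar_toFamily]
    exact mapsDegree_cogenerators.comp hd (add_zero 0)
  · rw [barMap_toFamily hF, h]

end Primitive

/-! ### Homotopies: reversal, composition and concatenation -/

section Homotopies

variable {A B C : Type*} [AddCommGroup A] [Module ℝ A] [AddCommGroup B] [Module ℝ B]
  [AddCommGroup C] [Module ℝ C]
variable (𝒜 : ℤ → Submodule ℝ A)
variable (ℬ : ℤ → Submodule ℝ B)
variable (D : TensorCoalgebra A →ₗ[ℝ] TensorCoalgebra A)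
  (D' : TensorCoalgebra B →ₗ[ℝ] TensorCoalgebra B)

/-- A morphism of differential graded tensor coalgebras. -/
structure IsDGMap (F : TensorCoalgebra A →ₗ[ℝ] TensorCoalgebra B) : Prop where
  coalg : IsCoalgMap F
  degree : MapsDegree (tensorGrading 𝒜) (tensorGrading ℬ) 0 F
  comm : D' ∘ₗ F = F ∘ₗ D

variable {𝒜 ℬ D D'}
variable {𝒞 : ℤ → Submodule ℝ C} {D'' : TensorCoalgebra C →ₗ[ℝ] TensorCoalgebra C}

theorem IsDGMap.comp {G : TensorCoalgebra B →ₗ[ℝ] TensorCoalgebra C}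
    {F : TensorCoalgebra A →ₗ[ℝ] TensorCoalgebra B}
    (hG : IsDGMap ℬ 𝒞 D' D'' G) (hF : IsDGMap 𝒜 ℬ D D' F) : IsDGMap 𝒜 𝒞 D D'' (G ∘ₗ F) where
  coalg := hG.coalg.comp hF.coalg
  degree := hG.degree.comp hF.degree (add_zero 0)
  comm := by
    rw [← LinearMap.comp_assoc, hG.comm, LinearMap.comp_assoc, hF.comm, LinearMap.comp_assoc]

variable (𝒜 ℬ D D') [DirectSum.Decomposition 𝒜]

/-- A homotopy of maps between differential graded tensor coalgebras, smooth in `t ∈ ℝ`. -/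
structure IsSmoothHomotopy (F h : ℝ → (TensorCoalgebra A →ₗ[ℝ] TensorCoalgebra B)) : Prop where
  dgMap : ∀ t, IsDGMap 𝒜 ℬ D D' (F t)
  coder : ∀ t, IsCoderivationOver 𝒜 ℬ (F t) (h t)
  smooth : ∀ x (φ : Module.Dual ℝ (TensorCoalgebra B)), ContDiff ℝ ∞ (fun t => φ (F t x))
  smooth_h : ∀ x (φ : Module.Dual ℝ (TensorCoalgebra B)), ContDiff ℝ ∞ (fun t => φ (h t x))
  deriv : ∀ x (φ : Module.Dual ℝ (TensorCoalgebra B)) t,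
    HasDerivAt (fun t => φ (F t x)) (φ (D' (h t x) + h t (D x))) t

/-- `X` and `Y` are the end points of a smooth homotopy. -/
def SmoothHomotopic (X Y : TensorCoalgebra A →ₗ[ℝ] TensorCoalgebra B) : Prop :=
  ∃ F h, IsSmoothHomotopy 𝒜 ℬ D D' F h ∧ F 0 = X ∧ F 1 = Y

variable {𝒜 ℬ D D'}

namespace SmoothHomotopic

variable {X Y : TensorCoalgebra A →ₗ[ℝ] TensorCoalgebra B}

/-- Reversing time changes the sign of the derivative, hence of `h`. -/
theorem symm (h : SmoothHomotopic 𝒜 ℬ D D' X Y) : SmoothHomotopic 𝒜 ℬ D D' Y X := by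
  obtain ⟨F, h, H, h0, h1⟩ := h
  refine ⟨fun t => F (1 - t), fun t => -h (1 - t), ⟨fun t => H.dgMap _, fun t => ?_, fun x φ => ?_,
    fun x φ => ?_, fun x φ t => ?_⟩, by simpa using h1, by simpa using h0⟩
  · obtain ⟨e1, e2, e3⟩ := H.coder (1 - t)
    refine ⟨fun k x hx => ?_, ?_, ?_⟩
    · exact neg_mem (e1 k x hx)
    · rw [LinearMap.neg_apply, e2, neg_zero]
    · have e4 : -h (1 - t) = (-1 : ℝ) • h (1 - t) := (neg_one_smul ℝ _).symm
      rw [e4, LinearMap.comp_smul, e3, TensorProduct.map_smul_left, TensorProduct.map_smul_right,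
        ← smul_add, LinearMap.smul_comp]
  · exact (H.smooth x φ).comp (contDiff_const.sub contDiff_id)
  · rw [show (fun t => φ ((-h (1 - t)) x)) = fun t => -(φ (h (1 - t) x)) from
      funext fun t => map_neg φ _]
    exact ((H.smooth_h x φ).comp (contDiff_const.sub contDiff_id)).neg
  · have := (H.deriv x φ (1 - t)).comp_const_sub 1 t
    refine this.congr_deriv ?_
    have e : ∀ y, (-h (1 - t)) y = -(h (1 - t) y) := fun _ => rfl
    rw [e, e, map_neg, ← neg_add, map_neg]

/-- The coderivation becomes `G h`; since `G` commutes with the differentials, `G (D' h + h D)` has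
the required form. -/
theorem comp_left [DirectSum.Decomposition ℬ] {G : TensorCoalgebra B →ₗ[ℝ] TensorCoalgebra C}
    (h : SmoothHomotopic 𝒜 ℬ D D' X Y) (hG : IsDGMap ℬ 𝒞 D' D'' G) :
    SmoothHomotopic 𝒜 𝒞 D D'' (G ∘ₗ X) (G ∘ₗ Y) := by
  obtain ⟨F, h, H, rfl, rfl⟩ := h
  refine ⟨fun t => G ∘ₗ F t, fun t => G ∘ₗ h t, ⟨fun t => hG.comp (H.dgMap t), fun t => ?_,
    fun x φ => H.smooth x (φ ∘ₗ G), fun x φ => H.smooth_h x (φ ∘ₗ G), fun x φ t => ?_⟩, rfl, rfl⟩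
  · obtain ⟨e1, e2, e3⟩ := H.coder t
    refine ⟨fun k x hx => ?_, ?_, ?_⟩
    · have := hG.degree _ _ (e1 k x hx)
      rwa [add_zero] at this
    · rw [LinearMap.comp_apply, e2, map_zero]
    · rw [← LinearMap.comp_assoc, hG.coalg.comul, LinearMap.comp_assoc, e3, ← LinearMap.comp_assoc,
        LinearMap.comp_add, ← TensorProduct.map_comp, ← TensorProduct.map_comp,
        LinearMap.comp_assoc]
  · have c := congrArg (fun f => f (h t x)) hG.comm
    simp only [LinearMap.comp_apply] at c
    have := H.deriv x (φ ∘ₗ G) t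
    simp only [LinearMap.comp_apply, map_add] at this ⊢
    rwa [c]

/-- The coderivation becomes `h E`. Its Koszul sign is the right one because `E` has degree zero and
commutes with the sign operators. -/
theorem comp_right [DirectSum.Decomposition 𝒞] {E : TensorCoalgebra C →ₗ[ℝ] TensorCoalgebra A}
    (h : SmoothHomotopic 𝒜 ℬ D D' X Y) (hE : IsDGMap 𝒞 𝒜 D'' D E) :
    SmoothHomotopic 𝒞 ℬ D'' D' (X ∘ₗ E) (Y ∘ₗ E) := by
  obtain ⟨F, h, H, rfl, rfl⟩ := h
  refine ⟨fun t => F t ∘ₗ E, fun t => h t ∘ₗ E, ⟨fun t => (H.dgMap t).comp hE, fun t => ?_,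
    fun x φ => H.smooth (E x) φ, fun x φ => H.smooth_h (E x) φ, fun x φ t => ?_⟩, rfl, rfl⟩
  · obtain ⟨e1, e2, e3⟩ := H.coder t
    refine ⟨fun k x hx => ?_, ?_, ?_⟩
    · have := hE.degree _ _ hx
      rw [add_zero] at this
      exact e1 k _ this
    · rw [pureTensor_zero, LinearMap.comp_apply, hE.coalg.one, ← pureTensor_zero Fin.elim0, e2]
    · rw [← LinearMap.comp_assoc, e3, LinearMap.comp_assoc, hE.coalg.comul, ← LinearMap.comp_assoc,
        LinearMap.add_comp, ← TensorProduct.map_comp, ← TensorProduct.map_comp,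
        LinearMap.comp_assoc, parity_comp_of_mapsDegree hE.degree, LinearMap.comp_assoc]
  · have c := congrArg (fun f => f x) hE.comm
    simp only [LinearMap.comp_apply] at c
    have := H.deriv (E x) φ t
    rwa [c] at this

end SmoothHomotopic

/-- A flow is a smooth homotopy that starts at the identity. -/
theorem IsFlow.smoothHomotopic (hD : IsCodifferential 𝒜 D) {δ : TensorCoalgebra A →ₗ[ℝ] A}
    (hδ : Vanish 1 δ) (hd : MapsDegree (tensorGrading 𝒜) (shift 𝒜) (-1) δ)
    {φ : ℝ → (TensorCoalgebra A →ₗ[ℝ] A)} (hφ : IsFlow 𝒜 D δ φ) :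
    SmoothHomotopic 𝒜 𝒜 D D LinearMap.id (geom (letters (φ 1))).ofConv := by
  obtain ⟨h1, h2⟩ := hφ.comm_and_deriv hD hδ hd
  obtain ⟨H', hH⟩ := h2.coderOver (𝒜 := 𝒜) δ
  refine ⟨fun t => (geom (letters (φ t))).ofConv,
    fun t => coderOver 𝒜 (geom (letters (φ t))).ofConv δ,
    ⟨fun t => ⟨isCoalgMap_geom (hφ.vanish t), mapsDegree_geom (hφ.degree t), h1 t⟩, fun t => ?_,
    fun x ψ => polyDeriv_contDiff (h2 x) ψ, fun x ψ => polyDeriv_contDiff (hH x) ψ,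
    fun x ψ t => polyDeriv_hasDerivAt (h2 x) ψ t⟩, ?_, rfl⟩
  · refine ⟨mapsDegree_coderOver (mapsDegree_geom (hφ.degree t)) hd, ?_,
      isCoder_coderOver (isCoalgMap_geom (hφ.vanish t)) δ⟩
    rw [pureTensor_zero]
    exact vanish_one_iff.1 (vanish_coderOver _ hδ)
  · simp only [hφ.zero]
    rw [← id_eq_geom]

variable [DirectSum.Decomposition ℬ] {m : Family A A} {m' : Family B B}

theorem homotopic_refl {f : Family A B} (hf : IsMorphism 𝒜 ℬ m m' f) :
    Homotopic 𝒜 ℬ m m' f f :=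
  ⟨{ N := 1
     τ := fun i => (i : ℕ)
     τ_strictMono := fun i j h => Nat.cast_lt.2 h
     τ_zero := by simp
     τ_last := by simp
     path := fun _ => f
     h := fun _ _ => 0
     path_zero := rfl
     path_one := rfl
     isMorphism := fun _ _ => hf
     isCoderivation := fun _ _ _ => ⟨fun _ _ _ => zero_mem _, rfl, by
      rw [TensorProduct.map_zero_left, TensorProduct.map_zero_right, add_zero, LinearMap.zero_comp,
        LinearMap.comp_zero]⟩
     smooth_path := fun _ _ _ => contDiffOn_const
     smooth_h := fun _ _ _ => contDiffOn_const
     deriv_path := fun _ _ _ _ φ => by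
      simpa using hasDerivWithinAt_const _ _ _ }⟩

/-- A smooth homotopy followed by a homotopy. -/
theorem SmoothHomotopic.trans_homotopic (hm : IsAlgebra 𝒜 m) (hm' : IsAlgebra ℬ m')
    {X Y : TensorCoalgebra A →ₗ[ℝ] TensorCoalgebra B}
    (h : SmoothHomotopic 𝒜 ℬ (barDifferential 𝒜 m) (barDifferential ℬ m') X Y) {k : Family A B}
    (hk : Homotopic 𝒜 ℬ m m' (toFamily 𝒜 Y) k) : Homotopic 𝒜 ℬ m m' (toFamily 𝒜 X) k := by
  obtain ⟨F, h, H, rfl, rfl⟩ := h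
  obtain ⟨K⟩ := hk
  have hbar : ∀ t, barMap 𝒜 (toFamily 𝒜 (F t)) = F t := fun t => barMap_toFamily (H.dgMap t).coalg
  -- Each homotopy is run at double speed on one half of the interval, so the coderivations are
  -- multiplied by two.
  set path : ℝ → Family A B := fun t =>
    if t ≤ 1 / 2 then toFamily 𝒜 (F (2 * t)) else K.path (2 * t - 1) with hpath
  have hτ : ∀ i, 0 ≤ K.τ i := fun i => by
    rw [← K.τ_zero]
    exact K.τ_strictMono.monotone (Fin.zero_le i)
  have p1 : ∀ t ∈ Set.Icc (0 : ℝ) ((1 + K.τ 0) / 2), barMap 𝒜 (path t) = F (2 * t) := fun t ht => by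
    have : t ≤ 1 / 2 := by
      have := ht.2
      rwa [K.τ_zero, add_zero] at this
    simp only [hpath, if_pos this, hbar]
  have p2 : ∀ (i : Fin K.N), ∀ t ∈ Set.Icc ((1 + K.τ i.castSucc) / 2) ((1 + K.τ i.succ) / 2),
      path t = K.path (2 * t - 1) := fun i t ht => by
    have h1 := hτ i.castSucc
    have h2 := ht.1
    -- At `t = 1/2` the first branch of the definition applies, but both homotopies have the value
    -- `toFamily 𝒜 (F 1)` there.
    rcases (show 1 / 2 ≤ t by linarith).eq_or_lt with h3 | h3
    · simp only [hpath, ← h3, le_refl, if_true]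
      norm_num
      exact K.path_zero.symm
    · simp only [hpath, if_neg (not_le.2 h3)]
  have p3 : ∀ (i : Fin K.N), Set.MapsTo (fun t : ℝ => 2 * t - 1)
      (Set.Icc ((1 + K.τ i.castSucc) / 2) ((1 + K.τ i.succ) / 2))
      (Set.Icc (K.τ i.castSucc) (K.τ i.succ)) := fun i t ht =>
    ⟨by have := ht.1; linarith, by have := ht.2; linarith⟩
  have d1 : ∀ t : ℝ, HasDerivAt (fun t : ℝ => 2 * t) 2 t := fun t => by
    simpa using (hasDerivAt_id t).const_mul 2
  have d2 : ∀ t : ℝ, HasDerivAt (fun t : ℝ => 2 * t - 1) 2 t := fun t => (d1 t).sub_const 1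
  have s1 : ContDiff ℝ ∞ (fun t : ℝ => 2 * t) := contDiff_const.mul contDiff_id
  have s2 : ContDiff ℝ ∞ (fun t : ℝ => 2 * t - 1) := s1.sub contDiff_const
  have hcoder : ∀ {X Y : TensorCoalgebra A →ₗ[ℝ] TensorCoalgebra B},
      IsCoderivationOver 𝒜 ℬ X Y → IsCoderivationOver 𝒜 ℬ X ((2 : ℝ) • Y) := fun h =>
    ⟨fun k x hx => Submodule.smul_mem _ _ (h.degree k x hx), by
      rw [LinearMap.smul_apply, h.one, smul_zero], by
      rw [LinearMap.comp_smul, h.coleibniz, TensorProduct.map_smul_left,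
        TensorProduct.map_smul_right, ← smul_add, LinearMap.smul_comp]⟩
  refine ⟨{
    N := K.N + 1
    τ := Fin.cons 0 fun i => (1 + K.τ i) / 2
    τ_strictMono := ?_
    τ_zero := rfl
    τ_last := ?_
    path := path
    h := Fin.cons (fun t => (2 : ℝ) • h (2 * t)) fun i t => (2 : ℝ) • K.h i (2 * t - 1)
    path_zero := ?_
    path_one := ?_
    isMorphism := ?_
    isCoderivation := ?_
    smooth_path := ?_
    smooth_h := ?_
    deriv_path := ?_ }⟩
  · refine Fin.strictMono_iff_lt_succ.2 fun i => ?_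
    refine Fin.cases ?_ (fun i => ?_) i
    · simp only [Fin.castSucc_zero, Fin.cons_zero, Fin.cons_succ, K.τ_zero]
      norm_num
    · rw [← Fin.succ_castSucc, Fin.cons_succ, Fin.cons_succ]
      have := K.τ_strictMono (Fin.castSucc_lt_succ (i := i))
      linarith
  · rw [← Fin.succ_last, Fin.cons_succ, K.τ_last]
    norm_num
  · simp only [hpath]
    norm_num
  · simp only [hpath]
    norm_num
    exact K.path_one
  · intro t ht
    simp only [hpath]
    split_ifs with h
    · exact isMorphism_toFamily hm hm' (H.dgMap _).coalg (H.dgMap _).degree (H.dgMap _).comm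
    · exact K.isMorphism _ ⟨by linarith, by have := ht.2; linarith⟩
  · refine Fin.cases (fun t ht => ?_) (fun i t ht => ?_)
    · simp only [Fin.castSucc_zero, Fin.cons_zero, Fin.cons_succ] at ht ⊢
      rw [p1 t ht]
      exact hcoder (H.coder _)
    · rw [← Fin.succ_castSucc, Fin.cons_succ, Fin.cons_succ] at ht
      rw [Fin.cons_succ, p2 i t ht]
      exact hcoder (K.isCoderivation i _ (p3 i ht))
  · refine Fin.cases (fun x φ => ?_) (fun i x φ => ?_)
    · simp only [Fin.castSucc_zero, Fin.cons_zero, Fin.cons_succ]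
      exact ((H.smooth x φ).comp s1).contDiffOn.congr fun t ht => by rw [p1 t ht]; rfl
    · rw [← Fin.succ_castSucc, Fin.cons_succ, Fin.cons_succ]
      exact ((K.smooth_path i x φ).comp s2.contDiffOn (p3 i)).congr fun t ht => by
        simp only [p2 i t ht]; rfl
  · refine Fin.cases (fun x φ => ?_) (fun i x φ => ?_)
    · simp only [Fin.cons_zero, LinearMap.smul_apply, map_smul]
      exact (((H.smooth_h x φ).comp s1).const_smul (2 : ℝ)).contDiffOn
    · rw [← Fin.succ_castSucc, Fin.cons_succ, Fin.cons_succ]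
      simp only [Fin.cons_succ, LinearMap.smul_apply, map_smul]
      exact ((K.smooth_h i x φ).comp s2.contDiffOn (p3 i)).const_smul (2 : ℝ)
  · refine Fin.cases (fun t ht x φ => ?_) (fun i t ht x φ => ?_)
    · simp only [Fin.castSucc_zero, Fin.cons_zero, Fin.cons_succ, LinearMap.smul_apply] at ht ⊢
      have := (((H.deriv x φ (2 * t)).comp t (d1 t)).hasDerivWithinAt
        (s := Set.Icc (0 : ℝ) ((1 + K.τ 0) / 2))).congr
        (f₁ := fun t => φ (barMap 𝒜 (path t) x)) (fun t ht => by rw [p1 t ht]; rfl)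
        (by rw [p1 t ht]; rfl)
      refine this.congr_deriv ?_
      rw [map_smul, ← smul_add, map_smul, smul_eq_mul, mul_comm]
    · rw [← Fin.succ_castSucc, Fin.cons_succ, Fin.cons_succ] at ht ⊢
      rw [Fin.cons_succ]
      have := ((K.deriv_path i _ (p3 i ht) x φ).comp t (d2 t).hasDerivWithinAt (p3 i)).congr
        (f₁ := fun t => φ (barMap 𝒜 (path t) x)) (fun t ht => by rw [p2 i t ht]; rfl)
        (by rw [p2 i t ht]; rfl)
      refine this.congr_deriv ?_
      rw [LinearMap.smul_apply, LinearMap.smul_apply, map_smul, ← smul_add, map_smul, smul_eq_mul,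
        mul_comm]

end Homotopies

/-! ### Quasi-isomorphisms and homotopy equivalences -/

section Equivalence

variable {A B : Type*} [AddCommGroup A] [Module ℝ A] [AddCommGroup B] [Module ℝ B]
variable {𝒜 : ℤ → Submodule ℝ A} {ℬ : ℤ → Submodule ℝ B}
variable {m : Family A A} {m' : Family B B} {f g : Family A B}

theorem Family.HasDegree.linear {d : ℕ → ℤ} (h : f.HasDegree 𝒜 ℬ d) :
    MapsDegree 𝒜 ℬ (d 1) f.linear := fun k x hx => by
  have := h 1 (fun _ => k) (fun _ => x) (fun _ => hx)
  rwa [Fin.sum_univ_one] at this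

variable [DirectSum.Decomposition 𝒜]

theorem IsMorphism.isQuasiIso_iff (hf : IsMorphism 𝒜 ℬ m m' f) : IsQuasiIso 𝒜 ℬ hf ↔
    (∀ x, m.linear x = 0 → (∃ y, m'.linear y = f.linear x) → ∃ y, m.linear y = x) ∧
      ∀ y, m'.linear y = 0 → ∃ x z, m.linear x = 0 ∧ f.linear x + m'.linear z = y := by
  rw [IsQuasiIso, Function.Bijective, cohomologyMap_injective_iff, cohomologyMap_surjective_iff]

variable [DirectSum.Decomposition ℬ]

theorem IsMorphism.isDGMap (hm : IsAlgebra 𝒜 m) (hm' : IsAlgebra ℬ m')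
    (hf : IsMorphism 𝒜 ℬ m m' f) :
    IsDGMap 𝒜 ℬ (barDifferential 𝒜 m) (barDifferential ℬ m') (barMap 𝒜 f) :=
  ⟨isCoalgMap_barMap hf.zero, mapsDegree_barMap hf.zero hf.mapsDegree, hf.comm hm hm'⟩

theorem IsAlgebra.linear_linear (hm : IsAlgebra 𝒜 m) (x : A) : m.linear (m.linear x) = 0 := by
  have hD := hm.isCodifferential
  have h := congrArg (fun f => cogenerators (f (letter x))) hD.sq
  simp only [LinearMap.comp_apply, LinearMap.zero_apply, map_zero] at h
  rwa [hD.apply_letter, hD.apply_letter, cogenerators_letter, linearPart_barDifferential hm.zero]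
    at h

/-- On a cocycle `x` the derivative of the linear part is the boundary of the linear part of `h` at
`x`, which `φ` kills. -/
theorem Homotopy.functional_eq (hm : IsAlgebra 𝒜 m) (hm' : IsAlgebra ℬ m')
    (K : Homotopy 𝒜 ℬ m m' f g) {x : A} (hx : m.linear x = 0) {φ : Module.Dual ℝ B}
    (hφ : ∀ y, φ (m'.linear y) = 0) : φ (g.linear x) = φ (f.linear x) := by
  have hτ : ∀ i, K.τ i ∈ Set.Icc (0 : ℝ) 1 := fun i => by
    rw [← K.τ_zero, ← K.τ_last]
    exact ⟨K.τ_strictMono.monotone (Fin.zero_le i), K.τ_strictMono.monotone (Fin.le_last i)⟩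
  set γ : ℝ → ℝ := fun t => φ (cogenerators (barMap 𝒜 (K.path t) (letter x))) with hγ
  have hγt : ∀ t ∈ Set.Icc (0 : ℝ) 1, γ t = φ ((K.path t).linear x) := fun t ht => by
    rw [← linearPart_barMap (𝒜 := 𝒜) (K.isMorphism t ht).zero]
    rfl
  have hD := hm.isCodifferential
  have hD' := hm'.isCodifferential
  have hder : ∀ i : Fin K.N, ∀ t ∈ Set.Icc (K.τ i.castSucc) (K.τ i.succ),
      HasDerivWithinAt γ 0 (Set.Icc (K.τ i.castSucc) (K.τ i.succ)) t := fun i t ht => by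
    have h01 : t ∈ Set.Icc (0 : ℝ) 1 :=
      ⟨(hτ i.castSucc).1.trans ht.1, ht.2.trans (hτ i.succ).2⟩
    have hF := isCoalgMap_barMap (𝒜 := 𝒜) (K.isMorphism t h01).zero
    obtain ⟨_, e2, e3⟩ := K.isCoderivation i t ht
    rw [pureTensor_zero] at e2
    have hc : IsCoder (barMap 𝒜 (K.path t) ∘ₗ tensorParity 𝒜) (barMap 𝒜 (K.path t)) (K.h i t) := e3
    have := K.deriv_path i t ht (letter x) (φ ∘ₗ cogenerators)
    rw [hD.apply_letter, linearPart_barDifferential hm.zero, hx, map_zero, map_zero, add_zero,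
      hc.apply_letter (hF.comp isCoalgMap_tensorParity).one hF.one e2, hD'.apply_letter,
      LinearMap.comp_apply, cogenerators_letter, linearPart_barDifferential hm'.zero, hφ] at this
    exact this
  -- The pieces fit together because the path is a single function on the interval; only the
  -- coderivations may jump.
  have hconst : ∀ i, γ (K.τ i) = γ (K.τ 0) := fun i => by
    induction i using Fin.induction with
    | zero => rfl
    | succ i ih =>
      rw [← ih]
      have hlt := K.τ_strictMono (Fin.castSucc_lt_succ (i := i))
      exact constant_of_has_deriv_right_zero (fun t ht => (hder i t ht).continuousWithinAt)
        (fun t ht => (hder i t ⟨ht.1, ht.2.le⟩).mono_of_mem_nhdsWithin (Icc_mem_nhdsGE_of_mem ht))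
        _ ⟨hlt.le, le_rfl⟩
  have h0 := hγt 0 ⟨le_rfl, zero_le_one⟩
  have h1 := hγt 1 ⟨zero_le_one, le_rfl⟩
  rw [K.path_zero] at h0
  rw [K.path_one] at h1
  rw [← h0, ← h1, ← K.τ_last, hconst, K.τ_zero]

/-- The linear parts of homotopic morphisms induce the same map on cohomology. -/
theorem Homotopic.exists_linear_eq (hm : IsAlgebra 𝒜 m) (hm' : IsAlgebra ℬ m')
    (h : Homotopic 𝒜 ℬ m m' f g) {x : A} (hx : m.linear x = 0) :
    ∃ y, g.linear x + m'.linear y = f.linear x := by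
  obtain ⟨K⟩ := h
  -- The curve is differentiable only after applying functionals, so the boundary is not obtained by
  -- integration: a functional would separate a non-boundary from all boundaries.
  by_contra hn
  push Not at hn
  have : f.linear x - g.linear x ∉ LinearMap.range m'.linear := by
    rintro ⟨y, hy⟩
    exact hn y (by rw [hy, add_sub_cancel])
  obtain ⟨φ, hφ, hker⟩ := Submodule.exists_le_ker_of_notMem this
  refine hφ ?_
  rw [map_sub, K.functional_eq hm hm' hx (fun y => hker ⟨y, rfl⟩), sub_self]

theorem linear_comp {C : Type*} [AddCommGroup C] [Module ℝ C] {g : Family B C} (hg : g 0 = 0)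
    (hf : f 0 = 0) (x : A) : (comp 𝒜 ℬ g f).linear x = g.linear (f.linear x) := by
  rw [← linearPart_barMap (𝒜 := 𝒜) (comp_zero hg hf), barMap_comp hg hf,
    linearPart_comp _ (isCoalgMap_barMap hf), linearPart_barMap hf, linearPart_barMap hg]

theorem linear_idMorphism (x : A) : (idMorphism A).linear x = x := rfl

/-- On cocycles, both composites of the linear parts of `f` and `g` are the identity up to
boundaries: `g f` gives injectivity and `f g` surjectivity on cohomology. -/
theorem isQuasiIso_of_isHomotopyEquivalence (hm : IsAlgebra 𝒜 m) (hm' : IsAlgebra ℬ m')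
    (hf : IsMorphism 𝒜 ℬ m m' f) (h : IsHomotopyEquivalence 𝒜 ℬ m m' f) :
    IsQuasiIso 𝒜 ℬ hf := by
  obtain ⟨g, hg, hgf, hfg⟩ := h
  rw [hf.isQuasiIso_iff]
  refine ⟨fun x hx ⟨y, hy⟩ => ?_, fun y hy => ?_⟩
  · obtain ⟨z, hz⟩ := hgf.exists_linear_eq hm hm hx
    rw [linear_comp hg.zero hf.zero, linear_idMorphism, ← hy, ← hg.chain] at hz
    exact ⟨g.linear y - z, by rw [map_sub, ← hz, add_sub_cancel_right]⟩
  · obtain ⟨z, hz⟩ := hfg.exists_linear_eq hm' hm' hy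
    rw [linear_comp hf.zero hg.zero, linear_idMorphism] at hz
    exact ⟨g.linear y, -z, by rw [hg.chain, hy, map_zero],
      by rw [← hz, map_neg, add_neg_cancel_right]⟩

theorem SmoothHomotopic.homotopic (hm : IsAlgebra 𝒜 m) (hm' : IsAlgebra ℬ m')
    {X Y : TensorCoalgebra A →ₗ[ℝ] TensorCoalgebra B}
    (h : SmoothHomotopic 𝒜 ℬ (barDifferential 𝒜 m) (barDifferential ℬ m') X Y) :
    Homotopic 𝒜 ℬ m m' (toFamily 𝒜 X) (toFamily 𝒜 Y) := by
  refine h.trans_homotopic hm hm' (homotopic_refl ?_)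
  obtain ⟨F, _, H, _, rfl⟩ := h
  exact isMorphism_toFamily hm hm' (H.dgMap 1).coalg (H.dgMap 1).degree (H.dgMap 1).comm

theorem toFamily_id : toFamily 𝒜 LinearMap.id = idMorphism A := by
  rw [← barMap_id (𝒜 := 𝒜), toFamily_barMap rfl]

/-- For a solution `s` without obstruction, the first component of the obstruction makes `G` commute
with the differentials and the second makes `F ∘ G` the end point of a flow from the identity. -/
theorem IsQuasiIso.exists_right_inverse (hm : IsAlgebra 𝒜 m) (hm' : IsAlgebra ℬ m')
    {hf : IsMorphism 𝒜 ℬ m m' f} (h : IsQuasiIso 𝒜 ℬ hf) :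
    ∃ g, IsMorphism ℬ 𝒜 m' m g ∧ SmoothHomotopic ℬ ℬ (barDifferential ℬ m')
      (barDifferential ℬ m') LinearMap.id (barMap 𝒜 f ∘ₗ barMap ℬ g) := by
  have hD := hm.isCodifferential
  have hD' := hm'.isCodifferential
  have hF := hf.isDGMap hm hm'
  have d1 : MapsDegree 𝒜 𝒜 1 m.linear := hm.degree.linear
  have d2 : MapsDegree ℬ ℬ 1 m'.linear := hm'.degree.linear
  have d3 : MapsDegree 𝒜 ℬ 0 f.linear := hf.degree.linear
  obtain ⟨S, hSd, hS⟩ := exists_cone_contraction d1 d2 d3 hm.linear_linear hm'.linear_linear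
    (hf.chain 𝒜 ℬ) h
  have e1 := linearPart_barDifferential (𝒜 := 𝒜) hm.zero
  have e2 := linearPart_barDifferential (𝒜 := ℬ) hm'.zero
  have e3 := linearPart_barMap (𝒜 := 𝒜) hf.zero
  obtain ⟨s, hs, hob⟩ := exists_inverse_of_contraction hD hD' hF.coalg hF.degree hF.comm
    hSd.cone_shift
    (by
      rw [e1, e2, e3]
      exact coneDifferential_coneDifferential hm.linear_linear hm'.linear_linear (hf.chain 𝒜 ℬ))
    (by
      rw [e1, e2, e3]
      exact (mapsDegree_coneDifferential d1 d2 d3).cone_shift)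
    (by
      rw [e1, e2, e3]
      exact hS)
  set G := (geom (letters (LinearMap.fst ℝ A B ∘ₗ s))).ofConv with hGdef
  have hG : IsCoalgMap G := hs.isCoalgMap
  have hGd : MapsDegree (tensorGrading ℬ) (tensorGrading 𝒜) 0 G := mapsDegree_geom hs.degree_fst
  have hπG : cogenerators ∘ₗ G = LinearMap.fst ℝ A B ∘ₗ s := cogenerators_comp_geom hs.vanish_fst
  have o1 : cogenerators ∘ₗ barDifferential 𝒜 m ∘ₗ G -
      (LinearMap.fst ℝ A B ∘ₗ s) ∘ₗ barDifferential ℬ m' = 0 :=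
    congrArg (fun o => LinearMap.fst ℝ A B ∘ₗ o) hob
  have o2 : cogenerators ∘ₗ barMap 𝒜 f ∘ₗ G -
      flowEnd ℬ (barDifferential ℬ m') (LinearMap.snd ℝ A B ∘ₗ s) = 0 :=
    congrArg (fun o => LinearMap.snd ℝ A B ∘ₗ o) hob
  have hcomm : barDifferential 𝒜 m ∘ₗ G = G ∘ₗ barDifferential ℬ m' := by
    rw [← sub_eq_zero, comm_sub_eq_coderOver hD' hD hG hGd, hπG, o1]
    simp [coderOver, letters_zero]
  have hflow := hs.isFlow hD'
  have hH := hflow.smoothHomotopic hD' hs.vanish_snd hs.degree_snd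
  -- The vanishing obstruction compares projections to letters only, and these determine coalgebra
  -- maps.
  have hend : (geom (letters (Classical.epsilon (IsFlow ℬ (barDifferential ℬ m')
      (LinearMap.snd ℝ A B ∘ₗ s)) 1))).ofConv = barMap 𝒜 f ∘ₗ G :=
    (isCoalgMap_geom (hflow.vanish 1)).ext (hF.coalg.comp hG) (by
      rw [cogenerators_comp_geom (hflow.vanish 1)]
      exact (sub_eq_zero.1 o2).symm)
  refine ⟨toFamily ℬ G, isMorphism_toFamily hm' hm hG hGd hcomm, ?_⟩
  rw [barMap_toFamily hG, ← hend]
  exact hH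

/-- The homotopy right inverse `g` of `f` has in turn a homotopy right inverse `k`, and `g f ∼ id`
follows formally from `f g ∼ id` and `g k ∼ id`. -/
theorem IsQuasiIso.isHomotopyEquivalence (hm : IsAlgebra 𝒜 m) (hm' : IsAlgebra ℬ m')
    {hf : IsMorphism 𝒜 ℬ m m' f} (h : IsQuasiIso 𝒜 ℬ hf) :
    IsHomotopyEquivalence 𝒜 ℬ m m' f := by
  obtain ⟨g, hg, hfg⟩ := h.exists_right_inverse hm hm'
  have hfg' : Homotopic ℬ ℬ m' m' (comp ℬ 𝒜 f g) (idMorphism B) := by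
    have := hfg.symm.homotopic hm' hm'
    rwa [← barMap_comp hf.zero hg.zero, toFamily_barMap (comp_zero hf.zero hg.zero), toFamily_id]
      at this
  -- On cohomology `f g` is the identity and `f` is bijective, so `g` is its inverse. Only the
  -- homotopy for `f g` and the injectivity of `f` enter.
  have hgq : IsQuasiIso ℬ 𝒜 hg := by
    rw [hf.isQuasiIso_iff] at h
    rw [hg.isQuasiIso_iff]
    have key : ∀ y, m'.linear y = 0 → ∃ z, y + m'.linear z = f.linear (g.linear y) := fun y hy => by
      have := hfg'.exists_linear_eq hm' hm' hy
      rwa [linear_comp hf.zero hg.zero] at this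
    refine ⟨fun y hy ⟨x, hx⟩ => ?_, fun x hx => ?_⟩
    · obtain ⟨z, hz⟩ := key y hy
      rw [← hx, ← hf.chain] at hz
      exact ⟨f.linear x - z, by rw [map_sub, ← hz, add_sub_cancel_right]⟩
    · have hfx : m'.linear (f.linear x) = 0 := by rw [hf.chain, hx, map_zero]
      obtain ⟨z, hz⟩ := key _ hfx
      obtain ⟨w, hw⟩ := h.1 (x - g.linear (f.linear x))
        (by rw [map_sub, hx, hg.chain, hfx, map_zero, sub_zero])
        ⟨-z, by rw [map_sub, ← hz, map_neg, sub_add_cancel_left]⟩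
      exact ⟨f.linear x, w, hfx, by rw [hw, add_sub_cancel]⟩
  obtain ⟨k, hk, hgk⟩ := hgq.exists_right_inverse hm' hm
  refine ⟨g, hg, ?_, hfg'⟩
  have hF := hf.isDGMap hm hm'
  have hG := hg.isDGMap hm' hm
  have hK := hk.isDGMap hm hm'
  -- The chain is `g f ∼ g f g k ∼ g k ∼ id`. Its links are smooth homotopies, and their
  -- concatenation is only piecewise smooth.
  have s1 := hgk.comp_left (hG.comp hF)
  have s2 := (hfg.symm.comp_right hK).comp_left hG
  rw [LinearMap.id_comp] at s2
  rw [LinearMap.comp_id] at s1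
  have := s1.trans_homotopic hm hm (s2.trans_homotopic hm hm (hgk.symm.homotopic hm hm))
  rwa [← barMap_comp hg.zero hf.zero, toFamily_barMap (comp_zero hg.zero hf.zero), toFamily_id]
    at this

end Equivalence

end AInfty

end

theorem mainTheorem4 {A : Type*} {B : Type*} [AddCommGroup A] [Module ℝ A] [AddCommGroup B]
    [Module ℝ B] (𝒜 : ℤ → Submodule ℝ A) [DirectSum.Decomposition 𝒜]
    (ℬ : ℤ → Submodule ℝ B) [DirectSum.Decomposition ℬ]
    (m : AInfty.Family A A) (m' : AInfty.Family B B)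
    (hm : AInfty.IsAlgebra 𝒜 m) (hm' : AInfty.IsAlgebra ℬ m')
    (f : AInfty.Family A B) (hf : AInfty.IsMorphism 𝒜 ℬ m m' f) :
    AInfty.IsQuasiIso 𝒜 ℬ hf ↔ AInfty.IsHomotopyEquivalence 𝒜 ℬ m m' f := by
  exact ⟨fun h => AInfty.IsQuasiIso.isHomotopyEquivalence hm hm' h,
    AInfty.isQuasiIso_of_isHomotopyEquivalence hm hm' hf⟩
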